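/- Let $N$ be a non-empty, orientable, topologically finite $3$-manifold with an ideal triangulation $\mathcal T$: $N=\big(\bigsqcup_{k=1}^n(\Delta_k\setminus\Delta_k^{(0)})\big)/\Phi$, where $\Delta_1,\dots,\Delta_n$ are finitely many disjoint standard Euclidean $3$-simplices, $\Delta_k^{(0)}$ is the set of vertices of $\Delta_k$, and $\Phi$ is a collection of Euclidean isometries that glues their $2$-dimensional faces in pairs (no face being glued to itself); orientability means that the simplices can be oriented so that all face pairings reverse the induced orientations. Let $N^{(1)}$ be the union of the ideal edges in $N$. A *hyperbolic cone-manifold structure* on $N$ is a length metric that induces the topology of $N$ (with value $\infty$ exactly between points of different components, if $N$ is not connected) such that every point of $N$ is the centre of a ball isometric to a ball in $\mathbb H^3$, or to a ball centred at a point of the axis in $\mathbb H^3(\alpha)$ for some $\alpha>0$. Here $\mathbb H^3(\alpha)$ has cylindrical coordinates $r\ge 0$, $\theta\in\mathbb R/\alpha\mathbb Z$, $h\in\mathbb R$ (with $\theta$ collapsed on the axis $r=0$) and the length metric of $dr^2+\sinh^2 r\,d\theta^2+\cosh^2 r\,dh^2$. Its *singular locus* is the set of points that are not the centre of a ball isometric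 to a ball in $\mathbb H^3$. Then $N$ is non-compact, and it has a hyperbolic cone-manifold structure that is complete, has singular locus contained in $N^{(1)}$, and has volume exactly $$\operatorname{vol}(N)=n\cdot v_3,$$ where $v_3$ is the volume of the regular ideal tetrahedron in $\mathbb H^3$. Moreover, the structure can be chosen such that every tetrahedron of $\mathcal T$ is regular ideal: for each $k$, the map $\Delta_k\setminus\Delta_k^{(0)}\to\mathbb H^3$ onto the regular ideal tetrahedron that takes vertices to ideal vertices and is affine in the projective (Klein) model is, away from the edges, locally an isometry from the metric of $N$ pulled back to $\Delta_k$ to the metric of $\mathbb H^3$. -/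

import Mathlib

open scoped ENNReal MeasureTheory RealInnerProductSpace

noncomputable section

/-! ## Hyperbolic 3-space (projective model) and its regular ideal tetrahedron -/

/-- Hyperbolic 3-space `ℍ³` in the projective (Klein) model: the open unit ball of `ℝ³`, with the
hyperbolic metric given below. Hyperbolic convex hulls are Euclidean convex hulls in this model, and
the sphere at infinity is the unit sphere. -/
structure HypSpace where
  pt : EuclideanSpace ℝ (Fin 3)
  norm_lt : ‖pt‖ < 1

namespace HypSpace

/-- The hyperbolic cosine of the hyperbolic distance. -/
def coshDist (x y : HypSpace) : ℝ :=
  (1 - ⟪x.pt, y.pt⟫) / (√(1 - ‖x.pt‖ ^ 2) * √(1 - ‖y.pt‖ ^ 2))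

lemma one_sub_pos (x : HypSpace) : 0 < 1 - ‖x.pt‖ ^ 2 := by
  have h := x.norm_lt
  have h0 := norm_nonneg x.pt
  nlinarith

lemma one_sub_inner_pos (x y : HypSpace) : 0 < 1 - ⟪x.pt, y.pt⟫ := by
  have h := real_inner_le_norm x.pt y.pt
  have hx := x.norm_lt
  have hy := y.norm_lt
  have h0 := norm_nonneg x.pt
  have h1 := norm_nonneg y.pt
  nlinarith

lemma coshDist_comm (x y : HypSpace) : coshDist x y = coshDist y x := by
  unfold coshDist
  rw [real_inner_comm, mul_comm (√(1 - ‖x.pt‖ ^ 2))]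

lemma coshDist_self (x : HypSpace) : coshDist x x = 1 := by
  unfold coshDist
  rw [Real.mul_self_sqrt x.one_sub_pos.le, real_inner_self_eq_norm_sq, div_self x.one_sub_pos.ne']

lemma coshDist_pos (x y : HypSpace) : 0 < coshDist x y :=
  div_pos (one_sub_inner_pos x y)
    (mul_pos (Real.sqrt_pos.2 x.one_sub_pos) (Real.sqrt_pos.2 y.one_sub_pos))

lemma inner_expand (x y z : EuclideanSpace ℝ (Fin 3)) :
    ⟪x - y, z - y⟫ = ⟪x, z⟫ - ⟪x, y⟫ - ⟪y, z⟫ + ‖y‖ ^ 2 := by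
  rw [inner_sub_left, inner_sub_right, inner_sub_right, real_inner_self_eq_norm_sq]
  ring

lemma coshDist_sq_sub_one (x y : HypSpace) :
    coshDist x y ^ 2 - 1 =
      (⟪x.pt - y.pt, y.pt⟫ ^ 2 + (1 - ‖y.pt‖ ^ 2) * ‖x.pt - y.pt‖ ^ 2) /
        ((1 - ‖x.pt‖ ^ 2) * (1 - ‖y.pt‖ ^ 2)) := by
  have hx := x.one_sub_pos
  have hy := y.one_sub_pos
  have e : coshDist x y ^ 2 = (1 - ⟪x.pt, y.pt⟫) ^ 2 / ((1 - ‖x.pt‖ ^ 2) * (1 - ‖y.pt‖ ^ 2)) := by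
    unfold coshDist
    rw [div_pow, mul_pow, Real.sq_sqrt hx.le, Real.sq_sqrt hy.le]
  have h1 : ‖x.pt - y.pt‖ ^ 2 = ‖x.pt‖ ^ 2 - 2 * ⟪x.pt, y.pt⟫ + ‖y.pt‖ ^ 2 :=
    norm_sub_sq_real _ _
  have h2 : ⟪x.pt - y.pt, y.pt⟫ = ⟪x.pt, y.pt⟫ - ‖y.pt‖ ^ 2 := by
    rw [inner_sub_left, real_inner_self_eq_norm_sq]
  rw [e, h1, h2]
  field_simp
  ring

lemma one_le_coshDist (x y : HypSpace) : 1 ≤ coshDist x y := by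
  have h : 0 ≤ coshDist x y ^ 2 - 1 := by
    rw [coshDist_sq_sub_one]
    have hx := x.one_sub_pos
    have hy := y.one_sub_pos
    positivity
  have := coshDist_pos x y
  nlinarith

lemma eq_of_coshDist_eq_one {x y : HypSpace} (h : coshDist x y = 1) : x = y := by
  have e := coshDist_sq_sub_one x y
  have hx := x.one_sub_pos
  have hy := y.one_sub_pos
  rw [h, one_pow, sub_self, eq_comm, div_eq_zero_iff] at e
  rcases e with e | e
  · have : (1 - ‖y.pt‖ ^ 2) * ‖x.pt - y.pt‖ ^ 2 = 0 := by
      have h1 := sq_nonneg ⟪x.pt - y.pt, y.pt⟫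
      have h2 : 0 ≤ (1 - ‖y.pt‖ ^ 2) * ‖x.pt - y.pt‖ ^ 2 := by positivity
      linarith
    have h3 : ‖x.pt - y.pt‖ = 0 := by
      rcases mul_eq_zero.1 this with h | h
      · exact absurd h hy.ne'
      · exact pow_eq_zero_iff (two_ne_zero) |>.1 h
    have h4 : x.pt = y.pt := sub_eq_zero.1 (norm_eq_zero.1 h3)
    cases x; cases y; simp_all
  · exact absurd e (mul_pos hx hy).ne'

lemma coshDist_le (x y z : HypSpace) :
    coshDist x z ≤ coshDist x y * coshDist y z +
      √(coshDist x y ^ 2 - 1) * √(coshDist y z ^ 2 - 1) := by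
  have hx := x.one_sub_pos
  have hy := y.one_sub_pos
  have hz := z.one_sub_pos
  set s := ⟪x.pt - y.pt, y.pt⟫ with hs
  set t := ⟪z.pt - y.pt, y.pt⟫ with ht
  set P := ‖x.pt - y.pt‖ with hP
  set Q := ‖z.pt - y.pt‖ with hQ
  set r := ⟪x.pt - y.pt, z.pt - y.pt⟫ with hr
  have hr2 : |r| ≤ P * Q := abs_real_inner_le_norm _ _
  rw [coshDist_comm y z, ← Real.sqrt_mul (by nlinarith [one_le_coshDist x y]),
    coshDist_sq_sub_one, coshDist_sq_sub_one]
  rw [← hs, ← ht, ← hP, ← hQ]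
  have ea := Real.sq_sqrt hx.le
  have eb := Real.sq_sqrt hy.le
  have ec := Real.sq_sqrt hz.le
  have ha := Real.sqrt_pos.2 hx
  have hb := Real.sqrt_pos.2 hy
  have hc := Real.sqrt_pos.2 hz
  set a := √(1 - ‖x.pt‖ ^ 2)
  set b := √(1 - ‖y.pt‖ ^ 2)
  set c := √(1 - ‖z.pt‖ ^ 2)
  have e1 : coshDist x z - coshDist x y * coshDist z y = -(s * t + b ^ 2 * r) / (a * b ^ 2 * c) := by
    have h1 : r = ⟪x.pt, z.pt⟫ - ⟪x.pt, y.pt⟫ - ⟪y.pt, z.pt⟫ + ‖y.pt‖ ^ 2 := inner_expand _ _ _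
    have h2 : s = ⟪x.pt, y.pt⟫ - ‖y.pt‖ ^ 2 := by
      rw [hs, inner_sub_left, real_inner_self_eq_norm_sq]
    have h3 : t = ⟪y.pt, z.pt⟫ - ‖y.pt‖ ^ 2 := by
      rw [ht, inner_sub_left, real_inner_self_eq_norm_sq, real_inner_comm]
    have h4 : ‖y.pt‖ ^ 2 = 1 - b ^ 2 := by linarith
    change (1 - ⟪x.pt, z.pt⟫) / (a * c) -
      (1 - ⟪x.pt, y.pt⟫) / (a * b) * ((1 - ⟪z.pt, y.pt⟫) / (c * b)) = _
    rw [real_inner_comm y.pt z.pt, h1, h2, h3, h4]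
    field_simp
    ring
  have key : -(s * t + b ^ 2 * r) / (a * b ^ 2 * c) ≤
      √((s ^ 2 + (1 - ‖y.pt‖ ^ 2) * P ^ 2) / ((1 - ‖x.pt‖ ^ 2) * (1 - ‖y.pt‖ ^ 2)) *
        ((t ^ 2 + (1 - ‖y.pt‖ ^ 2) * Q ^ 2) / ((1 - ‖z.pt‖ ^ 2) * (1 - ‖y.pt‖ ^ 2)))) := by
    apply Real.le_sqrt_of_sq_le
    rw [← ea, ← eb, ← ec, div_mul_div_comm, div_pow]
    have e2 : (a * b ^ 2 * c) ^ 2 = a ^ 2 * b ^ 2 * (c ^ 2 * b ^ 2) := by ring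
    rw [e2]
    gcongr
    have h1 : r ^ 2 ≤ P ^ 2 * Q ^ 2 := by
      rw [← mul_pow, ← sq_abs]
      gcongr
    have h2 : 2 * (s * t) * r ≤ s ^ 2 * Q ^ 2 + t ^ 2 * P ^ 2 := by
      have h3 : 2 * (s * t) * r ≤ 2 * (|s| * |t|) * (P * Q) := by
        calc 2 * (s * t) * r ≤ |2 * (s * t) * r| := le_abs_self _
          _ = 2 * (|s| * |t|) * |r| := by simp [abs_mul]
          _ ≤ _ := by gcongr
      have h4 := sq_nonneg (|s| * Q - |t| * P)
      have h5 := sq_abs s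
      have h6 := sq_abs t
      nlinarith
    have hb2 : 0 ≤ b ^ 2 := by positivity
    nlinarith [mul_le_mul_of_nonneg_left h2 hb2, mul_le_mul_of_nonneg_left h1 (mul_nonneg hb2 hb2)]
  linarith

/-- The hyperbolic metric: `cosh d(x, y) = (1 - x·y) / √((1 - |x|²)(1 - |y|²))`. -/
instance : MetricSpace HypSpace where
  dist x y := Real.arcosh (coshDist x y)
  dist_self x := by rw [coshDist_self, Real.arcosh_zero]
  dist_comm x y := by rw [coshDist_comm]
  dist_triangle x y z := by
    have hxy := one_le_coshDist x y
    have hyz := one_le_coshDist y z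
    have h0 := add_nonneg (Real.arcosh_nonneg hxy) (Real.arcosh_nonneg hyz)
    have h : coshDist x z ≤ Real.cosh (Real.arcosh (coshDist x y) + Real.arcosh (coshDist y z)) := by
      rw [Real.cosh_add, Real.cosh_arcosh hxy, Real.cosh_arcosh hyz, Real.sinh_arcosh hxy,
        Real.sinh_arcosh hyz]
      exact coshDist_le x y z
    have h1 := (Real.arcosh_le_arcosh (coshDist_pos x z) (Real.cosh_pos _)).2 h
    rwa [Real.arcosh_cosh h0] at h1
  eq_of_dist_eq_zero {x y} h :=
    eq_of_coshDist_eq_one ((Real.arcosh_eq_zero_iff (one_le_coshDist x y)).1 h)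

/-- The four vertices of a regular Euclidean tetrahedron inscribed in the unit sphere. -/
def idealVertex : Fin 4 → EuclideanSpace ℝ (Fin 3) :=
  ![!₂[1 / √3, 1 / √3, 1 / √3], !₂[1 / √3, -(1 / √3), -(1 / √3)],
    !₂[-(1 / √3), 1 / √3, -(1 / √3)], !₂[-(1 / √3), -(1 / √3), 1 / √3]]

/-- The regular ideal tetrahedron of `ℍ³`: the hyperbolic convex hull of four points of the sphere
at infinity, in symmetric position. -/
def regularIdealTetrahedron : Set HypSpace :=
  {x | x.pt ∈ convexHull ℝ (Set.range idealVertex)}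

end HypSpace

/-- Three-dimensional volume in a metric space: the three-dimensional Hausdorff measure, normalised
so as to agree with Lebesgue measure on Euclidean `3`-space. For the metric of a Riemannian
`3`-manifold this is the Riemannian volume. -/
def volume3 (X : Type*) [EMetricSpace X] (s : Set X) : ℝ≥0∞ :=
  letI : MeasurableSpace X := borel X
  haveI : BorelSpace X := ⟨rfl⟩
  (μHE[3] : MeasureTheory.Measure X) s

/-! ## Hyperbolic cone-manifolds -/

/-- Cylindrical coordinates `(r, θ, h)`, `r ≥ 0`, `θ ∈ ℝ / αℤ`, `h ∈ ℝ`, on the model space `ℍ³(α)`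
with a singular axis `r = 0` of cone angle `α`, whose metric is
`dr² + sinh² r dθ² + cosh² r dh²`. Points `(0, θ, h)` with the same `h` are at distance zero; they
represent the same point of the axis. -/
structure ConeModel (α : ℝ) where
  radius : NNReal
  angle : AddCircle α
  height : ℝ

/-- The distance in `ℍ³(α)`. If `δ` is the distance of the two angles in the circle `ℝ / αℤ`, then it
is the distance of two points of `ℍ³` whose angles differ by `min δ π`: when `δ ≥ π` the shortest
path runs through the axis. -/
def ConeModel.dist {α : ℝ} (p q : ConeModel α) : ℝ :=
  Real.arcosh (Real.cosh p.radius * Real.cosh q.radius * Real.cosh (p.height - q.height) -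
    Real.sinh p.radius * Real.sinh q.radius * Real.cos (min ‖p.angle - q.angle‖ Real.pi))

/-- The base point on the axis of `ℍ³(α)`; all points of the axis are equivalent under isometries. -/
def ConeModel.origin (α : ℝ) : ConeModel α := ⟨0, 0, 0⟩

section ConeManifold

variable {X : Type*} [EMetricSpace X]

/-- Some open ball about `x` is isometric to an open ball of `ℍ³`. -/
def IsHyperbolicPoint (x : X) : Prop :=
  ∃ ρ : ℝ, 0 < ρ ∧ ∃ (o : HypSpace) (ψ : HypSpace → X), ψ o = x ∧
    (∀ p ∈ Metric.ball o ρ, ∀ q ∈ Metric.ball o ρ, edist (ψ p) (ψ q) = edist p q) ∧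
    ψ '' Metric.ball o ρ = Metric.eball x (ENNReal.ofReal ρ)

/-- Some open ball about `x` is isometric to an open ball of `ℍ³(α)` centred on the singular axis. -/
def IsConePoint (α : ℝ) (x : X) : Prop :=
  ∃ ρ : ℝ, 0 < ρ ∧ ∃ ψ : ConeModel α → X, ψ (ConeModel.origin α) = x ∧
    (∀ p q : ConeModel α, ConeModel.dist (ConeModel.origin α) p < ρ →
      ConeModel.dist (ConeModel.origin α) q < ρ →
        edist (ψ p) (ψ q) = ENNReal.ofReal (ConeModel.dist p q)) ∧
    ψ '' {p | ConeModel.dist (ConeModel.origin α) p < ρ} = Metric.eball x (ENNReal.ofReal ρ)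

variable (X) in
/-- The distance of two points is the infimum of the lengths of the paths that join them (`⊤` if
there is none of finite length, such as for points in different components). -/
def IsLengthMetric : Prop :=
  ∀ x y : X, edist x y = ⨅ γ : Path x y, eVariationOn γ Set.univ

variable (X) in
/-- Hyperbolic cone-3-manifolds whose singular locus is a union of geodesics: length spaces which are
locally isometric to `ℍ³` or to some `ℍ³(α)`, `α > 0`. -/
def IsHyperbolicConeManifold : Prop :=
  IsLengthMetric X ∧ ∀ x : X, IsHyperbolicPoint x ∨ ∃ α : ℝ, 0 < α ∧ IsConePoint α x

end ConeManifold

/-- A hyperbolic cone-manifold structure on the topological space `N`: a metric that induces the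
topology of `N` and makes `N` a hyperbolic cone-manifold. The metric may take the value `⊤`, which
allows `N` to be disconnected. -/
structure HyperbolicConeStructure (N : Type*) [top : TopologicalSpace N] where
  metric : EMetricSpace N
  induces_top : metric.toUniformSpace.toTopologicalSpace = top
  isConeManifold : @IsHyperbolicConeManifold N metric

namespace HyperbolicConeStructure

variable {N : Type*} [TopologicalSpace N] (S : HyperbolicConeStructure N)

/-- The distance function of a hyperbolic cone-manifold structure. -/
def dist (x y : N) : ℝ≥0∞ := S.metric.edist x y

def IsComplete : Prop := @CompleteSpace N S.metric.toUniformSpace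

/-- The points without a neighbourhood isometric to a ball in `ℍ³`. -/
def singularLocus : Set N := {x | ¬ @IsHyperbolicPoint N S.metric x}

/-- The total volume. -/
def volume : ℝ≥0∞ := @volume3 N S.metric Set.univ

end HyperbolicConeStructure

/-! ## Ideal triangulations -/

/-- The standard `3`-simplex with its vertices removed, in barycentric coordinates. -/
abbrev IdealSimplex : Type := {t : Fin 4 → ℝ // t ∈ stdSimplex ℝ (Fin 4) ∧ ∀ i, t i ≠ 1}

/-- Face pairings of `n` standard `3`-simplices with vertices numbered `0, 1, 2, 3`; face `i` is the one
opposite to vertex `i`. Face `i` of the simplex `k` is glued to face `perm k i i` of the simplex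
`nbr k i` by the isometry that takes each vertex `j ≠ i` to the vertex `perm k i j`. -/
structure FacePairing (n : ℕ) where
  nbr : Fin n → Fin 4 → Fin n
  perm : Fin n → Fin 4 → Equiv.Perm (Fin 4)
  nbr_nbr : ∀ k i, nbr (nbr k i) (perm k i i) = k
  perm_perm : ∀ k i, perm (nbr k i) (perm k i i) = (perm k i)⁻¹
  /-- No face is glued to itself. -/
  no_self : ∀ k i, (nbr k i, perm k i i) ≠ (k, i)

namespace FacePairing

variable {n : ℕ} (F : FacePairing n)

/-- Elementary identifications: a point in face `i` of a simplex and its image under the pairing. -/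
def Glue (a b : Fin n × IdealSimplex) : Prop :=
  ∃ i, a.2.1 i = 0 ∧ b.1 = F.nbr a.1 i ∧ ∀ j, b.2.1 (F.perm a.1 i j) = a.2.1 j

/-- The space obtained from `n` standard `3`-simplices without their vertices by gluing the faces,
with the quotient topology. -/
def Space : Type := Quot F.Glue

instance : TopologicalSpace F.Space := inferInstanceAs (TopologicalSpace (Quot F.Glue))

/-- The simplices can be oriented such that every face pairing reverses the induced orientations. The
simplex `k` carries the orientation `o k` times the one of the order `0, 1, 2, 3` of its vertices. -/
def Orientable : Prop :=
  ∃ o : Fin n → ℤˣ, ∀ k i, o (F.nbr k i) * Equiv.Perm.sign (F.perm k i) = -o k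

end FacePairing

/-- An ideal triangulation of the space `N`: finitely many standard `3`-simplices with face pairings,
and an identification of `N` with the quotient of the simplices without their vertices. -/
structure IdealTriangulation (N : Type*) [TopologicalSpace N] where
  numTet : ℕ
  pairing : FacePairing numTet
  homeo : pairing.Space ≃ₜ N

namespace IdealTriangulation

variable {N : Type*} [TopologicalSpace N] (T : IdealTriangulation N)

def Orientable : Prop := T.pairing.Orientable

/-- The quotient map from the `k`-th ideal simplex to `N`. -/
def tet (k : Fin T.numTet) (t : IdealSimplex) : N := T.homeo (Quot.mk _ (k, t))

/-- `N⁽¹⁾`: the union of the ideal edges in `N`. A point lies on an edge of its simplex if two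
barycentric coordinates vanish. -/
def oneSkeleton : Set N :=
  {x | ∃ k t, T.tet k t = x ∧ ∃ i j, i ≠ j ∧ t.1 i = 0 ∧ t.1 j = 0}

end IdealTriangulation

/-- The standard identification of the `3`-simplex without its vertices with the regular ideal
tetrahedron: vertices go to ideal vertices, and the map is affine in the projective model. -/
def straight (t : IdealSimplex) : HypSpace where
  pt := ∑ i, t.1 i • HypSpace.idealVertex i
  norm_lt := by
    obtain ⟨t, ⟨h0, h1⟩, h2⟩ := t
    have hle : ∀ i, t i < 1 := fun i =>
      lt_of_le_of_ne (h1 ▸ Finset.single_le_sum (fun j _ => h0 j) (Finset.mem_univ i)) (h2 i)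
    have h3 : (1 / √3 : ℝ) ^ 2 = 1 / 3 := by
      rw [div_pow, Real.sq_sqrt (by norm_num)]; norm_num
    rw [Fin.sum_univ_four] at h1
    have h4 : ‖∑ i, t i • HypSpace.idealVertex i‖ ^ 2 < 1 := by
      rw [EuclideanSpace.norm_sq_eq, Fin.sum_univ_three]
      simp only [HypSpace.idealVertex, Fin.sum_univ_four, Real.norm_eq_abs, sq_abs]
      simp
      have h5 := h0 0; have h6 := h0 1; have h7 := h0 2; have h8 := h0 3
      have g5 := hle 0; have g6 := hle 1; have g7 := hle 2; have g8 := hle 3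
      have hsq : t 0 ^ 2 + t 1 ^ 2 + t 2 ^ 2 + t 3 ^ 2 < 1 := by
        have : t 0 * (1 - t 0) + t 1 * (1 - t 1) + t 2 * (1 - t 2) + t 3 * (1 - t 3) > 0 := by
          have k5 := mul_nonneg h5 (sub_nonneg.2 g5.le)
          have k6 := mul_nonneg h6 (sub_nonneg.2 g6.le)
          have k7 := mul_nonneg h7 (sub_nonneg.2 g7.le)
          have k8 := mul_nonneg h8 (sub_nonneg.2 g8.le)
          by_contra hc
          have z : ∀ s : ℝ, 0 ≤ s → s < 1 → s * (1 - s) ≤ 0 → s = 0 := by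
            intro s hs hs1 hs2
            nlinarith
          have z5 := z _ h5 g5 (by linarith)
          have z6 := z _ h6 g6 (by linarith)
          have z7 := z _ h7 g7 (by linarith)
          have z8 := z _ h8 g8 (by linarith)
          linarith
        linarith
      have hw : ((√3)⁻¹ : ℝ) ^ 2 = 1 / 3 := by rw [← h3]; simp
      set w : ℝ := (√3)⁻¹
      have e : t 3 = 1 - t 0 - t 1 - t 2 := by linarith
      rw [e] at hsq ⊢
      ring_nf
      rw [hw]
      nlinarith
    have := norm_nonneg (∑ i, t i • HypSpace.idealVertex i)
    nlinarith

/-- All tetrahedra of the triangulation are regular ideal tetrahedra for the structure `S`: away from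
the edges, the standard identification of each simplex with the regular ideal tetrahedron of `ℍ³`
is a local isometry with respect to the metric of `N`. -/
def HyperbolicConeStructure.TetrahedraRegular {N : Type*} [TopologicalSpace N]
    (S : HyperbolicConeStructure N) (T : IdealTriangulation N) : Prop :=
  ∀ (k : Fin T.numTet) (t : IdealSimplex), (∀ i j, i ≠ j → t.1 i = 0 → t.1 j ≠ 0) →
    ∃ U ∈ nhds t, ∀ a ∈ U, ∀ b ∈ U,
      S.dist (T.tet k a) (T.tet k b) = edist (straight a) (straight b)

end

/-! In barycentric coordinates with respect to the ideal vertices of the regular ideal tetrahedron,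
the Lorentz form of hyperbolic space is, up to scale, `(∑ u)(∑ w) - ∑ u w`, which is invariant under
all permutations of the coordinates. Hence every renumbering of the vertices is an isometry of the
whole tetrahedron (`dist_straight_permute`). Each face pairing is the restriction of such an
isometry (`FacePairing.cross`), so regular ideal tetrahedra can be glued along any pattern, and all
points of one fibre of the quotient map look alike.

The metric on the quotient is defined by duality: the distance of `x` and `y` is the supremum of `|f
x - f y|` over all functions `f` that are `1`-Lipschitz on every simplex. Upper bounds for the
distance come from the triangle inequality along broken segments, lower bounds from test functions.
`exists_isTetLipschitz` produces the local ones: it extends a compatible function near one fibre by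
a constant. The distance to a fibre, cut off at a small radius, is such a test function; it shows
that the metric separates points and induces the quotient topology. The path-length distance,
suitably truncated, is another one, and it shows that the metric is a length metric.

The distance to the centre of the simplex is compatible with all gluings, because renumberings fix
the centre. It is therefore a `1`-Lipschitz function on the quotient, with sublevel sets covered by
finitely many compact truncated simplices. Completeness and non-compactness follow from this one
function.

The local geometry is described by a `Chart`, a way to lay out the simplices at a point in a model
space; `Chart.exists_isometry` turns it into an isometry of balls. Away from the edges at most two
simplices meet, and the second is unfolded by the reflection in the common face. At an edge the
dihedral angle is `π / 3`, so the simplices met while rotating about the edge fill a cone of angle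
`period * (π / 3)`. Orientability, together with the absence of self-glued faces, ensures that the
rotation never returns to the same simplex with the edge or the wedge reversed
(`iterate_rotate_eq_self`), so the wedges close up consistently.

For the volume, the open tetrahedra embed disjointly by local isometries, and the faces are null
sets. -/

open scoped ENNReal MeasureTheory RealInnerProductSpace

noncomputable section

/-! ## Homogeneous barycentric coordinates on hyperbolic space -/

namespace HypSpace

lemma inner_idealVertex (i j : Fin 4) :
    ⟪idealVertex i, idealVertex j⟫ = if i = j then 1 else -(1 / 3 : ℝ) := by
  have hw : (√3 : ℝ) * √3 = 3 := Real.mul_self_sqrt (by norm_num)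
  have hi : (√3 : ℝ)⁻¹ * (√3)⁻¹ = 1 / 3 := by rw [← mul_inv, hw]; norm_num
  have h1 : (1 / √3 : ℝ) * (1 / √3) = 1 / 3 := by rw [one_div, hi]
  fin_cases i <;> fin_cases j <;>
    simp only [idealVertex, PiLp.inner_apply, Fin.sum_univ_three, Fin.isValue, Fin.mk_zero,
      Fin.mk_one, Fin.reduceFinMk, Matrix.cons_val, RCLike.inner_apply, conj_trivial] <;>
    simp [hi] <;> norm_num

/-- The Lorentz form in homogeneous barycentric coordinates, up to scale. -/
def form (u w : Fin 4 → ℝ) : ℝ := (∑ i, u i) * (∑ i, w i) - ∑ i, u i * w i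

lemma form_comm (u w : Fin 4 → ℝ) : form u w = form w u := by
  simp only [form, mul_comm]

lemma form_add_right (u v w : Fin 4 → ℝ) : form u (v + w) = form u v + form u w := by
  simp only [form, Pi.add_apply, Fin.sum_univ_four]; ring

lemma form_smul_right (c : ℝ) (u w : Fin 4 → ℝ) : form u (c • w) = c * form u w := by
  simp only [form, Pi.smul_apply, smul_eq_mul, Fin.sum_univ_four]; ring

lemma form_add_left (u v w : Fin 4 → ℝ) : form (u + v) w = form u w + form v w := by
  simp only [form, Pi.add_apply, Fin.sum_univ_four]; ring

lemma form_smul_left (c : ℝ) (u w : Fin 4 → ℝ) : form (c • u) w = c * form u w := by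
  simp only [form, Pi.smul_apply, smul_eq_mul, Fin.sum_univ_four]; ring

lemma form_comp_perm (σ : Equiv.Perm (Fin 4)) (u w : Fin 4 → ℝ) :
    form (u ∘ σ) (w ∘ σ) = form u w := by
  simp only [form, Function.comp_apply]
  rw [Equiv.sum_comp σ u, Equiv.sum_comp σ w, Equiv.sum_comp σ (fun i => u i * w i)]

/-- The Gram matrix of the ideal vertices is `4/3` times the identity minus `1/3` times the all-ones
matrix. For coordinates with sum one this makes `1 - ⟪x, y⟫`, the numerator of `cosh d`, a multiple
of `form`. -/
lemma inner_combination (t s : Fin 4 → ℝ) :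
    ⟪∑ i, t i • idealVertex i, ∑ j, s j • idealVertex j⟫ =
      (∑ i, t i) * (∑ i, s i) - 4 / 3 * form t s := by
  simp only [Fin.sum_univ_four, inner_add_left, inner_add_right, real_inner_smul_left,
    real_inner_smul_right, inner_idealVertex, form]
  simp
  ring

/-- The affine (barycentric) coordinates with respect to the four ideal vertices. -/
def bary (p : HypSpace) (i : Fin 4) : ℝ := (1 + 3 * ⟪p.pt, idealVertex i⟫) / 4

/-- The four vertices sum to zero and form a tight frame: `∑ ⟪x, v i⟫ v i = 4/3 x`. -/
lemma sum_bary_smul (x : EuclideanSpace ℝ (Fin 3)) :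
    ∑ i, ((1 + 3 * ⟪x, idealVertex i⟫) / 4) • idealVertex i = x := by
  have hw : (√3 : ℝ) * √3 = 3 := Real.mul_self_sqrt (by norm_num)
  have hi : (√3 : ℝ)⁻¹ ^ 2 = 1 / 3 := by rw [inv_pow, sq, hw]; norm_num
  ext j
  fin_cases j <;>
    simp [idealVertex, PiLp.inner_apply, Fin.sum_univ_three, Fin.sum_univ_four] <;>
    ring_nf <;> rw [hi] <;> ring

lemma sum_bary (p : HypSpace) : ∑ i, bary p i = 1 := by
  have : ∑ i, idealVertex i = 0 := by
    ext j
    fin_cases j <;> simp [idealVertex, Fin.sum_univ_four]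
  have h2 : ∑ i, ⟪p.pt, idealVertex i⟫ = 0 := by rw [← inner_sum, this, inner_zero_right]
  simp only [bary]
  rw [← Finset.sum_div, Finset.sum_add_distrib, ← Finset.mul_sum, h2]
  simp

lemma pt_eq (p : HypSpace) : p.pt = ∑ i, bary p i • idealVertex i := (sum_bary_smul p.pt).symm

@[ext] lemma ext_pt {p q : HypSpace} (h : p.pt = q.pt) : p = q := by
  cases p; cases q; simp_all

lemma ext_bary {p q : HypSpace} (h : ∀ i, bary p i = bary q i) : p = q := by
  ext1
  rw [pt_eq p, pt_eq q]
  simp [h]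

/-- Coordinates of points of hyperbolic space. -/
def Timelike (u : Fin 4 → ℝ) : Prop := 0 < ∑ i, u i ∧ 0 < form u u

lemma one_sub_inner (p q : HypSpace) : 1 - ⟪p.pt, q.pt⟫ = 4 / 3 * form (bary p) (bary q) := by
  rw [pt_eq p, pt_eq q, inner_combination, sum_bary, sum_bary]
  ring

lemma timelike_bary (p : HypSpace) : Timelike (bary p) := by
  refine ⟨by rw [sum_bary]; norm_num, ?_⟩
  have := one_sub_inner p p
  have h := p.one_sub_pos
  rw [real_inner_self_eq_norm_sq] at this
  linarith

/-- After normalisation to sum one, `1 - ‖x‖²` is `4/3` of the form, hence positive. -/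
lemma norm_combination_lt {u : Fin 4 → ℝ} (h : Timelike u) :
    ‖∑ i, (u i / ∑ j, u j) • idealVertex i‖ < 1 := by
  have h1 : (∑ i, u i / ∑ j, u j) = 1 := by
    rw [← Finset.sum_div, div_self h.1.ne']
  have h2 := inner_combination (fun i => u i / ∑ j, u j) (fun i => u i / ∑ j, u j)
  have h3 : form (fun i => u i / ∑ j, u j) (fun i => u i / ∑ j, u j) =
      form u u * (1 / ∑ j, u j) ^ 2 := by
    have : (fun i => u i / ∑ j, u j) = (1 / ∑ j, u j) • u := by
      ext i; simp [div_eq_inv_mul]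
    rw [this, form_smul_left, form_smul_right]; ring
  have h4 : 0 < form u u * (1 / ∑ j, u j) ^ 2 :=
    mul_pos h.2 (pow_pos (one_div_pos.2 h.1) 2)
  rw [real_inner_self_eq_norm_sq, h1, h3] at h2
  have := norm_nonneg (∑ i, (u i / ∑ j, u j) • idealVertex i)
  nlinarith

open Classical in
/-- The point with given homogeneous barycentric coordinates. -/
def ofCoord (u : Fin 4 → ℝ) : HypSpace :=
  if h : Timelike u then ⟨∑ i, (u i / ∑ j, u j) • idealVertex i, norm_combination_lt h⟩
  else ⟨0, by simp⟩

lemma bary_combination {p : HypSpace} {t : Fin 4 → ℝ} (ht : ∑ i, t i = 1)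
    (hp : p.pt = ∑ i, t i • idealVertex i) (i : Fin 4) : bary p i = t i := by
  rw [Fin.sum_univ_four] at ht
  simp only [bary, hp, Fin.sum_univ_four, inner_add_left, real_inner_smul_left, inner_idealVertex]
  fin_cases i <;> simp <;> linarith

lemma bary_ofCoord {u : Fin 4 → ℝ} (h : Timelike u) (i : Fin 4) :
    bary (ofCoord u) i = u i / ∑ j, u j := by
  refine bary_combination (t := fun i => u i / ∑ j, u j) ?_ ?_ i
  · rw [← Finset.sum_div, div_self h.1.ne']
  · simp [ofCoord, h]

lemma ofCoord_bary (p : HypSpace) : ofCoord (bary p) = p :=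
  ext_bary fun i => by rw [bary_ofCoord (timelike_bary p), sum_bary, div_one]

lemma Timelike.smul {u : Fin 4 → ℝ} (h : Timelike u) {c : ℝ} (hc : 0 < c) : Timelike (c • u) := by
  refine ⟨?_, ?_⟩
  · simp only [Pi.smul_apply, smul_eq_mul, ← Finset.mul_sum]; exact mul_pos hc h.1
  · rw [form_smul_left, form_smul_right]; exact mul_pos hc (mul_pos hc h.2)

lemma ofCoord_smul {u : Fin 4 → ℝ} (h : Timelike u) {c : ℝ} (hc : 0 < c) :
    ofCoord (c • u) = ofCoord u :=
  ext_bary fun i => by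
    rw [bary_ofCoord h, bary_ofCoord (h.smul hc)]
    simp only [Pi.smul_apply, smul_eq_mul, ← Finset.mul_sum]
    rw [mul_div_mul_left _ _ hc.ne']

lemma coshDist_eq_bary (p q : HypSpace) : coshDist p q =
    form (bary p) (bary q) / (√(form (bary p) (bary p)) * √(form (bary q) (bary q))) := by
  have e : ∀ p : HypSpace, √(1 - ‖p.pt‖ ^ 2) = √(4 / 3) * √(form (bary p) (bary p)) := by
    intro p
    rw [← real_inner_self_eq_norm_sq, one_sub_inner, Real.sqrt_mul (by norm_num)]
  have h0 : √(4 / 3 : ℝ) * √(4 / 3) = 4 / 3 := Real.mul_self_sqrt (by norm_num)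
  rw [coshDist, e, e, one_sub_inner, mul_mul_mul_comm, h0]
  rw [mul_div_mul_left _ _ (by norm_num)]

lemma bary_ofCoord_eq {u : Fin 4 → ℝ} (h : Timelike u) :
    bary (ofCoord u) = (∑ j, u j)⁻¹ • u := by
  ext i
  rw [bary_ofCoord h, Pi.smul_apply, smul_eq_mul, div_eq_inv_mul]

lemma coshDist_ofCoord {u w : Fin 4 → ℝ} (hu : Timelike u) (hw : Timelike w) :
    coshDist (ofCoord u) (ofCoord w) = form u w / (√(form u u) * √(form w w)) := by
  have e : ∀ {u : Fin 4 → ℝ}, Timelike u →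
      √(form (bary (ofCoord u)) (bary (ofCoord u))) = (∑ j, u j)⁻¹ * √(form u u) := by
    intro u hu
    rw [bary_ofCoord_eq hu, form_smul_left, form_smul_right, ← mul_assoc, Real.sqrt_mul (mul_self_nonneg _),
      Real.sqrt_mul_self (inv_pos.2 hu.1).le]
  have := inv_pos.2 hu.1
  have := inv_pos.2 hw.1
  have h0 : (∑ j, u j)⁻¹ * (∑ j, w j)⁻¹ ≠ 0 := by positivity
  rw [coshDist_eq_bary, e hu, e hw, bary_ofCoord_eq hu, bary_ofCoord_eq hw, form_smul_left,
    form_smul_right, mul_mul_mul_comm, ← mul_assoc, mul_div_mul_left _ _ h0]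

lemma dist_def (p q : HypSpace) : dist p q = Real.arcosh (coshDist p q) := rfl

lemma cosh_dist (p q : HypSpace) : Real.cosh (dist p q) = coshDist p q :=
  Real.cosh_arcosh (one_le_coshDist p q)

lemma dist_ofCoord {u w : Fin 4 → ℝ} (hu : Timelike u) (hw : Timelike w) :
    dist (ofCoord u) (ofCoord w) = Real.arcosh (form u w / (√(form u u) * √(form w w))) := by
  rw [dist_def, coshDist_ofCoord hu hw]

/-- Both vectors lie in the same nappe of the light cone; the sign is read off from the positivity
of `cosh d`. -/
lemma Timelike.form_pos {u w : Fin 4 → ℝ} (hu : Timelike u) (hw : Timelike w) : 0 < form u w := by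
  have h := coshDist_pos (ofCoord u) (ofCoord w)
  rw [coshDist_ofCoord hu hw] at h
  have := Real.sqrt_pos.2 hu.2
  have := Real.sqrt_pos.2 hw.2
  exact (div_pos_iff_of_pos_right (by positivity)).1 h

/-- The future cone is convex. Since hyperbolic segments are projections of linear ones, this
supplies all points of segments below. -/
lemma Timelike.combination {u w : Fin 4 → ℝ} (hu : Timelike u) (hw : Timelike w) {a b : ℝ}
    (ha : 0 ≤ a) (hb : 0 ≤ b) (hab : 0 < a + b) : Timelike (a • u + b • w) := by
  have h := hu.form_pos hw
  have hu1 := hu.1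
  have hu2 := hu.2
  have hw1 := hw.1
  have hw2 := hw.2
  refine ⟨?_, ?_⟩
  · simp only [Pi.add_apply, Pi.smul_apply, smul_eq_mul, Finset.sum_add_distrib, ← Finset.mul_sum]
    rcases ha.lt_or_eq with ha' | rfl
    · have := mul_pos ha' hu1
      positivity
    · have hb' : 0 < b := by linarith
      have := mul_pos hb' hw1
      positivity
  · simp only [form_add_left, form_add_right, form_smul_left, form_smul_right, form_comm w u]
    rcases ha.lt_or_eq with ha' | rfl
    · have := mul_pos ha' (mul_pos ha' hu2)
      positivity
    · have hb' : 0 < b := by linarith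
      have := mul_pos hb' (mul_pos hb' hw2)
      positivity

/-- Distances add up along hyperbolic segments. -/
lemma dist_add_dist_combination {u w : Fin 4 → ℝ} (hu : Timelike u) (hw : Timelike w) {a b : ℝ}
    (ha : 0 ≤ a) (hb : 0 ≤ b) (hab : 0 < a + b) :
    dist (ofCoord u) (ofCoord (a • u + b • w)) + dist (ofCoord (a • u + b • w)) (ofCoord w) =
      dist (ofCoord u) (ofCoord w) := by
  have hc := hu.combination hw ha hb hab
  set c := a • u + b • w with hcdef
  set p := ofCoord u
  set q := ofCoord w
  set z := ofCoord c
  have hU := Real.sqrt_pos.2 hu.2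
  have hW := Real.sqrt_pos.2 hw.2
  have hN := Real.sqrt_pos.2 hc.2
  have eU := Real.sq_sqrt hu.2.le
  have eW := Real.sq_sqrt hw.2.le
  have eN := Real.sq_sqrt hc.2.le
  have h1 : coshDist p z = _ := coshDist_ofCoord hu hc
  have h2 : coshDist z q = _ := coshDist_ofCoord hc hw
  have h3 : coshDist p q = _ := coshDist_ofCoord hu hw
  set U := √(form u u)
  set W := √(form w w)
  set N := √(form c c)
  have f1 : form u c = a * U ^ 2 + b * form u w := by
    rw [hcdef, form_add_right, form_smul_right, form_smul_right, eU]
  have f2 : form c w = a * form u w + b * W ^ 2 := by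
    rw [hcdef, form_add_left, form_smul_left, form_smul_left, eW]
  have f3 : N ^ 2 = a ^ 2 * U ^ 2 + 2 * a * b * form u w + b ^ 2 * W ^ 2 := by
    rw [eN, hcdef]
    simp only [form_add_left, form_add_right, form_smul_left, form_smul_right, form_comm w u, eU, eW]
    ring
  have hC : form u w = coshDist p q * (U * W) := by rw [h3]; field_simp
  set C := coshDist p q
  have hC1 : 1 ≤ C := one_le_coshDist p q
  have hS := Real.sq_sqrt (show 0 ≤ C ^ 2 - 1 by nlinarith)
  have hS0 := Real.sqrt_nonneg (C ^ 2 - 1)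
  set S := √(C ^ 2 - 1)
  have hsinh : ∀ {d y : ℝ}, 0 ≤ d → 0 ≤ y → Real.cosh d ^ 2 = 1 + y ^ 2 → Real.sinh d = y := by
    intro d y hd hy h
    rw [Real.cosh_sq, add_comm, add_right_inj] at h
    exact (sq_eq_sq₀ (Real.sinh_nonneg_iff.2 hd) hy).1 h
  have c1 : Real.cosh (dist p z) = (a * U + b * C * W) / N := by
    rw [cosh_dist, h1, f1, hC]; field_simp
  have c2 : Real.cosh (dist z q) = (a * C * U + b * W) / N := by
    rw [cosh_dist, h2, f2, hC]; field_simp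
  rw [hC] at f3
  -- With `C` and `S` the hyperbolic cosine and sine of the whole distance, the sine of each partial
  -- distance is proportional to the weight of the opposite endpoint. The addition theorem for
  -- `cosh` then gives back `C`.
  have s1 : Real.sinh (dist p z) = b * W * S / N := by
    refine hsinh dist_nonneg (by positivity) ?_
    rw [c1]
    field_simp
    rw [hS, f3]
    ring
  have s2 : Real.sinh (dist z q) = a * U * S / N := by
    refine hsinh dist_nonneg (by positivity) ?_
    rw [c2]
    field_simp
    rw [hS, f3]
    ring
  refine Real.cosh_injOn (add_nonneg dist_nonneg dist_nonneg) (dist_nonneg (x := p) (y := q)) ?_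
  rw [Real.cosh_add, c1, c2, s1, s2, cosh_dist]
  field_simp
  rw [hS, f3]
  ring

end HypSpace

/-! ## Topology of hyperbolic space and of the ideal simplex -/

namespace HypSpace

/-- In the projective model the hyperbolic metric dominates the Euclidean one: the denominators in
the formula for `sinh² d` only increase it. This gives the continuity of `pt`. -/
lemma norm_sub_le_sinh_dist (p q : HypSpace) : ‖p.pt - q.pt‖ ≤ Real.sinh (dist p q) := by
  rw [dist_def, Real.sinh_arcosh (one_le_coshDist p q), coshDist_sq_sub_one]
  apply Real.le_sqrt_of_sq_le
  have hp := p.one_sub_pos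
  have hq := q.one_sub_pos
  rw [le_div_iff₀ (mul_pos hp hq)]
  have h1 : 0 ≤ ‖p.pt - q.pt‖ ^ 2 * (1 - ‖q.pt‖ ^ 2) * ‖p.pt‖ ^ 2 := by positivity
  nlinarith [sq_nonneg ⟪p.pt - q.pt, q.pt⟫]

lemma continuous_pt : Continuous pt := by
  rw [continuous_iff_continuousAt]
  intro p
  rw [ContinuousAt, tendsto_iff_norm_sub_tendsto_zero]
  have h : Filter.Tendsto (fun q : HypSpace => Real.sinh (dist q p)) (nhds p) (nhds 0) := by
    have : Continuous fun q : HypSpace => Real.sinh (dist q p) := by fun_prop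
    simpa using this.tendsto p
  exact squeeze_zero (fun _ => norm_nonneg _) (fun q => norm_sub_le_sinh_dist q p) h

/-- One direction is the comparison with the Euclidean metric. For the other, `cosh d(·, p)` is
continuous in Euclidean coordinates with value `1` at `p`, and `arcosh` is continuous on `[1, ∞)`.
-/
lemma isInducing_pt : Topology.IsInducing pt := by
  rw [Topology.isInducing_iff_nhds]
  intro p
  refine le_antisymm continuous_pt.continuousAt.le_comap ?_
  have h : Filter.Tendsto id (Filter.comap pt (nhds p.pt)) (nhds p) := by
    rw [tendsto_iff_dist_tendsto_zero]
    have hG : Filter.Tendsto (fun x : EuclideanSpace ℝ (Fin 3) =>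
        (1 - ⟪x, p.pt⟫) / (√(1 - ‖x‖ ^ 2) * √(1 - ‖p.pt‖ ^ 2))) (nhds p.pt) (nhds 1) := by
      have hp := Real.sqrt_pos.2 p.one_sub_pos
      have : ContinuousAt (fun x : EuclideanSpace ℝ (Fin 3) =>
        (1 - ⟪x, p.pt⟫) / (√(1 - ‖x‖ ^ 2) * √(1 - ‖p.pt‖ ^ 2))) p.pt := by
        refine ContinuousAt.div (by fun_prop) (by fun_prop) (by positivity)
      have e := coshDist_self p
      unfold coshDist at e
      simpa only [ContinuousAt, e] using this
    have h2 : Filter.Tendsto (fun q => coshDist q p) (Filter.comap pt (nhds p.pt))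
        (nhdsWithin 1 (Set.Ici 1)) := by
      rw [tendsto_nhdsWithin_iff]
      exact ⟨hG.comp Filter.tendsto_comap, Filter.Eventually.of_forall fun q => one_le_coshDist q p⟩
    have h3 := (Real.continuousOn_arcosh 1 Set.self_mem_Ici).tendsto.comp h2
    rwa [Real.arcosh_zero] at h3
  exact Filter.tendsto_id'.1 h

lemma continuous_bary (i : Fin 4) : Continuous fun p => bary p i := by
  unfold bary
  have := continuous_pt
  fun_prop

lemma isOpen_bary_pos (i : Fin 4) : IsOpen {p | 0 < bary p i} :=
  isOpen_lt continuous_const (continuous_bary i)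

/-- The centre of the regular ideal tetrahedron. -/
def center : HypSpace := ⟨0, by simp⟩

lemma coshDist_center (p : HypSpace) : coshDist p center = 1 / √(1 - ‖p.pt‖ ^ 2) := by
  simp [coshDist, center]

lemma bary_center (i : Fin 4) : bary center i = 1 / 4 := by
  simp [bary, center]

end HypSpace

open HypSpace

@[simp] lemma bary_straight (t : IdealSimplex) (i : Fin 4) : bary (straight t) i = t.1 i :=
  bary_combination t.2.1.2 rfl i

lemma bary_straight_eq (t : IdealSimplex) : bary (straight t) = t.1 :=
  funext (bary_straight t)

lemma IdealSimplex.timelike (t : IdealSimplex) : Timelike t.1 := by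
  rw [← bary_straight_eq]; exact timelike_bary _

lemma ofCoord_idealSimplex (t : IdealSimplex) : ofCoord t.1 = straight t := by
  rw [← bary_straight_eq, ofCoord_bary]

lemma straight_injective : Function.Injective straight := fun a b h =>
  Subtype.ext (by rw [← bary_straight_eq, h, bary_straight_eq])

/-- The barycentric coordinates are continuous functions of the position, so they recover the
simplex. Neighbourhoods in the simplex may therefore be tested by hyperbolic balls. -/
lemma isInducing_straight : Topology.IsInducing straight := by
  have h : Topology.IsInducing (pt ∘ straight) := by
    have hc : Continuous (pt ∘ straight) := by
      change Continuous fun t : IdealSimplex => ∑ i, t.1 i • idealVertex i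
      exact continuous_finsetSum _ fun i _ =>
        ((continuous_apply i).comp continuous_subtype_val).smul continuous_const
    have hg : Continuous fun (x : EuclideanSpace ℝ (Fin 3)) (i : Fin 4) =>
        (1 + 3 * ⟪x, idealVertex i⟫) / 4 := by fun_prop
    refine Topology.IsInducing.of_comp hc hg ?_
    have e : (fun (x : EuclideanSpace ℝ (Fin 3)) (i : Fin 4) =>
        (1 + 3 * ⟪x, idealVertex i⟫) / 4) ∘ pt ∘ straight = Subtype.val :=
      funext bary_straight_eq
    rw [e]
    exact Topology.IsInducing.subtypeVal
  exact (isInducing_pt.of_comp_iff).1 h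

lemma continuous_straight : Continuous straight := isInducing_straight.continuous

/-- Otherwise the remaining coordinates vanish and `p` would be an ideal vertex, where the form is
zero. -/
lemma bary_ne_one {p : HypSpace} (h : ∀ i, 0 ≤ bary p i) (i : Fin 4) : bary p i ≠ 1 := by
  intro hi
  have h1 := sum_bary p
  have h2 := (timelike_bary p).2
  have h3 : ∀ j, j ≠ i → bary p j = 0 := by
    intro j hj
    have := Finset.add_le_sum (fun k _ => h k) (Finset.mem_univ i) (Finset.mem_univ j) hj.symm
    have := h j
    linarith
  rw [form, h1] at h2
  have h4 : ∑ j, bary p j * bary p j = 1 := by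
    rw [Finset.sum_eq_single i (fun j _ hj => by rw [h3 j hj, mul_zero]) (by simp), hi, mul_one]
  linarith

/-- The centre of the simplex. -/
def IdealSimplex.center : IdealSimplex :=
  ⟨fun _ => 1 / 4, ⟨fun _ => by norm_num, by simp⟩, fun _ => by norm_num⟩

lemma straight_center : straight IdealSimplex.center = HypSpace.center :=
  ext_bary fun i => by rw [bary_straight, bary_center, IdealSimplex.center]

open Classical in
/-- The inverse of `straight` on the regular ideal tetrahedron. -/
def toSimplex (p : HypSpace) : IdealSimplex :=
  if h : ∀ i, 0 ≤ bary p i then ⟨bary p, ⟨h, sum_bary p⟩, bary_ne_one h⟩ else IdealSimplex.center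

lemma straight_toSimplex {p : HypSpace} (h : ∀ i, 0 ≤ bary p i) : straight (toSimplex p) = p :=
  ext_bary fun i => by rw [bary_straight, toSimplex, dif_pos h]

lemma toSimplex_straight (t : IdealSimplex) : toSimplex (straight t) = t :=
  straight_injective (straight_toSimplex fun i => by rw [bary_straight]; exact t.2.1.1 i)

lemma toSimplex_apply {p : HypSpace} (h : ∀ i, 0 ≤ bary p i) (i : Fin 4) :
    (toSimplex p).1 i = bary p i := by
  rw [toSimplex, dif_pos h]

lemma IdealSimplex.nonneg (t : IdealSimplex) (i : Fin 4) : 0 ≤ t.1 i := t.2.1.1 i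

lemma range_straight : Set.range straight = {p | ∀ i, 0 ≤ bary p i} := by
  ext p
  constructor
  · rintro ⟨t, rfl⟩ i
    rw [bary_straight]
    exact t.nonneg i
  · intro h
    exact ⟨toSimplex p, straight_toSimplex h⟩

lemma range_straight_eq : Set.range straight = regularIdealTetrahedron := by
  ext p
  constructor
  · rintro ⟨t, rfl⟩
    exact (convex_convexHull ℝ _).sum_mem (fun i _ => t.nonneg i) t.2.1.2
      fun i _ => subset_convexHull ℝ _ (Set.mem_range_self i)
  · intro h
    rw [range_straight]
    intro i
    have h1 : convexHull ℝ (Set.range idealVertex) ⊆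
        {x : EuclideanSpace ℝ (Fin 3) | 0 ≤ 1 + 3 * ⟪x, idealVertex i⟫} := by
      refine convexHull_min ?_ ?_
      · rintro _ ⟨j, rfl⟩
        rw [Set.mem_ofPred_eq, inner_idealVertex]
        split_ifs <;> norm_num
      · intro x hx y hy a b ha hb hab
        simp only [Set.mem_ofPred_eq, inner_add_left, real_inner_smul_left] at *
        nlinarith [mul_nonneg ha hx, mul_nonneg hb hy]
    have := h1 h
    simp only [bary, Set.mem_ofPred_eq] at *
    linarith

/-- Renumbering the vertices of the simplex. -/
def IdealSimplex.permute (σ : Equiv.Perm (Fin 4)) (t : IdealSimplex) : IdealSimplex :=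
  ⟨t.1 ∘ σ.symm, ⟨fun _ => t.2.1.1 _, by
    exact (Equiv.sum_comp σ.symm t.1).trans t.2.1.2⟩, fun _ => t.2.2 _⟩

/-! ### Symmetries of the simplex, truncation of its cusps, small radii -/

namespace IdealSimplex

@[simp] lemma permute_apply (σ : Equiv.Perm (Fin 4)) (t : IdealSimplex) (i : Fin 4) :
    (t.permute σ).1 i = t.1 (σ.symm i) := rfl

/-- The inverse in the definition of `permute` makes it a left action, in accordance with the
direction of the face pairings. -/
lemma permute_mul (σ τ : Equiv.Perm (Fin 4)) (t : IdealSimplex) :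
    t.permute (σ * τ) = (t.permute τ).permute σ := rfl

@[simp] lemma permute_one (t : IdealSimplex) : t.permute 1 = t := rfl

@[simp] lemma permute_inv_permute (σ : Equiv.Perm (Fin 4)) (t : IdealSimplex) :
    (t.permute σ).permute σ⁻¹ = t := by rw [← permute_mul, inv_mul_cancel, permute_one]

@[simp] lemma permute_permute_inv (σ : Equiv.Perm (Fin 4)) (t : IdealSimplex) :
    (t.permute σ⁻¹).permute σ = t := by rw [← permute_mul, mul_inv_cancel, permute_one]

lemma eq_permute_iff {σ : Equiv.Perm (Fin 4)} {t s : IdealSimplex} :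
    s = t.permute σ ↔ ∀ j, s.1 (σ j) = t.1 j := by
  constructor
  · rintro rfl j; simp
  · intro h
    refine Subtype.ext (funext fun j => ?_)
    have := h (σ.symm j)
    simpa using this

/-- The form is symmetric in the four coordinates. This is where the regularity of the tetrahedron
enters: it makes all gluings isometric. -/
lemma dist_straight_permute (σ : Equiv.Perm (Fin 4)) (a b : IdealSimplex) :
    dist (straight (a.permute σ)) (straight (b.permute σ)) = dist (straight a) (straight b) := by
  rw [dist_def, dist_def, coshDist_eq_bary, coshDist_eq_bary]
  simp only [bary_straight_eq, permute, form_comp_perm]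

lemma permute_center (σ : Equiv.Perm (Fin 4)) : center.permute σ = center := rfl

/-- The centre is the origin of the ball, so `cosh` of the distance is `1 / √(1 - ‖x‖²)`, and `1 -
‖x‖²` is `4/3` of the form. Balls about the centre thus become closed conditions on the coordinates.
-/
lemma dist_center_le_iff {R : ℝ} (hR : 0 ≤ R) (t : IdealSimplex) :
    dist (straight t) HypSpace.center ≤ R ↔ 1 / Real.cosh R ^ 2 ≤ 4 / 3 * form t.1 t.1 := by
  have h1 := one_sub_inner (straight t) (straight t)
  rw [real_inner_self_eq_norm_sq, bary_straight_eq] at h1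
  have h0 := (straight t).one_sub_pos
  rw [← abs_of_nonneg (dist_nonneg (x := straight t) (y := HypSpace.center)),
    ← abs_of_nonneg hR, ← Real.cosh_le_cosh, cosh_dist, coshDist_center, abs_of_nonneg hR, ← h1,
    one_div_le (Real.sqrt_pos.2 h0) (Real.cosh_pos R),
    Real.le_sqrt' (one_div_pos.2 (Real.cosh_pos R)), one_div_pow]

lemma exists_dist_center_gt (R : ℝ) :
    ∃ t : IdealSimplex, R < dist (straight t) HypSpace.center := by
  have hc : 1 ≤ Real.cosh |R| ^ 2 := one_le_pow₀ (Real.one_le_cosh _)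
  -- The point with coordinates `1 - 3ε, ε, ε, ε` runs into a cusp. Four thirds of its form is `8ε -
  -- 16ε²`, which is less than `16ε = 1 / cosh² R`.
  set ε := 1 / (16 * Real.cosh |R| ^ 2) with hε
  have h0 : 0 < ε := by positivity
  have h1 : ε ≤ 1 / 16 := by
    rw [hε]
    gcongr
    linarith
  refine ⟨⟨![1 - 3 * ε, ε, ε, ε], ⟨fun i => ?_, ?_⟩, fun i => ?_⟩, ?_⟩
  · fin_cases i <;> simp <;> linarith
  · simp [Fin.sum_univ_four]; ring
  · fin_cases i <;> simp <;> linarith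
  · refine (le_abs_self R).trans_lt (not_le.1 fun h => ?_)
    rw [dist_center_le_iff (abs_nonneg R)] at h
    have e : 1 / Real.cosh |R| ^ 2 = 16 * ε := by rw [hε]; field_simp
    rw [e] at h
    simp [form, Fin.sum_univ_four] at h
    nlinarith

/-- In the compact full simplex a positive lower bound on the form is a closed condition, and it
excludes the vertices by itself. -/
lemma isCompact_dist_center_le (R : ℝ) :
    IsCompact {t : IdealSimplex | dist (straight t) HypSpace.center ≤ R} := by
  rcases lt_or_ge R 0 with hR | hR
  · convert isCompact_empty
    ext t
    simpa using hR.trans_le dist_nonneg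
  have hval : Topology.IsInducing (Subtype.val : IdealSimplex → Fin 4 → ℝ) :=
    Topology.IsInducing.subtypeVal
  rw [hval.isCompact_iff]
  have e : Subtype.val '' {t : IdealSimplex | dist (straight t) HypSpace.center ≤ R} =
      stdSimplex ℝ (Fin 4) ∩ {u | 1 / Real.cosh R ^ 2 ≤ 4 / 3 * form u u} := by
    ext u
    constructor
    · rintro ⟨t, ht, rfl⟩
      exact ⟨t.2.1, (dist_center_le_iff hR t).1 ht⟩
    · rintro ⟨hu, hR'⟩
      have h2 : 0 < form u u := by
        have : 0 < 1 / Real.cosh R ^ 2 := one_div_pos.2 (pow_pos (Real.cosh_pos R) 2)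
        simp only [Set.mem_ofPred_eq] at hR'
        linarith
      have hT : Timelike u := ⟨by rw [hu.2]; norm_num, h2⟩
      have h3 : bary (ofCoord u) = u := by rw [bary_ofCoord_eq hT, hu.2]; simp
      refine ⟨⟨u, hu, fun i => ?_⟩, (dist_center_le_iff hR _).2 hR', rfl⟩
      rw [← h3]
      exact bary_ne_one (by rw [h3]; exact hu.1) i
  rw [e]
  refine (isCompact_stdSimplex ℝ (Fin 4)).inter_right (isClosed_le continuous_const ?_)
  unfold form
  fun_prop

/-- A radius about a point of the simplex (the same for all renumberings of the vertices) below which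
balls meet only the faces that contain the centre, and the balls about different renumberings are
disjoint. -/
structure IsSmallRadius (t : IdealSimplex) (ρ : ℝ) : Prop where
  pos : 0 < ρ
  separated : ∀ σ τ : Equiv.Perm (Fin 4), t.permute σ ≠ t.permute τ →
    2 * ρ ≤ dist (straight (t.permute σ)) (straight (t.permute τ))
  bary_pos : ∀ (σ : Equiv.Perm (Fin 4)) (i : Fin 4), (t.permute σ).1 i ≠ 0 →
    ∀ p, dist p (straight (t.permute σ)) < ρ → 0 < bary p i

/-- Each requirement holds for some positive radius, and only finitely many permutations and indices
occur, so the minimum serves. -/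
lemma exists_isSmallRadius (t : IdealSimplex) : ∃ ρ, t.IsSmallRadius ρ := by
  have h1 : ∀ σ τ : Equiv.Perm (Fin 4), ∃ ρ : ℝ, 0 < ρ ∧ (t.permute σ ≠ t.permute τ →
      2 * ρ ≤ dist (straight (t.permute σ)) (straight (t.permute τ))) := by
    intro σ τ
    by_cases h : t.permute σ = t.permute τ
    · exact ⟨1, one_pos, fun h' => absurd h h'⟩
    · refine ⟨_, half_pos (dist_pos.2 (straight_injective.ne h)), fun _ => by linarith⟩
  have h2 : ∀ (σ : Equiv.Perm (Fin 4)) (i : Fin 4), ∃ ρ : ℝ, 0 < ρ ∧ ((t.permute σ).1 i ≠ 0 →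
      ∀ p, dist p (straight (t.permute σ)) < ρ → 0 < bary p i) := by
    intro σ i
    by_cases h : (t.permute σ).1 i = 0
    · exact ⟨1, one_pos, fun h' => absurd h h'⟩
    · have h0 : straight (t.permute σ) ∈ {p | 0 < bary p i} := by
        rw [Set.mem_ofPred_eq, bary_straight]
        exact lt_of_le_of_ne ((t.permute σ).nonneg i) (Ne.symm h)
      obtain ⟨ρ, hρ, hb⟩ := Metric.isOpen_iff.1 (isOpen_bary_pos i) _ h0
      exact ⟨ρ, hρ, fun _ p hp => hb hp⟩
  choose r1 hr1 hr1' using h1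
  choose r2 hr2 hr2' using h2
  let f : Equiv.Perm (Fin 4) × Equiv.Perm (Fin 4) × Fin 4 → ℝ :=
    fun x => min (r1 x.1 x.2.1) (r2 x.1 x.2.2)
  obtain ⟨x, hx⟩ := Finite.exists_min f
  refine ⟨f x, lt_min (hr1 _ _) (hr2 _ _), fun σ τ h => ?_, fun σ i h p hp => ?_⟩
  · have := (hx (σ, τ, 0)).trans (min_le_left _ _)
    have := hr1' σ τ h
    simp only at *
    linarith
  · exact hr2' σ i h p (hp.trans_le ((hx (σ, 1, i)).trans (min_le_right _ _)))

end IdealSimplex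

/-! ## The fibres of the quotient map -/

namespace FacePairing

variable {n : ℕ} (F : FacePairing n)

/-- The identification across face `i`, extended to an isometry of the whole simplex. -/
def cross (x : Fin n × IdealSimplex) (i : Fin 4) : Fin n × IdealSimplex :=
  (F.nbr x.1 i, x.2.permute (F.perm x.1 i))

lemma glue_iff {a b : Fin n × IdealSimplex} :
    F.Glue a b ↔ ∃ i, a.2.1 i = 0 ∧ b = F.cross a i := by
  refine exists_congr fun i => and_congr_right fun _ => ?_
  rw [cross, Prod.ext_iff, ← IdealSimplex.eq_permute_iff]

lemma cross_cross (x : Fin n × IdealSimplex) (i : Fin 4) :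
    F.cross (F.cross x i) (F.perm x.1 i i) = x := by
  simp only [cross, F.nbr_nbr, F.perm_perm, IdealSimplex.permute_inv_permute]

lemma cross_apply (x : Fin n × IdealSimplex) (i : Fin 4) :
    (F.cross x i).2.1 (F.perm x.1 i i) = x.2.1 i := by
  simp [cross]

end FacePairing

namespace IdealTriangulation

variable {N : Type*} [TopologicalSpace N] (T : IdealTriangulation N)

/-- The quotient map. -/
def proj (x : Fin T.numTet × IdealSimplex) : N := T.tet x.1 x.2

lemma proj_surjective : Function.Surjective T.proj := fun y => by
  obtain ⟨x, hx⟩ := Quot.exists_rep (T.homeo.symm y)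
  refine ⟨x, ?_⟩
  change T.homeo (Quot.mk _ x) = y
  rw [hx, Homeomorph.apply_symm_apply]

lemma isQuotientMap_proj : Topology.IsQuotientMap T.proj :=
  T.homeo.isQuotientMap.comp isQuotientMap_quot_mk

lemma continuous_proj : Continuous T.proj := T.isQuotientMap_proj.continuous

lemma continuous_tet (k : Fin T.numTet) : Continuous (T.tet k) :=
  T.continuous_proj.comp (Continuous.prodMk_right k)

lemma proj_cross {x : Fin T.numTet × IdealSimplex} {i : Fin 4} (h : x.2.1 i = 0) :
    T.proj (T.pairing.cross x i) = T.proj x :=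
  congrArg T.homeo (Quot.sound (T.pairing.glue_iff.2 ⟨i, h, rfl⟩)).symm

lemma exists_lift {β : Type*} (f : Fin T.numTet × IdealSimplex → β)
    (hf : ∀ x i, x.2.1 i = 0 → f (T.pairing.cross x i) = f x) :
    ∃ g : N → β, ∀ x, g (T.proj x) = f x := by
  refine ⟨fun y => Quot.lift f ?_ (T.homeo.symm y), fun x => ?_⟩
  · intro a b h
    obtain ⟨i, hi, rfl⟩ := T.pairing.glue_iff.1 h
    exact (hf a i hi).symm
  · change Quot.lift f _ (T.homeo.symm (T.homeo (Quot.mk _ x))) = f x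
    rw [show T.homeo.symm (T.homeo (Quot.mk _ x)) = Quot.mk _ x from T.homeo.symm_apply_apply _]

/-- A predicate stable under crossing is invariant under it, because crossing back is again a
crossing. So `P` itself, as a `Prop`-valued function, descends to the quotient and is constant on
fibres. -/
lemma fiber_induction {P : Fin T.numTet × IdealSimplex → Prop} {x₀ : Fin T.numTet × IdealSimplex}
    (h₀ : P x₀) (hP : ∀ x i, P x → x.2.1 i = 0 → P (T.pairing.cross x i))
    {x : Fin T.numTet × IdealSimplex} (hx : T.proj x = T.proj x₀) : P x := by
  obtain ⟨g, hg⟩ := T.exists_lift P fun x i hi => propext ⟨fun h => by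
    have := hP _ (T.pairing.perm x.1 i i) h (by rw [T.pairing.cross_apply, hi])
    rwa [T.pairing.cross_cross] at this, fun h => hP x i h hi⟩
  rw [← hg, hx, hg]
  exact h₀

/-- Crossing a face only renumbers coordinates. Fibres are therefore finite, and one small radius
fits all their points. -/
lemma exists_permute_of_proj_eq {x x₀ : Fin T.numTet × IdealSimplex} (h : T.proj x = T.proj x₀) :
    ∃ σ, x.2 = x₀.2.permute σ := by
  refine T.fiber_induction (P := fun x => ∃ σ, x.2 = x₀.2.permute σ) ⟨1, rfl⟩ ?_ h
  rintro x i ⟨σ, hσ⟩ -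
  exact ⟨T.pairing.perm x.1 i * σ, by rw [FacePairing.cross, hσ, IdealSimplex.permute_mul]⟩

lemma finite_fiber (x₀ : Fin T.numTet × IdealSimplex) : {x | T.proj x = T.proj x₀}.Finite := by
  refine (Set.finite_range fun p : Fin T.numTet × Equiv.Perm (Fin 4) =>
    (p.1, x₀.2.permute p.2)).subset ?_
  intro x hx
  obtain ⟨σ, hσ⟩ := T.exists_permute_of_proj_eq hx
  exact ⟨(x.1, σ), Prod.ext rfl hσ.symm⟩

/-! ### Small balls about the points of a fibre -/

section SmallRadius

variable {T} {x₀ x x' z : Fin T.numTet × IdealSimplex} {ρ : ℝ}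

lemma eq_of_mem_ball (hρ : x₀.2.IsSmallRadius ρ) (hx : T.proj x = T.proj x₀)
    (hx' : T.proj x' = T.proj x₀) (h : x.1 = x'.1) {a : IdealSimplex}
    (ha : dist (straight a) (straight x.2) < ρ) (ha' : dist (straight a) (straight x'.2) < ρ) :
    x = x' := by
  obtain ⟨σ, hσ⟩ := T.exists_permute_of_proj_eq hx
  obtain ⟨τ, hτ⟩ := T.exists_permute_of_proj_eq hx'
  refine Prod.ext h ?_
  by_contra hne
  rw [hσ, hτ] at hne
  have h1 := hρ.separated σ τ hne
  rw [← hσ, ← hτ] at h1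
  have := dist_triangle_left (straight x.2) (straight x'.2) (straight a)
  linarith

lemma bary_pos_of_ball (hρ : x₀.2.IsSmallRadius ρ) (hx : T.proj x = T.proj x₀) {i : Fin 4}
    (hi : x.2.1 i ≠ 0) {p : HypSpace} (hp : dist p (straight x.2) < ρ) : 0 < bary p i := by
  obtain ⟨σ, hσ⟩ := T.exists_permute_of_proj_eq hx
  rw [hσ] at hi hp
  exact hρ.bary_pos σ i hi p hp

/-- A small ball meets only faces through its centre. Hence whenever a nearby point can be carried
across a face, so can the centre. -/
lemma eq_zero_of_ball (hρ : x₀.2.IsSmallRadius ρ) (hx : T.proj x = T.proj x₀) {i : Fin 4}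
    {a : IdealSimplex} (ha : dist (straight a) (straight x.2) < ρ) (hi : a.1 i = 0) :
    x.2.1 i = 0 := by
  by_contra h
  have := bary_pos_of_ball hρ hx h ha
  rw [bary_straight, hi] at this
  exact lt_irrefl _ this

end SmallRadius

/-! ## The glued metric -/

/-- Functions that are `1`-Lipschitz on every simplex. -/
def IsTetLipschitz (f : N → ℝ) : Prop :=
  ∀ k a b, |f (T.tet k a) - f (T.tet k b)| ≤ dist (straight a) (straight b)

/-- A function given near the points of one fibre, compatible with the face pairings, and equal to
the constant `c` near the boundary of the balls, extends by `c`. -/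
theorem exists_isTetLipschitz {x₀ : Fin T.numTet × IdealSimplex} {ρ : ℝ}
    (hρ : x₀.2.IsSmallRadius ρ) (c : ℝ) (g : Fin T.numTet × IdealSimplex → IdealSimplex → ℝ)
    (hg : ∀ x, T.proj x = T.proj x₀ → ∀ a b, dist (straight a) (straight x.2) < ρ →
      dist (straight b) (straight x.2) < ρ → |g x a - g x b| ≤ dist (straight a) (straight b))
    (hglue : ∀ x, T.proj x = T.proj x₀ → ∀ i, x.2.1 i = 0 → ∀ a : IdealSimplex, a.1 i = 0 →
      dist (straight a) (straight x.2) < ρ →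
        g (T.pairing.cross x i) (a.permute (T.pairing.perm x.1 i)) = g x a)
    (hc : ∀ x, T.proj x = T.proj x₀ → ∀ a, dist (straight a) (straight x.2) < ρ → g x a ≤ c)
    (hc' : ∀ x, T.proj x = T.proj x₀ → ∀ a, dist (straight a) (straight x.2) < ρ →
      c - g x a ≤ ρ - dist (straight a) (straight x.2)) :
    ∃ f, T.IsTetLipschitz f ∧
      (∀ x, T.proj x = T.proj x₀ → ∀ a, dist (straight a) (straight x.2) < ρ →
        f (T.tet x.1 a) = g x a) ∧
      ∀ k a, (∀ x, T.proj x = T.proj x₀ → x.1 = k → ρ ≤ dist (straight a) (straight x.2)) →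
        f (T.tet k a) = c := by
  classical
  let near (z x : Fin T.numTet × IdealSimplex) : Prop :=
    T.proj x = T.proj x₀ ∧ x.1 = z.1 ∧ dist (straight z.2) (straight x.2) < ρ
  let f (z : Fin T.numTet × IdealSimplex) : ℝ := if h : ∃ x, near z x then g h.choose z.2 else c
  have hf : ∀ {z x}, near z x → f z = g x z.2 := by
    intro z x h
    have h' : ∃ x, near z x := ⟨x, h⟩
    have e : h'.choose = x := eq_of_mem_ball hρ h'.choose_spec.1 h.1
      (h'.choose_spec.2.1.trans h.2.1.symm) h'.choose_spec.2.2 h.2.2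
    simp only [f, dif_pos h', e]
  have hf' : ∀ {z}, (¬ ∃ x, near z x) → f z = c := fun h => dif_neg h
  -- Crossing carries the ball about `x` isometrically to the ball about the crossed centre.
  -- Together with crossing back, this makes nearness to the fibre invariant under gluing, so that
  -- `f` descends.
  have hnear : ∀ {z x i}, near z x → z.2.1 i = 0 →
      near (T.pairing.cross z i) (T.pairing.cross x i) := by
    rintro z x i ⟨h1, h2, h3⟩ hi
    refine ⟨(T.proj_cross (eq_zero_of_ball hρ h1 h3 hi)).trans h1, ?_, ?_⟩
    · simp only [FacePairing.cross, h2]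
    · simp only [FacePairing.cross, h2, IdealSimplex.dist_straight_permute, h3]
  have hinv : ∀ z i, z.2.1 i = 0 → f (T.pairing.cross z i) = f z := by
    intro z i hi
    by_cases h : ∃ x, near z x
    · obtain ⟨x, hx⟩ := h
      rw [hf hx, hf (hnear hx hi), ← hglue x hx.1 i (eq_zero_of_ball hρ hx.1 hx.2.2 hi) z.2 hi hx.2.2]
      simp only [FacePairing.cross, hx.2.1]
    · rw [hf' h, hf']
      rintro ⟨x, hx⟩
      have := hnear hx (i := T.pairing.perm z.1 i i) (by rw [FacePairing.cross_apply, hi])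
      rw [FacePairing.cross_cross] at this
      exact h ⟨_, this⟩
  obtain ⟨F, hF⟩ := T.exists_lift f hinv
  refine ⟨F, ?_, fun x hx a ha => (hF (x.1, a)).trans (hf ⟨hx, rfl, ha⟩), fun k a h =>
    (hF (k, a)).trans (hf' ?_)⟩
  -- A one-sided estimate suffices by symmetry. If `b` is far from the fibre, `f b = c` is the
  -- maximal value. If `b` lies in a ball that `a` does not, then `c - f b` is at most the distance
  -- from `b` to the boundary of the ball, hence at most the distance to `a`.
  · have key : ∀ k a b, f (k, a) - f (k, b) ≤ dist (straight a) (straight b) := by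
      intro k a b
      by_cases hb : ∃ x, near (k, b) x
      · obtain ⟨y, hy1, hy2, hy3⟩ := hb
        rw [hf ⟨hy1, hy2, hy3⟩]
        have hby := hc' y hy1 b hy3
        by_cases ha : dist (straight a) (straight y.2) < ρ
        · rw [hf (z := (k, a)) ⟨hy1, hy2, ha⟩]
          exact (le_abs_self _).trans (hg y hy1 a b ha hy3)
        · have hac : f (k, a) ≤ c := by
            by_cases h : ∃ x, near (k, a) x
            · obtain ⟨x, hx⟩ := h
              rw [hf hx]; exact hc x hx.1 a hx.2.2
            · rw [hf' h]
          have := dist_triangle (straight a) (straight b) (straight y.2)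
          simp only at *
          linarith
      · rw [hf' hb]
        have : f (k, a) ≤ c := by
          by_cases h : ∃ x, near (k, a) x
          · obtain ⟨x, hx⟩ := h
            rw [hf hx]; exact hc x hx.1 a hx.2.2
          · rw [hf' h]
        have := dist_nonneg (x := straight a) (y := straight b)
        linarith
    intro k a b
    have e : ∀ a, F (T.tet k a) = f (k, a) := fun a => hF (k, a)
    rw [e, e, abs_le]
    have h1 := key k a b
    have h2 := key k b a
    rw [dist_comm] at h2
    constructor <;> linarith
  · rintro ⟨x, hx1, hx2, hx3⟩
    exact absurd hx3 (not_lt.2 (h x hx1 hx2))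

/-- The space `N`, to be equipped with the glued metric. -/
def Glued (_ : IdealTriangulation N) : Type _ := N

/-- The quotient map from a simplex to the glued metric space. -/
def toGlued (k : Fin T.numTet) (a : IdealSimplex) : T.Glued := T.tet k a

lemma toGlued_surjective (y : T.Glued) : ∃ k a, T.toGlued k a = y := by
  obtain ⟨x, hx⟩ := T.proj_surjective y
  exact ⟨x.1, x.2, hx⟩

/-- The supremum of `|f x - f y|` over all functions that are `1`-Lipschitz on every simplex. -/
instance : PseudoEMetricSpace T.Glued where
  edist x y := ⨆ f : {f : N → ℝ // T.IsTetLipschitz f}, edist (f.1 x) (f.1 y)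
  edist_self x := by simp
  edist_comm x y := by simp only [edist_comm]
  edist_triangle x y z := iSup_le fun f => (edist_triangle _ (f.1 y) _).trans
    (add_le_add (le_iSup (fun f : {f : N → ℝ // T.IsTetLipschitz f} => edist (f.1 x) (f.1 y)) f)
      (le_iSup (fun f : {f : N → ℝ // T.IsTetLipschitz f} => edist (f.1 y) (f.1 z)) f))

lemma edist_le_edist {f : N → ℝ} (hf : T.IsTetLipschitz f) (x y : T.Glued) :
    edist (f x) (f y) ≤ edist x y :=
  le_iSup (fun f : {f : N → ℝ // T.IsTetLipschitz f} => edist (f.1 x) (f.1 y)) ⟨f, hf⟩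

lemma edist_toGlued_le (k : Fin T.numTet) (a b : IdealSimplex) :
    edist (T.toGlued k a) (T.toGlued k b) ≤ edist (straight a) (straight b) :=
  iSup_le fun f => by
    rw [edist_dist, edist_dist, Real.dist_eq]
    exact ENNReal.ofReal_le_ofReal (f.2 k a b)

/-- The test function is the distance to the fibre, cut off at `ρ`. It bounds the glued distance
from below, so a small glued ball is covered by the hyperbolic balls about the points of the fibre.
-/
lemma exists_of_edist_lt {x₀ : Fin T.numTet × IdealSimplex} {ρ : ℝ}
    (hρ : x₀.2.IsSmallRadius ρ) {y : T.Glued}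
    (hy : edist y (T.toGlued x₀.1 x₀.2) < ENNReal.ofReal ρ) :
    ∃ x, T.proj x = T.proj x₀ ∧ ∃ a, T.toGlued x.1 a = y ∧
      dist (straight a) (straight x.2) < ρ ∧
      edist (straight a) (straight x.2) ≤ edist y (T.toGlued x₀.1 x₀.2) := by
  obtain ⟨f, hf, hf1, hf2⟩ := T.exists_isTetLipschitz hρ ρ
    (fun x a => dist (straight a) (straight x.2))
    (fun x _ a b _ _ => abs_dist_sub_le _ _ _)
    (fun x _ i _ a _ _ => IdealSimplex.dist_straight_permute _ _ _)
    (fun x _ a h => h.le) (fun x _ a h => le_rfl)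
  obtain ⟨k, a, rfl⟩ := T.toGlued_surjective y
  have h0 : f (T.tet x₀.1 x₀.2) = 0 := by
    rw [hf1 x₀ rfl x₀.2 (by rw [dist_self]; exact hρ.pos), dist_self]
  have h1 := T.edist_le_edist hf (T.toGlued k a) (T.toGlued x₀.1 x₀.2)
  rw [toGlued, toGlued, h0, edist_dist, Real.dist_eq, sub_zero] at h1
  by_cases h : ∃ x, T.proj x = T.proj x₀ ∧ x.1 = k ∧ dist (straight a) (straight x.2) < ρ
  · obtain ⟨x, hx1, rfl, hx3⟩ := h
    rw [hf1 x hx1 a hx3, abs_of_nonneg dist_nonneg, ← edist_dist] at h1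
    exact ⟨x, hx1, a, rfl, hx3, h1⟩
  · push Not at h
    rw [hf2 k a h, abs_of_pos hρ.pos] at h1
    exact absurd (h1.trans_lt hy) (lt_irrefl _)

instance : EMetricSpace T.Glued where
  eq_of_edist_eq_zero {y z} h := by
    obtain ⟨k, t, rfl⟩ := T.toGlued_surjective z
    obtain ⟨ρ, hρ⟩ := t.exists_isSmallRadius
    obtain ⟨x, hx, a, rfl, -, ha⟩ := T.exists_of_edist_lt (x₀ := (k, t)) hρ (y := y) (by
      rw [h]; exact ENNReal.ofReal_pos.2 hρ.pos)
    rw [h, nonpos_iff_eq_zero, edist_eq_zero] at ha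
    rw [straight_injective ha]
    exact hx

lemma continuous_toGlued (k : Fin T.numTet) : Continuous (T.toGlued k) := by
  have : LipschitzWith 1 fun p : Set.range straight => T.toGlued k (toSimplex p.1) := by
    intro p q
    obtain ⟨_, a, rfl⟩ := p
    obtain ⟨_, b, rfl⟩ := q
    rw [ENNReal.coe_one, one_mul]
    simp only [toSimplex_straight]
    exact T.edist_toGlued_le k a b
  have h2 := this.continuous.comp
    (continuous_straight.subtype_mk (p := fun p => p ∈ Set.range straight)
      (fun a => Set.mem_range_self a))
  convert h2 using 1
  ext a
  simp only [Function.comp_apply, toSimplex_straight]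

/-- The identity from the glued metric space to `N`. -/
def ofGlued (y : T.Glued) : N := y

/-- The identity from `N` to the glued metric space. -/
def mkGlued (y : N) : T.Glued := y

lemma continuous_mkGlued : Continuous T.mkGlued := by
  refine T.isQuotientMap_proj.continuous_iff.2 ?_
  refine continuous_prod_of_discrete_left.2 fun k => ?_
  exact T.continuous_toGlued k

/-- A neighbourhood in the quotient topology contains a hyperbolic ball about each point of the
fibre. The fibre is finite, so there is a least radius, and the glued ball of that radius fits
inside. -/
lemma continuous_ofGlued : Continuous T.ofGlued := by
  refine continuous_iff_continuousAt.2 fun y => ?_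
  obtain ⟨k, t, rfl⟩ := T.toGlued_surjective y
  obtain ⟨ρ, hρ⟩ := t.exists_isSmallRadius
  intro U hU
  have hx : ∀ x, T.proj x = T.proj (k, t) → ∃ ε : ℝ, 0 < ε ∧ ∀ a,
      dist (straight a) (straight x.2) < ε → T.tet x.1 a ∈ U := by
    intro x hx
    have h1 : (T.tet x.1) ⁻¹' U ∈ nhds x.2 := by
      refine (T.continuous_tet x.1).continuousAt ?_
      change U ∈ nhds (T.proj x)
      rw [hx]
      exact hU
    rw [isInducing_straight.nhds_eq_comap, Filter.mem_comap] at h1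
    obtain ⟨V, hV, hVU⟩ := h1
    obtain ⟨ε, hε, hb⟩ := Metric.mem_nhds_iff.1 hV
    exact ⟨ε, hε, fun a ha => hVU (hb ha)⟩
  choose! ε hε hεU using hx
  obtain ⟨x₁, hx₁, hmin⟩ := (T.finite_fiber (k, t)).exists_minimalFor ε _ ⟨(k, t), rfl⟩
  have hball : Metric.eball (T.toGlued k t) (ENNReal.ofReal (min ρ (ε x₁))) ∈
      nhds (T.toGlued k t) :=
    Metric.eball_mem_nhds _ (ENNReal.ofReal_pos.2 (lt_min hρ.pos (hε _ hx₁)))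
  refine Filter.mem_of_superset hball fun z hz => ?_
  obtain ⟨x, hx, a, rfl, -, ha⟩ := T.exists_of_edist_lt (x₀ := (k, t)) hρ (y := z)
    (hz.trans_le (ENNReal.ofReal_le_ofReal (min_le_left _ _)))
  have h2 := ha.trans_lt hz
  rw [edist_dist, ENNReal.ofReal_lt_ofReal_iff_of_nonneg dist_nonneg, lt_min_iff] at h2
  refine hεU x hx a (h2.2.trans_le ?_)
  rcases le_total (ε x₁) (ε x) with h | h
  · exact h
  · exact hmin hx h

/-- The glued metric as a metric on `N`. -/
@[reducible] def gluedMetric : EMetricSpace N := (inferInstance : EMetricSpace T.Glued)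

/-- The glued metric induces the quotient topology. -/
theorem gluedMetric_topology_eq :
    T.gluedMetric.toUniformSpace.toTopologicalSpace = ‹TopologicalSpace N› :=
  le_antisymm (continuous_id_iff_le.1 T.continuous_ofGlued)
    (continuous_id_iff_le.1 T.continuous_mkGlued)

end IdealTriangulation

namespace IdealTriangulation

variable {N : Type*} [TopologicalSpace N] (T : IdealTriangulation N)

/-! ## Completeness -/

/-- The distance from the centres of the simplices is a proper `1`-Lipschitz function. -/
lemma exists_height : ∃ f : N → ℝ, T.IsTetLipschitz f ∧
    ∀ k a, f (T.tet k a) = dist (straight a) HypSpace.center := by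
  obtain ⟨f, hf⟩ := T.exists_lift (fun x => dist (straight x.2) HypSpace.center) (by
    intro x i _
    change dist (straight (x.2.permute _)) _ = _
    rw [← straight_center, ← IdealSimplex.permute_center (T.pairing.perm x.1 i),
      IdealSimplex.dist_straight_permute, IdealSimplex.permute_center])
  refine ⟨f, fun k a b => ?_, fun k a => hf (k, a)⟩
  have e : ∀ a, f (T.tet k a) = _ := fun a => hf (k, a)
  rw [e, e]
  exact abs_dist_sub_le _ _ _

/-- The height is `1`-Lipschitz, so a Cauchy sequence eventually has bounded height and stays in a
finite union of images of compact truncated simplices. -/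
instance : CompleteSpace T.Glued := by
  refine EMetric.complete_of_cauchySeq_tendsto fun u hu => ?_
  obtain ⟨f, hf, hf'⟩ := T.exists_height
  obtain ⟨n, hn⟩ := EMetric.cauchySeq_iff'.1 hu 1 one_pos
  set R := f (u n) + 1
  let K : Set T.Glued := ⋃ k, T.toGlued k '' {t | dist (straight t) HypSpace.center ≤ R}
  have hK : IsCompact K := isCompact_iUnion fun k =>
    (IdealSimplex.isCompact_dist_center_le R).image (T.continuous_toGlued k)
  have huK : ∀ m, u (m + n) ∈ K := by
    intro m
    have h1 := (T.edist_le_edist hf _ _).trans_lt (hn (m + n) (by omega))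
    rw [edist_dist, ENNReal.ofReal_lt_one, Real.dist_eq] at h1
    obtain ⟨k, a, ha⟩ := T.toGlued_surjective (u (m + n))
    refine Set.mem_iUnion.2 ⟨k, a, ?_, ha⟩
    have h2 := (abs_lt.1 h1).2
    rw [← ha] at h2
    change f (T.tet k a) - _ < _ at h2
    rw [hf'] at h2
    change _ ≤ f (u n) + 1
    linarith
  obtain ⟨y, -, hy⟩ := cauchySeq_tendsto_of_isComplete hK.isComplete huK
    (hu.comp_tendsto (Filter.tendsto_add_atTop_nat n))
  exact ⟨y, (Filter.tendsto_add_atTop_iff_nat n).1 hy⟩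

/-- The height is continuous and unbounded on every simplex; nonemptiness provides a simplex. -/
lemma noncompactSpace [Nonempty N] (T : IdealTriangulation N) : NoncompactSpace N := by
  refine ⟨fun hN => ?_⟩
  obtain ⟨f, hf, hf'⟩ := T.exists_height
  have hc : Continuous f := by
    refine T.isQuotientMap_proj.continuous_iff.2 ?_
    have : f ∘ T.proj = fun x => dist (straight x.2) HypSpace.center :=
      funext fun x => hf' x.1 x.2
    rw [this]
    exact (continuous_straight.comp continuous_snd).dist continuous_const
  obtain ⟨C, hC⟩ := hN.exists_bound_of_continuousOn hc.continuousOn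
  obtain ⟨x, -⟩ := T.proj_surjective (Classical.arbitrary N)
  obtain ⟨t, ht⟩ := IdealSimplex.exists_dist_center_gt C
  have := hC (T.tet x.1 t) (Set.mem_univ _)
  rw [hf'] at this
  exact absurd ((le_abs_self _).trans this) (not_le.2 ht)

end IdealTriangulation

/-! ## Geodesics -/

namespace IdealSimplex

/-- The point at time `s` on the segment from `a` to `b`. -/
def segment (a b : IdealSimplex) (s : unitInterval) : IdealSimplex :=
  ⟨(1 - s.1) • a.1 + s.1 • b.1,
    convex_stdSimplex ℝ (Fin 4) a.2.1 b.2.1 (by linarith [s.2.2]) s.2.1 (by ring), fun i h => by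
      have hle : ∀ t : IdealSimplex, t.1 i < 1 := fun t => lt_of_le_of_ne
        ((Finset.single_le_sum (fun j _ => t.nonneg j) (Finset.mem_univ i)).trans_eq t.2.1.2)
        (t.2.2 i)
      simp only [Pi.add_apply, Pi.smul_apply, smul_eq_mul] at h
      have ha := hle a
      have hb := hle b
      have h0 := s.2.1
      rcases eq_or_lt_of_le s.2.2 with h1 | h1
      · rw [h1] at h
        linarith
      · nlinarith [mul_pos (sub_pos.2 h1) (sub_pos.2 ha), mul_nonneg h0 (sub_pos.2 hb).le]⟩

lemma segment_zero (a b : IdealSimplex) : segment a b 0 = a := Subtype.ext (by simp [segment])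

lemma segment_one (a b : IdealSimplex) : segment a b 1 = b := Subtype.ext (by simp [segment])

lemma continuous_segment (a b : IdealSimplex) : Continuous (segment a b) := by
  unfold segment
  refine Continuous.subtype_mk ?_ _
  fun_prop

lemma dist_segment_add (a b : IdealSimplex) {s s' : unitInterval} (h : s ≤ s') :
    dist (straight a) (straight (segment a b s)) +
      dist (straight (segment a b s)) (straight (segment a b s')) =
        dist (straight a) (straight (segment a b s')) := by
  rcases eq_or_lt_of_le s'.2.1 with h0 | h0
  · have : s = s' := le_antisymm h (by rw [← Subtype.coe_le_coe, ← h0]; exact s.2.1)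
    rw [this, dist_self, add_zero]
  have h1 : s.1 / s'.1 ≤ 1 := div_le_one_of_le₀ h h0.le
  have h2 : 0 ≤ s.1 / s'.1 := div_nonneg s.2.1 h0.le
  -- The parametrisation is affine in the coordinates, so the earlier point divides the shorter
  -- segment from `a` in the ratio of the parameters.
  have e : (segment a b s).1 = (1 - s.1 / s'.1) • a.1 + (s.1 / s'.1) • (segment a b s').1 := by
    ext i
    simp only [segment, Pi.add_apply, Pi.smul_apply, smul_eq_mul]
    field_simp
    ring
  have := dist_add_dist_combination a.timelike (segment a b s').timelike (sub_nonneg.2 h1) h2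
    (by linarith)
  rwa [← e, ofCoord_idealSimplex, ofCoord_idealSimplex, ofCoord_idealSimplex] at this

end IdealSimplex

/-- Concatenation of paths is subadditive for the length. -/
lemma eVariationOn_trans_le {X : Type*} [PseudoEMetricSpace X] {x y z : X} (γ : Path x y)
    (γ' : Path y z) : eVariationOn (γ.trans γ') Set.univ ≤
      eVariationOn γ Set.univ + eVariationOn γ' Set.univ := by
  let half : unitInterval := ⟨1 / 2, by norm_num, by norm_num⟩
  have hu : (Set.univ : Set unitInterval) = Set.Iic half ∪ Set.Ici half := Set.Iic_union_Ici.symm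
  -- Clamping to the unit interval makes the two reparametrisations `2t` and `2t - 1` monotone on
  -- all of it, so each half of the concatenation is a monotone reparametrisation of one path.
  have hm : ∀ c : ℝ, Monotone fun t : unitInterval =>
      Set.projIcc (0 : ℝ) 1 zero_le_one (2 * t.1 - c) := by
    intro c s t h
    refine Set.monotone_projIcc _ ?_
    have : s.1 ≤ t.1 := h
    linarith
  conv_lhs => rw [hu, eVariationOn.union _ isGreatest_Iic isLeast_Ici]
  gcongr
  · have e : Set.EqOn (γ.trans γ') (γ ∘ fun t : unitInterval =>
        Set.projIcc (0 : ℝ) 1 zero_le_one (2 * t.1 - 0)) (Set.Iic half) := by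
      intro t ht
      have ht' : t.1 ≤ 1 / 2 := ht
      have h0 := t.2.1
      rw [Path.trans_apply, dif_pos ht', Function.comp_apply, Set.projIcc_of_mem _ (by
        constructor <;> linarith)]
      simp
    rw [eVariationOn.congr e]
    exact eVariationOn.comp_le_of_monotoneOn _ _ ((hm 0).monotoneOn _) fun _ _ => Set.mem_univ _
  · have e : Set.EqOn (γ.trans γ') (γ' ∘ fun t : unitInterval =>
        Set.projIcc (0 : ℝ) 1 zero_le_one (2 * t.1 - 1)) (Set.Ici half) := by
      intro t ht
      have ht' : 1 / 2 ≤ t.1 := ht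
      have h0 := t.2.2
      rw [Path.trans_apply, Function.comp_apply, Set.projIcc_of_mem _ (by
        constructor <;> linarith)]
      split_ifs with h
      · have : t.1 = 1 / 2 := le_antisymm h ht'
        simp [this]
      · rfl
    rw [eVariationOn.congr e]
    exact eVariationOn.comp_le_of_monotoneOn _ _ ((hm 1).monotoneOn _) fun _ _ => Set.mem_univ _

/-! ### Straight segments in the glued space and the length metric -/

namespace IdealTriangulation

variable {N : Type*} [TopologicalSpace N] (T : IdealTriangulation N)

/-- The segment from `a` to `b` in a simplex, as a path in the glued space. -/
def segmentPath (k : Fin T.numTet) (a b : IdealSimplex) : Path (T.toGlued k a) (T.toGlued k b) where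
  toFun s := T.toGlued k (a.segment b s)
  continuous_toFun := (T.continuous_toGlued k).comp (IdealSimplex.continuous_segment a b)
  source' := by rw [IdealSimplex.segment_zero]
  target' := by rw [IdealSimplex.segment_one]

/-- Along the segment the distance `F` from `a` is monotone, and the distance of two of its points
is the difference of their values of `F`. The length is therefore at most the total increase of `F`.
-/
lemma eVariationOn_segmentPath_le (k : Fin T.numTet) (a b : IdealSimplex) :
    eVariationOn (T.segmentPath k a b) Set.univ ≤ edist (straight a) (straight b) := by
  let F : unitInterval → ℝ := fun s => dist (straight a) (straight (a.segment b s))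
  have hF : ∀ {s s'}, s ≤ s' →
      dist (straight (a.segment b s)) (straight (a.segment b s')) = F s' - F s := fun h => by
    have := IdealSimplex.dist_segment_add a b h
    simp only [F]
    linarith
  have hmono : Monotone F := fun s s' h => by
    have := hF h
    have := dist_nonneg (x := straight (a.segment b s)) (y := straight (a.segment b s'))
    linarith
  have hle : eVariationOn (T.segmentPath k a b) Set.univ ≤ eVariationOn F Set.univ := by
    refine iSup_le fun p => le_trans (Finset.sum_le_sum fun i _ => ?_)
      (eVariationOn.sum_le p.2.2.1 p.2.2.2 (n := p.1))
    have hi := p.2.2.1 (Nat.le_succ i)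
    refine (T.edist_toGlued_le k _ _).trans ?_
    rw [edist_dist, edist_dist, dist_comm, hF hi, Real.dist_eq, abs_of_nonneg]
    exact sub_nonneg.2 (hmono hi)
  refine hle.trans ?_
  have h2 := (hmono.monotoneOn Set.univ).eVariationOn_eq (Set.mem_univ 0) (Set.mem_univ 1)
  have e : Set.univ ∩ Set.Icc (0 : unitInterval) 1 = Set.univ := by
    ext s; simp [unitInterval.le_one']
  rw [e] at h2
  rw [h2, edist_dist]
  refine ENNReal.ofReal_le_ofReal ?_
  simp [F, IdealSimplex.segment_zero, IdealSimplex.segment_one]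

/-- The infimum `ℓ` of the lengths of paths from `x` grows along a simplex by at most the hyperbolic
distance, since a segment can be appended. A truncation of `ℓ` is thus one of the test functions in
the supremum that defines the glued distance. -/
theorem isLengthMetric_glued : IsLengthMetric T.Glued := by
  intro x y
  let ℓ (z : T.Glued) : ℝ≥0∞ := ⨅ γ : Path x z, eVariationOn γ Set.univ
  refine le_antisymm (le_iInf fun γ => ?_) ?_
  · have := eVariationOn.edist_le γ (Set.mem_univ 0) (Set.mem_univ 1)
    rwa [γ.source, γ.target] at this
  · rcases eq_or_ne (edist x y) ⊤ with htop | htop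
    · rw [htop]; exact le_top
    change ℓ y ≤ edist x y
    have hstep : ∀ k a b, ℓ (T.toGlued k b) ≤ ℓ (T.toGlued k a) + edist (straight a) (straight b) := by
      intro k a b
      rw [ENNReal.iInf_add]
      refine le_iInf fun γ => (iInf_le _ (γ.trans (T.segmentPath k a b))).trans ?_
      exact (eVariationOn_trans_le _ _).trans (by gcongr; exact T.eVariationOn_segmentPath_le k a b)
    have h0 : ℓ x = 0 := by
      refine nonpos_iff_eq_zero.1 ((iInf_le _ (Path.refl x)).trans ?_)
      exact (eVariationOn.constant_on (f := Path.refl x) (by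
        rintro _ ⟨s, -, rfl⟩ _ ⟨t, -, rfl⟩; rfl)).le
    -- The truncation makes the test function real-valued. Its level lies strictly above the
    -- distance in question, so it cannot be the value attained at `y`.
    set R := edist x y + 1 with hR
    have hRtop : R ≠ ⊤ := ENNReal.add_ne_top.2 ⟨htop, ENNReal.one_ne_top⟩
    have hmin : ∀ z, min (ℓ z) R ≠ ⊤ := fun z => ne_top_of_le_ne_top hRtop (min_le_right _ _)
    let f : N → ℝ := fun z => (min (ℓ z) R).toReal
    have hf : T.IsTetLipschitz f := by
      have key : ∀ k a b, f (T.tet k b) ≤ f (T.tet k a) + dist (straight a) (straight b) := by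
        intro k a b
        rw [dist_edist]
        refine (ENNReal.toReal_mono (ENNReal.add_ne_top.2 ⟨hmin _, edist_ne_top _ _⟩) ?_).trans
          (ENNReal.toReal_add (hmin (T.tet k a)) (edist_ne_top _ _)).le
        rw [min_add]
        exact min_le_min (hstep k a b) le_self_add
      intro k a b
      rw [abs_le]
      have h1 := key k a b
      have h2 := key k b a
      rw [dist_comm] at h2
      constructor <;> linarith
    have h1 := T.edist_le_edist hf x y
    have hfx : f x = 0 := by simp only [f, h0]; simp
    rw [hfx, edist_comm, edist_dist, Real.dist_eq, sub_zero, abs_of_nonneg ENNReal.toReal_nonneg,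
      ENNReal.ofReal_toReal (hmin y)] at h1
    rcases min_le_iff.1 h1 with h | h
    · exact h
    · exact absurd h (not_le.2 (ENNReal.lt_add_right htop one_ne_zero))

end IdealTriangulation

namespace IdealTriangulation

variable {N : Type*} [TopologicalSpace N] (T : IdealTriangulation N)

/-! ## Charts -/

/-- A developing relation from the simplices around the point `T.proj x₀` to a model space `M`:
`rel x a p` says that `p` is the position in `M` of the point `a` of the simplex `x.1`, seen from the
point `x` of the fibre. -/
structure Chart (x₀ : Fin T.numTet × IdealSimplex) (ρ : ℝ) {M : Type*} [PseudoMetricSpace M]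
    (o : M) where
  small : x₀.2.IsSmallRadius ρ
  rel : Fin T.numTet × IdealSimplex → IdealSimplex → M → Prop
  total : ∀ x, T.proj x = T.proj x₀ → ∀ a, dist (straight a) (straight x.2) < ρ → ∃ p, rel x a p
  dist_le : ∀ {x a b p q}, T.proj x = T.proj x₀ → rel x a p → rel x b q →
    dist p q ≤ dist (straight a) (straight b)
  glue : ∀ {x i a p q}, T.proj x = T.proj x₀ → x.2.1 i = 0 → a.1 i = 0 → rel x a p →
    rel (T.pairing.cross x i) (a.permute (T.pairing.perm x.1 i)) q → dist p q = 0
  dist_origin : ∀ {x a p}, T.proj x = T.proj x₀ → rel x a p →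
    dist o p = dist (straight a) (straight x.2)
  surj : ∀ p, dist o p < ρ / 3 → ∃ x a, T.proj x = T.proj x₀ ∧ rel x a p
  le : ∀ {x x' a b p q}, T.proj x = T.proj x₀ → T.proj x' = T.proj x₀ → rel x a p → rel x' b q →
    dist o p < ρ / 3 → dist o q < ρ / 3 →
    edist (T.toGlued x.1 a) (T.toGlued x'.1 b) ≤ ENNReal.ofReal (dist p q)

namespace Chart

variable {T} {x₀ : Fin T.numTet × IdealSimplex} {ρ : ℝ} {M : Type*} [PseudoMetricSpace M] {o : M}
  (C : T.Chart x₀ ρ o)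
include C

/-- The lower bound uses the distance from `p` in the model, cut off at `2ρ / 3` and transported by
the chart. As `p` is within `ρ / 3` of `o`, the cut-off is reached before the boundary of the
`ρ`-ball, so the function extends by a constant. As `q` is within `ρ / 3` too, the cut-off does not
affect the distance of `p` and `q`. -/
lemma edist_eq {x x' : Fin T.numTet × IdealSimplex} {a b : IdealSimplex} {p q : M}
    (hx : T.proj x = T.proj x₀) (hx' : T.proj x' = T.proj x₀) (ha : C.rel x a p)
    (hb : C.rel x' b q) (hp : dist o p < ρ / 3) (hq : dist o q < ρ / 3) :
    edist (T.toGlued x.1 a) (T.toGlued x'.1 b) = ENNReal.ofReal (dist p q) := by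
  classical
  refine le_antisymm (C.le hx hx' ha hb hp hq) ?_
  have hρ := C.small.pos
  -- A position is chosen for each point. Any two positions of a point seen from the same place are
  -- at distance zero by `dist_le`, so the choice does not matter.
  let φ (z : Fin T.numTet × IdealSimplex) (c : IdealSimplex) : M :=
    if h : ∃ p, C.rel z c p then h.choose else o
  have hφ : ∀ z, T.proj z = T.proj x₀ → ∀ c, dist (straight c) (straight z.2) < ρ →
      C.rel z c (φ z c) := by
    intro z hz c hc
    have h := C.total z hz c hc
    simp only [φ, dif_pos h]
    exact h.choose_spec
  have hda : dist (straight a) (straight x.2) < ρ := by rw [← C.dist_origin hx ha]; linarith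
  have hdb : dist (straight b) (straight x'.2) < ρ := by rw [← C.dist_origin hx' hb]; linarith
  obtain ⟨f, hf, hf1, -⟩ := T.exists_isTetLipschitz C.small (2 * ρ / 3)
    (fun z c => min (dist p (φ z c)) (2 * ρ / 3))
    (fun z hz c d hc hd => (abs_inf_sub_inf_le_abs _ _ _).trans <| by
      rw [dist_comm p, dist_comm p]
      exact (abs_dist_sub_le _ _ _).trans (C.dist_le hz (hφ z hz c hc) (hφ z hz d hd)))
    (fun z hz i hi c hc hcz => by
      have h1 := hφ z hz c hcz
      have h2 := hφ (T.pairing.cross z i) ((T.proj_cross hi).trans hz)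
        (c.permute (T.pairing.perm z.1 i)) (by
          simpa only [FacePairing.cross, IdealSimplex.dist_straight_permute] using hcz)
      have h3 := C.glue hz hi hc h1 h2
      have h4 := dist_triangle p (φ z c) (φ (T.pairing.cross z i) (c.permute (T.pairing.perm z.1 i)))
      have h5 := dist_triangle_right p (φ z c)
        (φ (T.pairing.cross z i) (c.permute (T.pairing.perm z.1 i)))
      congr 1
      linarith)
    (fun z hz c _ => min_le_right _ _)
    (fun z hz c hc => by
      have hc2 := hc
      rw [← C.dist_origin hz (hφ z hz c hc)] at hc2 ⊢
      have := dist_triangle o p (φ z c)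
      rcases le_total (dist p (φ z c)) (2 * ρ / 3) with h | h
      · rw [min_eq_left h]; linarith
      · rw [min_eq_right h]; linarith)
  have e1 : f (T.tet x.1 a) = 0 := by
    rw [hf1 x hx a hda]
    have h1 := C.dist_le hx ha (hφ x hx a hda)
    rw [dist_self] at h1
    rw [le_antisymm h1 dist_nonneg, min_eq_left (by positivity)]
  have e2 : f (T.tet x'.1 b) = dist p q := by
    rw [hf1 x' hx' b hdb]
    have h1 := C.dist_le hx' hb (hφ x' hx' b hdb)
    rw [dist_self] at h1
    have h2 := dist_triangle p q (φ x' b)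
    have h3 := dist_triangle_right p q (φ x' b)
    have h4 := dist_triangle_left p q o
    rw [min_eq_left (by linarith)]
    linarith
  have := T.edist_le_edist hf (T.toGlued x.1 a) (T.toGlued x'.1 b)
  rwa [toGlued, toGlued, e1, e2, edist_comm, edist_dist, Real.dist_eq, sub_zero,
    abs_of_nonneg dist_nonneg] at this

/-- A chart identifies a ball of the model space with a ball of the glued space. -/
theorem exists_isometry : ∃ ψ : M → T.Glued, ψ o = T.toGlued x₀.1 x₀.2 ∧
    (∀ p q, dist o p < ρ / 3 → dist o q < ρ / 3 →
      edist (ψ p) (ψ q) = ENNReal.ofReal (dist p q)) ∧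
    ψ '' {p | dist o p < ρ / 3} = Metric.eball (T.toGlued x₀.1 x₀.2) (ENNReal.ofReal (ρ / 3)) := by
  have hρ := C.small.pos
  have : Nonempty (Fin T.numTet × IdealSimplex) := ⟨x₀⟩
  have : Nonempty IdealSimplex := ⟨x₀.2⟩
  -- The inverse chart: any representative may be chosen, because all points with the same position
  -- have glued distance zero.
  choose! X A hX hA using C.surj
  have ho : dist o o < ρ / 3 := by rw [dist_self]; positivity
  have hψo : T.toGlued (X o).1 (A o) = T.toGlued x₀.1 x₀.2 := by
    have h := C.dist_origin (hX o ho) (hA o ho)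
    rw [dist_self, eq_comm, dist_eq_zero] at h
    rw [straight_injective h]
    exact hX o ho
  have hiso : ∀ p q, dist o p < ρ / 3 → dist o q < ρ / 3 →
      edist (T.toGlued (X p).1 (A p)) (T.toGlued (X q).1 (A q)) = ENNReal.ofReal (dist p q) :=
    fun p q hp hq => C.edist_eq (hX p hp) (hX q hq) (hA p hp) (hA q hq) hp hq
  refine ⟨fun p => T.toGlued (X p).1 (A p), hψo, hiso, Set.Subset.antisymm ?_ ?_⟩
  · rintro _ ⟨p, hp, rfl⟩
    have h := hiso p o hp ho
    rw [hψo] at h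
    rw [Metric.mem_eball, h, dist_comm]
    exact (ENNReal.ofReal_lt_ofReal_iff_of_nonneg dist_nonneg).2 hp
  · intro z hz
    obtain ⟨x, hx, a, rfl, ha, ha'⟩ := T.exists_of_edist_lt C.small (y := z)
      (lt_of_lt_of_le hz (ENNReal.ofReal_le_ofReal (by linarith)))
    obtain ⟨p, hp⟩ := C.total x hx a ha
    have hop : dist o p < ρ / 3 := by
      rw [C.dist_origin hx hp]
      have := ha'.trans_lt hz
      rwa [edist_dist, ENNReal.ofReal_lt_ofReal_iff_of_nonneg dist_nonneg] at this
    refine ⟨p, hop, ?_⟩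
    have h := C.edist_eq (hX p hop) hx (hA p hop) hp hop hop
    rw [dist_self, ENNReal.ofReal_zero, edist_eq_zero] at h
    exact h

end Chart

end IdealTriangulation

/-! ## Reflections in the faces -/

namespace HypSpace

/-- Reflection in the `i`-th face, in homogeneous coordinates. -/
def reflect (i : Fin 4) (u : Fin 4 → ℝ) (j : Fin 4) : ℝ := if j = i then -u i else u j + u i

lemma reflect_smul (i : Fin 4) (c : ℝ) (u : Fin 4 → ℝ) : reflect i (c • u) = c • reflect i u := by
  ext j
  simp only [reflect, Pi.smul_apply, smul_eq_mul]
  split_ifs <;> ring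

lemma reflect_reflect (i : Fin 4) (u : Fin 4 → ℝ) : reflect i (reflect i u) = u := by
  ext j
  simp only [reflect]
  split_ifs with h
  · rw [h]; simp
  · simp

lemma sum_reflect (i : Fin 4) (u : Fin 4 → ℝ) : ∑ j, reflect i u j = (∑ j, u j) + u i := by
  simp only [reflect, Fin.sum_univ_four]
  fin_cases i <;> simp <;> ring

lemma form_reflect (i : Fin 4) (u w : Fin 4 → ℝ) : form (reflect i u) (reflect i w) = form u w := by
  simp only [form, sum_reflect]
  simp only [reflect, Fin.sum_univ_four]
  fin_cases i <;> simp <;> ring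

/-- The reflection preserves the form, and it changes the coordinate sum from `1` to `1 + bary p i`.
This is positive because `⟪p, v i⟫ > -1` gives `bary p i > -1/2`. -/
lemma timelike_reflect (i : Fin 4) (p : HypSpace) : Timelike (reflect i (bary p)) := by
  refine ⟨?_, ?_⟩
  · rw [sum_reflect, sum_bary, bary]
    have h1 := neg_le_of_abs_le (abs_real_inner_le_norm p.pt (idealVertex i))
    have h2 : ‖idealVertex i‖ = 1 := by
      have := inner_idealVertex i i
      rw [real_inner_self_eq_norm_sq, if_pos rfl] at this
      nlinarith [norm_nonneg (idealVertex i)]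
    rw [h2, mul_one] at h1
    have := p.norm_lt
    linarith
  · rw [form_reflect]
    exact (timelike_bary p).2

/-- Reflection in the plane that contains the `i`-th face. -/
def mirror (i : Fin 4) (p : HypSpace) : HypSpace := ofCoord (reflect i (bary p))

lemma dist_mirror (i : Fin 4) (p q : HypSpace) : dist (mirror i p) (mirror i q) = dist p q := by
  rw [mirror, mirror, dist_ofCoord (timelike_reflect i p) (timelike_reflect i q), dist_def,
    coshDist_eq_bary]
  simp only [form_reflect]

lemma mirror_mirror (i : Fin 4) (p : HypSpace) : mirror i (mirror i p) = p := by
  rw [mirror, mirror, bary_ofCoord_eq (timelike_reflect i p), reflect_smul, reflect_reflect,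
    ofCoord_smul (timelike_bary p) (inv_pos.2 (timelike_reflect i p).1), ofCoord_bary]

lemma mirror_eq_self {i : Fin 4} {p : HypSpace} (h : bary p i = 0) : mirror i p = p := by
  have : reflect i (bary p) = bary p := by
    ext j
    simp only [reflect, h]
    split_ifs with hj
    · rw [hj, h]; simp
    · simp
  rw [mirror, this, ofCoord_bary]

lemma bary_mirror (i : Fin 4) (p : HypSpace) :
    bary (mirror i p) i = -bary p i / (1 + bary p i) := by
  rw [mirror, bary_ofCoord (timelike_reflect i p), sum_reflect, sum_bary]
  simp [reflect]

lemma one_add_bary_pos (p : HypSpace) (i : Fin 4) : 0 < 1 + bary p i := by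
  have := (timelike_reflect i p).1
  rwa [sum_reflect, sum_bary] at this

/-- A segment that joins the two sides of a face meets its plane. -/
lemma exists_between_bary_eq_zero {i : Fin 4} {p q : HypSpace} (hp : 0 ≤ bary p i)
    (hq : bary q i ≤ 0) : ∃ c, bary c i = 0 ∧ dist p c + dist c q = dist p q := by
  rcases eq_or_lt_of_le hq with h0 | h0
  · exact ⟨q, h0, by rw [dist_self, add_zero]⟩
  -- The weights `-bary q i` and `bary p i` are chosen so that the `i`-th coordinate of the
  -- combination cancels.
  have hpos : 0 < -bary q i + bary p i := by linarith
  have hc := (timelike_bary p).combination (timelike_bary q) (neg_nonneg.2 hq) hp hpos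
  refine ⟨ofCoord (-bary q i • bary p + bary p i • bary q), ?_, ?_⟩
  · rw [bary_ofCoord hc]
    simp [mul_comm]
  · have := dist_add_dist_combination (timelike_bary p) (timelike_bary q) (neg_nonneg.2 hq) hp hpos
    rwa [ofCoord_bary, ofCoord_bary] at this

end HypSpace

/-! ## Points away from the edges -/

namespace IdealTriangulation

variable {N : Type*} [TopologicalSpace N] {T : IdealTriangulation N}

section NonEdge

variable {x₀ : Fin T.numTet × IdealSimplex} {i : Fin 4}

/-- Only face `i` can contain the point, so the only possible moves are crossing it and crossing
back. -/
lemma fiber_of_ne_zero (hi : ∀ j, j ≠ i → x₀.2.1 j ≠ 0) {x : Fin T.numTet × IdealSimplex}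
    (hx : T.proj x = T.proj x₀) :
    x = x₀ ∨ (x₀.2.1 i = 0 ∧ x = T.pairing.cross x₀ i) := by
  refine T.fiber_induction (P := fun x => x = x₀ ∨ (x₀.2.1 i = 0 ∧ x = T.pairing.cross x₀ i))
    (Or.inl rfl) ?_ hx
  rintro x j (rfl | ⟨h0, rfl⟩) hj
  · have : j = i := by_contra fun h => hi j h hj
    subst this
    exact Or.inr ⟨hj, rfl⟩
  · have : j = T.pairing.perm x₀.1 i i := by
      by_contra h
      refine hi ((T.pairing.perm x₀.1 i).symm j) (fun h' => h ?_) hj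
      exact (Equiv.symm_apply_eq _).1 h'
    subst this
    exact Or.inl (T.pairing.cross_cross x₀ i)

/-- If the point were its own neighbour, its only vanishing coordinate would be preserved, and face
`i` would be glued to itself. Thus the two sheets of the planar chart are never confused. -/
lemma cross_ne_self (hi : ∀ j, j ≠ i → x₀.2.1 j ≠ 0) (h0 : x₀.2.1 i = 0) :
    T.pairing.cross x₀ i ≠ x₀ := by
  intro h
  have h1 := T.pairing.cross_apply x₀ i
  rw [h, h0] at h1
  have h2 : T.pairing.perm x₀.1 i i = i := by_contra fun h' => hi _ h' h1
  exact T.pairing.no_self x₀.1 i (Prod.ext (congrArg (fun x => x.1) h) h2)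

/-- The position in hyperbolic space of points of the simplices at a point away from the edges. -/
def PlanarRel (x₀ : Fin T.numTet × IdealSimplex) (i : Fin 4) (x : Fin T.numTet × IdealSimplex)
    (a : IdealSimplex) (p : HypSpace) : Prop :=
  (x = x₀ ∧ p = straight a) ∨ (x₀.2.1 i = 0 ∧ x = T.pairing.cross x₀ i ∧
    ∃ b : IdealSimplex, a = b.permute (T.pairing.perm x₀.1 i) ∧ p = mirror i (straight b))

/-- The unfolded segment meets the plane of the face in a point `c`. Being in the small ball, `c`
lies in the face itself, so the route through `c` exists in the glued space and is as short as the
segment. -/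
lemma edist_le_of_planarRel {ρ : ℝ} (hρ : x₀.2.IsSmallRadius ρ) (hi : ∀ j, j ≠ i → x₀.2.1 j ≠ 0)
    {a b : IdealSimplex} (ha : dist (straight x₀.2) (straight a) < ρ / 3)
    (hb : dist (straight x₀.2) (mirror i (straight b)) < ρ / 3) :
    edist (T.toGlued x₀.1 a) (T.toGlued (T.pairing.cross x₀ i).1
      (b.permute (T.pairing.perm x₀.1 i))) ≤
        ENNReal.ofReal (dist (straight a) (mirror i (straight b))) := by
  have hρ0 := hρ.pos
  obtain ⟨c, hc, hd⟩ := exists_between_bary_eq_zero (i := i) (p := straight a)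
    (q := mirror i (straight b)) (by rw [bary_straight]; exact a.nonneg i) (by
      rw [bary_mirror]
      refine div_nonpos_of_nonpos_of_nonneg ?_ (one_add_bary_pos _ _).le
      rw [bary_straight]
      exact neg_nonpos.2 (b.nonneg i))
  have hcx : dist c (straight x₀.2) < ρ := by
    have h1 := dist_triangle_right c (straight x₀.2) (straight a)
    have h2 := dist_triangle_right c (straight x₀.2) (mirror i (straight b))
    have h3 := dist_triangle_left (straight a) (mirror i (straight b)) (straight x₀.2)
    rw [dist_comm c (straight a)] at h1
    linarith
  have hc0 : ∀ j, 0 ≤ bary c j := by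
    intro j
    by_cases hj : j = i
    · rw [hj, hc]
    · exact (bary_pos_of_ball (x₀ := x₀) hρ rfl (hi j hj) hcx).le
  have e1 : T.toGlued x₀.1 (toSimplex c) = T.toGlued (T.pairing.cross x₀ i).1
      ((toSimplex c).permute (T.pairing.perm x₀.1 i)) :=
    (T.proj_cross (x := (x₀.1, toSimplex c)) (i := i) (by rw [toSimplex_apply hc0, hc])).symm
  refine (edist_triangle _ (T.toGlued x₀.1 (toSimplex c)) _).trans ?_
  rw [← hd, ENNReal.ofReal_add dist_nonneg dist_nonneg]
  refine add_le_add ?_ ?_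
  · refine (T.edist_toGlued_le _ _ _).trans ?_
    rw [straight_toSimplex hc0, edist_dist]
  · rw [e1]
    refine (T.edist_toGlued_le _ _ _).trans ?_
    rw [edist_dist, IdealSimplex.dist_straight_permute, straight_toSimplex hc0, ← dist_mirror i c,
      mirror_eq_self hc]

/-- The chart at a point away from the edges. -/
def planarChart {ρ : ℝ} (hρ : x₀.2.IsSmallRadius ρ) (hi : ∀ j, j ≠ i → x₀.2.1 j ≠ 0) :
    T.Chart x₀ ρ (straight x₀.2) where
  small := hρ
  rel := PlanarRel x₀ i
  total := by
    intro x hx a _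
    rcases fiber_of_ne_zero hi hx with h | ⟨h0, h⟩
    · exact ⟨_, Or.inl ⟨h, rfl⟩⟩
    · exact ⟨_, Or.inr ⟨h0, h, a.permute (T.pairing.perm x₀.1 i)⁻¹, by simp, rfl⟩⟩
  dist_le := by
    rintro x a b p q hx (⟨rfl, rfl⟩ | ⟨h0, rfl, a, rfl, rfl⟩) (⟨h', rfl⟩ | ⟨h0', h', b, rfl, rfl⟩)
    · exact le_rfl
    · exact absurd h'.symm (cross_ne_self hi h0')
    · exact absurd h' (cross_ne_self hi h0)
    · rw [dist_mirror, IdealSimplex.dist_straight_permute]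
  glue := by
    rintro x j a p q hx hxj haj (⟨rfl, rfl⟩ | ⟨h0, rfl, a, rfl, rfl⟩) hq
    · have : j = i := by_contra fun h => hi j h hxj
      subst this
      rcases hq with ⟨h', -⟩ | ⟨-, -, b, hb, rfl⟩
      · exact absurd h' (cross_ne_self hi hxj)
      · have : a = b := by
          rw [← IdealSimplex.permute_inv_permute (T.pairing.perm x.1 j) a, hb,
            IdealSimplex.permute_inv_permute]
        rw [← this, mirror_eq_self (by rw [bary_straight, haj]), dist_self]
    -- On the second sheet the only face through the centre is the partner of face `i`, so this
    -- crossing leads back to the first sheet.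
    · have : j = T.pairing.perm x₀.1 i i := by
        by_contra h
        refine hi ((T.pairing.perm x₀.1 i).symm j) (fun h' => h ?_) hxj
        exact (Equiv.symm_apply_eq _).1 h'
      subst this
      rw [T.pairing.cross_cross] at hq
      rcases hq with ⟨-, rfl⟩ | ⟨-, h', -⟩
      · rw [IdealSimplex.permute_apply, Equiv.symm_apply_apply] at haj
        simp only [FacePairing.cross, FacePairing.perm_perm, IdealSimplex.permute_inv_permute]
        rw [mirror_eq_self (by rw [bary_straight, haj]), dist_self]
      · exact absurd h'.symm (cross_ne_self hi h0)
  dist_origin := by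
    rintro x a p hx (⟨rfl, rfl⟩ | ⟨h0, rfl, a, rfl, rfl⟩)
    · exact dist_comm _ _
    · rw [FacePairing.cross, IdealSimplex.dist_straight_permute, dist_comm,
        ← dist_mirror i (straight a), mirror_eq_self (p := straight x₀.2) (by rw [bary_straight, h0])]
  surj := by
    intro p hp
    have hρ0 := hρ.pos
    have hp' : dist p (straight x₀.2) < ρ := by rw [dist_comm]; linarith
    -- The side of the plane decides the sheet. The negative side can occur only if the centre lies
    -- on face `i`, and there the mirror image lies in the simplex.
    rcases le_or_gt 0 (bary p i) with h | h
    · refine ⟨x₀, toSimplex p, rfl, Or.inl ⟨rfl, (straight_toSimplex fun j => ?_).symm⟩⟩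
      by_cases hj : j = i
      · rw [hj]; exact h
      · exact (bary_pos_of_ball (x₀ := x₀) hρ rfl (hi j hj) hp').le
    · have h0 : x₀.2.1 i = 0 := by
        by_contra h0
        exact absurd (bary_pos_of_ball (x₀ := x₀) hρ rfl h0 hp') (not_lt.2 h.le)
      refine ⟨T.pairing.cross x₀ i, (toSimplex (mirror i p)).permute (T.pairing.perm x₀.1 i),
        T.proj_cross h0, Or.inr ⟨h0, rfl, _, rfl, ?_⟩⟩
      rw [straight_toSimplex, mirror_mirror]
      intro j
      by_cases hj : j = i
      · rw [hj, bary_mirror]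
        exact div_nonneg (neg_nonneg.2 h.le) (one_add_bary_pos _ _).le
      · refine (bary_pos_of_ball (x₀ := x₀) hρ rfl (hi j hj) ?_).le
        rwa [← mirror_eq_self (p := straight x₀.2) (i := i) (by rw [bary_straight, h0]), dist_mirror]
  le := by
    rintro x x' a b p q - - (⟨rfl, rfl⟩ | ⟨h0, rfl, a, rfl, rfl⟩) (⟨rfl, rfl⟩ | ⟨h0', rfl, b, rfl, rfl⟩)
      hp hq
    · rw [← edist_dist]
      exact T.edist_toGlued_le _ _ _
    · exact edist_le_of_planarRel hρ hi hp hq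
    · rw [edist_comm, dist_comm]
      exact edist_le_of_planarRel hρ hi hq hp
    · rw [dist_mirror, ← IdealSimplex.dist_straight_permute, ← edist_dist]
      exact T.edist_toGlued_le _ _ _

end NonEdge

lemma exists_forall_ne_zero {t : IdealSimplex} (ht : ∀ i j, i ≠ j → t.1 i = 0 → t.1 j ≠ 0) :
    ∃ i, ∀ j, j ≠ i → t.1 j ≠ 0 := by
  by_cases h : ∃ i, t.1 i = 0
  · obtain ⟨i, hi⟩ := h
    exact ⟨i, fun j hj => ht i j hj.symm hi⟩
  · push Not at h
    -- For an interior point any index serves.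
    exact ⟨0, fun j _ => h j⟩

theorem isHyperbolicPoint_of_nonEdge (k : Fin T.numTet) {t : IdealSimplex}
    (ht : ∀ i j, i ≠ j → t.1 i = 0 → t.1 j ≠ 0) : IsHyperbolicPoint (T.toGlued k t) := by
  obtain ⟨i, hi⟩ := exists_forall_ne_zero ht
  obtain ⟨ρ, hρ⟩ := t.exists_isSmallRadius
  obtain ⟨ψ, h1, h2, h3⟩ := (planarChart (x₀ := (k, t)) hρ hi).exists_isometry
  have hb : Metric.ball (straight t) (ρ / 3) = {p | dist (straight t) p < ρ / 3} := by
    ext p; rw [Metric.mem_ball, dist_comm]; rfl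
  refine ⟨ρ / 3, div_pos hρ.pos (by norm_num), straight t, ψ, h1, fun p hp q hq => ?_, by rw [hb, h3]⟩
  rw [hb] at hp hq
  rw [h2 p q hp hq, edist_dist]

theorem exists_nhds_edist_eq (k : Fin T.numTet) {t : IdealSimplex}
    (ht : ∀ i j, i ≠ j → t.1 i = 0 → t.1 j ≠ 0) : ∃ U ∈ nhds t, ∀ a ∈ U, ∀ b ∈ U,
      edist (T.toGlued k a) (T.toGlued k b) = edist (straight a) (straight b) := by
  obtain ⟨i, hi⟩ := exists_forall_ne_zero ht
  obtain ⟨ρ, hρ⟩ := t.exists_isSmallRadius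
  refine ⟨straight ⁻¹' Metric.ball (straight t) (ρ / 3),
    continuous_straight.continuousAt (Metric.ball_mem_nhds _ (div_pos hρ.pos (by norm_num))), ?_⟩
  intro a ha b hb
  rw [Set.mem_preimage, Metric.mem_ball, dist_comm] at ha hb
  rw [edist_dist (straight a)]
  exact (planarChart (x₀ := (k, t)) hρ hi).edist_eq (x := (k, t)) (x' := (k, t)) rfl rfl
    (Or.inl ⟨rfl, rfl⟩) (Or.inl ⟨rfl, rfl⟩) ha hb

end IdealTriangulation

/-! ## Cylindrical coordinates about an edge -/

namespace HypSpace

/-- Linear coordinates adapted to the edge that joins the vertices `0` and `1`. -/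
def lightVec (A B x y : ℝ) : Fin 4 → ℝ :=
  ![A - (√3 / 2 * x + y / 2), B - (√3 / 2 * x + y / 2), √3 / 2 * x - y / 2, y]

lemma sq_sqrt_three : (√3 : ℝ) ^ 2 = 3 := Real.sq_sqrt (by norm_num)

/-- The vertices `0` and `1` span a hyperbolic plane with null coordinates `A`, `B`; its orthogonal
complement has Cartesian coordinates `x`, `y`. The rotation about the edge acts on the latter. -/
lemma form_lightVec (A B x y A' B' x' y' : ℝ) : form (lightVec A B x y) (lightVec A' B' x' y') =
    A * B' + A' * B - 3 / 2 * (x * x' + y * y') := by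
  simp only [form, lightVec, Fin.sum_univ_four]
  simp
  linear_combination (-(x * x') / 2) * sq_sqrt_three

lemma timelike_lightVec {A B x y : ℝ} (hA : 0 < A) (hB : 0 < B)
    (h : 3 / 2 * (x * x + y * y) < 2 * (A * B)) : Timelike (lightVec A B x y) := by
  refine ⟨?_, by rw [form_lightVec]; linarith⟩
  have e : ∑ i, lightVec A B x y i = A + B - (√3 / 2 * x + y / 2) := by
    simp only [lightVec, Fin.sum_univ_four]
    simp
    ring
  rw [e]
  -- The left side is the square of the component in a unit direction. With `A * B` bounded by the
  -- square of the mean of `A` and `B`, it is smaller than `(A + B) ^ 2`.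
  have h1 : (√3 / 2 * x + y / 2) ^ 2 ≤ x * x + y * y := by
    have : (√3 / 2 * x + y / 2) ^ 2 + (x / 2 - √3 / 2 * y) ^ 2 = x * x + y * y := by
      linear_combination (x ^ 2 / 4 + y ^ 2 / 4) * sq_sqrt_three
    nlinarith [sq_nonneg (x / 2 - √3 / 2 * y)]
  have h2 : (√3 / 2 * x + y / 2) ^ 2 < (A + B) ^ 2 := by nlinarith [sq_nonneg (A - B), mul_pos hA hB]
  have := abs_lt_of_sq_lt_sq h2 (by positivity)
  linarith [(abs_lt.1 this).2]

/-- Cylindrical coordinates about the edge that joins the vertices `0` and `1`. The simplex is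
the part `0 ≤ θ ≤ π / 3` near this edge. -/
def cylVec (r θ h : ℝ) : Fin 4 → ℝ :=
  lightVec (√3 / 2 * Real.cosh r * Real.exp h) (√3 / 2 * Real.cosh r * Real.exp (-h))
    (Real.sinh r * Real.cos θ) (Real.sinh r * Real.sin θ)

/-- The hyperbolic cosine of the distance of two points in cylindrical coordinates with difference
`δ` of the angles. -/
def cylCosh (r h r' h' δ : ℝ) : ℝ :=
  Real.cosh r * Real.cosh r' * Real.cosh (h - h') - Real.sinh r * Real.sinh r' * Real.cos δ

/-- With the factor `√3 / 2` all these vectors have form `3 / 2`, so `cylCosh` is the hyperbolic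
cosine of the distance. It is the expression that defines the distance of the cone model, which
links the two. -/
lemma form_cylVec (r θ h r' θ' h' : ℝ) :
    form (cylVec r θ h) (cylVec r' θ' h') = 3 / 2 * cylCosh r h r' h' (θ - θ') := by
  rw [cylVec, cylVec, form_lightVec, cylCosh, Real.cosh_eq (h - h'), Real.cos_sub, neg_sub,
    Real.exp_sub, Real.exp_sub, Real.exp_neg, Real.exp_neg]
  linear_combination (Real.cosh r * Real.cosh r' * (Real.exp h / Real.exp h' +
    Real.exp h' / Real.exp h) / 4) * sq_sqrt_three

lemma cylCosh_self (r h : ℝ) : cylCosh r h r h 0 = 1 := by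
  rw [cylCosh, sub_self, Real.cosh_zero, Real.cos_zero]
  linear_combination Real.cosh_sq r

lemma timelike_cylVec (r θ h : ℝ) : Timelike (cylVec r θ h) := by
  have h3 : (0 : ℝ) < √3 := Real.sqrt_pos.2 (by norm_num)
  have hc := Real.cosh_pos r
  have h1 := form_cylVec r θ h r θ h
  rw [sub_self, cylCosh_self, cylVec, form_lightVec] at h1
  exact timelike_lightVec (by positivity) (by positivity) (by linarith)

/-- The point with given cylindrical coordinates. -/
def cylPt (r θ h : ℝ) : HypSpace := ofCoord (cylVec r θ h)

/-- The distance of two points in cylindrical coordinates with difference `δ` of the angles. -/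
def cylDist (r h r' h' δ : ℝ) : ℝ := Real.arcosh (cylCosh r h r' h' δ)

lemma dist_cylPt (r θ h r' θ' h' : ℝ) :
    dist (cylPt r θ h) (cylPt r' θ' h') = cylDist r h r' h' (θ - θ') := by
  have e : √(3 / 2 * 1 : ℝ) * √(3 / 2 * 1) = 3 / 2 := by
    rw [Real.mul_self_sqrt (by norm_num)]; norm_num
  rw [cylPt, cylPt, dist_ofCoord (timelike_cylVec _ _ _) (timelike_cylVec _ _ _), cylDist]
  simp only [form_cylVec, sub_self, cylCosh_self]
  rw [e]
  congr 1
  field_simp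

lemma cylDist_neg (r h r' h' δ : ℝ) : cylDist r h r' h' (-δ) = cylDist r h r' h' δ := by
  rw [cylDist, cylDist, cylCosh, cylCosh, Real.cos_neg]

lemma cylDist_abs (r h r' h' δ : ℝ) : cylDist r h r' h' |δ| = cylDist r h r' h' δ := by
  rw [cylDist, cylDist, cylCosh, cylCosh, Real.cos_abs]

lemma cylDist_comm (r h r' h' δ : ℝ) : cylDist r h r' h' δ = cylDist r' h' r h δ := by
  rw [cylDist, cylDist, cylCosh, cylCosh, ← Real.cosh_neg (h - h'), neg_sub]
  ring_nf

lemma dist_cylPt_zero (r h r' h' δ : ℝ) :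
    dist (cylPt r 0 h) (cylPt r' δ h') = cylDist r h r' h' δ := by
  rw [dist_cylPt, zero_sub, cylDist_neg]

lemma one_le_cylCosh (r h r' h' δ : ℝ) : 1 ≤ cylCosh r h r' h' δ := by
  have h1 := (timelike_cylVec r 0 h)
  have h2 := (timelike_cylVec r' δ h')
  have := one_le_coshDist (cylPt r 0 h) (cylPt r' δ h')
  rw [cylPt, cylPt, coshDist_ofCoord h1 h2] at this
  simp only [form_cylVec, sub_self, cylCosh_self] at this
  rw [Real.mul_self_sqrt (by norm_num), mul_one, mul_div_cancel_left₀ _ (by norm_num), zero_sub] at this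
  rwa [cylCosh, ← Real.cos_neg]

lemma cylDist_mono {r h r' h' δ δ' : ℝ} (hr : 0 ≤ r) (hr' : 0 ≤ r') (h0 : 0 ≤ δ) (hδ : δ ≤ δ')
    (hπ : δ' ≤ Real.pi) : cylDist r h r' h' δ ≤ cylDist r h r' h' δ' := by
  refine (Real.arcosh_le_arcosh (zero_lt_one.trans_le (one_le_cylCosh _ _ _ _ _))
    (zero_lt_one.trans_le (one_le_cylCosh _ _ _ _ _))).2 ?_
  have h1 := Real.cos_le_cos_of_nonneg_of_le_pi h0 hπ hδ
  have h2 := mul_nonneg (Real.sinh_nonneg_iff.2 hr) (Real.sinh_nonneg_iff.2 hr')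
  have := mul_le_mul_of_nonneg_left h1 h2
  simp only [cylCosh]
  linarith

lemma cylDist_triangle (r h r' h' r'' h'' δ δ' : ℝ) :
    cylDist r h r'' h'' (δ + δ') ≤ cylDist r h r' h' δ + cylDist r' h' r'' h'' δ' := by
  have := dist_triangle (cylPt r 0 h) (cylPt r' δ h') (cylPt r'' (δ + δ') h'')
  rw [dist_cylPt_zero, dist_cylPt_zero, dist_cylPt] at this
  rwa [show δ - (δ + δ') = -δ' by ring, cylDist_neg] at this

lemma cylDist_nonneg (r h r' h' δ : ℝ) : 0 ≤ cylDist r h r' h' δ :=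
  Real.arcosh_nonneg (one_le_cylCosh _ _ _ _ _)

/-- Recovering cylindrical coordinates from linear ones. -/
lemma exists_cylVec_eq {A B s : ℝ} (hA : 0 < A) (hB : 0 < B) (hs : 0 ≤ s)
    (h : 3 / 2 * s ^ 2 < 2 * (A * B)) (θ : ℝ) : ∃ κ r h : ℝ, 0 < κ ∧ 0 ≤ r ∧ (s = 0 → r = 0) ∧
      lightVec A B (s * Real.cos θ) (s * Real.sin θ) = κ • cylVec r θ h := by
  have hpos : 0 < 4 / 3 * (A * B) - s ^ 2 := by linarith
  -- The form of the vector is `3/2 * κ ^ 2`, so `κ` is its scale. Then `sinh r = s / κ`, and the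
  -- height is half the logarithm of `A / B`.
  set κ := √(4 / 3 * (A * B) - s ^ 2) with hκdef
  have hκ : 0 < κ := Real.sqrt_pos.2 hpos
  have hκ2 : κ ^ 2 = 4 / 3 * (A * B) - s ^ 2 := Real.sq_sqrt hpos.le
  have h3 : (0 : ℝ) < √3 := Real.sqrt_pos.2 (by norm_num)
  set r := Real.arsinh (s / κ) with hr
  have hsinh : κ * Real.sinh r = s := by rw [hr, Real.sinh_arsinh]; field_simp
  have hcosh : (κ * Real.cosh r) ^ 2 = 4 / 3 * (A * B) := by
    rw [mul_pow, Real.cosh_sq, mul_add, ← mul_pow, hsinh, hκ2]; ring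
  set t := Real.log (A / B) / 2
  have hexp : Real.exp t ^ 2 = A / B := by
    rw [← Real.exp_nat_mul]
    rw [show ((2 : ℕ) : ℝ) * t = Real.log (A / B) by simp only [t]; push_cast; ring]
    exact Real.exp_log (div_pos hA hB)
  have hcpos := Real.cosh_pos r
  have e1 : κ * (√3 / 2 * Real.cosh r * Real.exp t) = A := by
    refine (sq_eq_sq₀ (by positivity) hA.le).1 ?_
    rw [show (κ * (√3 / 2 * Real.cosh r * Real.exp t)) ^ 2 =
      (√3 ^ 2 / 4) * (κ * Real.cosh r) ^ 2 * Real.exp t ^ 2 by ring, hcosh, hexp, sq_sqrt_three]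
    field_simp
  have e2 : κ * (√3 / 2 * Real.cosh r * Real.exp (-t)) = B := by
    refine (sq_eq_sq₀ (by positivity) hB.le).1 ?_
    rw [Real.exp_neg, show (κ * (√3 / 2 * Real.cosh r * (Real.exp t)⁻¹)) ^ 2 =
      (√3 ^ 2 / 4) * (κ * Real.cosh r) ^ 2 * (Real.exp t ^ 2)⁻¹ by ring, hcosh, hexp, sq_sqrt_three]
    field_simp
  refine ⟨κ, r, t, hκ, Real.arsinh_nonneg_iff.2 (by positivity), fun h0 => by simp [hr, h0], ?_⟩
  rw [← hsinh]
  conv_lhs => rw [← e1, ← e2]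
  ext i
  fin_cases i <;> simp [lightVec, cylVec] <;> ring

/-- The points of the simplex in cylindrical coordinates. -/
lemma exists_eq_cylPt {p : HypSpace} (hp : ∀ i, 0 ≤ bary p i) :
    ∃ r θ h : ℝ, 0 ≤ r ∧ 0 ≤ θ ∧ θ ≤ Real.pi / 3 ∧ p = cylPt r θ h := by
  have h3 : (0 : ℝ) < √3 := Real.sqrt_pos.2 (by norm_num)
  have hT := timelike_bary p
  set u := bary p
  have h2 := sq_sqrt_three
  set x := (u 2 + u 3 / 2) * 2 / √3 with hx
  have hx' : √3 / 2 * x = u 2 + u 3 / 2 := by rw [hx]; field_simp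
  set A := u 0 + (u 2 + u 3)
  set B := u 1 + (u 2 + u 3)
  have hu : u = lightVec A B x (u 3) := by
    ext i
    fin_cases i <;> simp [lightVec, hx', A, B] <;> ring
  have hform := hT.2
  rw [hu, form_lightVec] at hform
  have hA0 : 0 ≤ A := add_nonneg (hp 0) (add_nonneg (hp 2) (hp 3))
  have hB0 : 0 ≤ B := add_nonneg (hp 1) (add_nonneg (hp 2) (hp 3))
  have hAB : 0 < A * B := by nlinarith [mul_self_nonneg x, mul_self_nonneg (u 3)]
  have hA : 0 < A := lt_of_le_of_ne hA0 fun h => by rw [← h, zero_mul] at hAB; exact lt_irrefl _ hAB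
  have hB : 0 < B := lt_of_le_of_ne hB0 fun h => by rw [← h, mul_zero] at hAB; exact lt_irrefl _ hAB
  set z : ℂ := ⟨x, u 3⟩
  have hzx : ‖z‖ * Real.cos z.arg = x := Complex.norm_mul_cos_arg z
  have hzy : ‖z‖ * Real.sin z.arg = u 3 := Complex.norm_mul_sin_arg z
  have hz2 : ‖z‖ ^ 2 = x * x + u 3 * u 3 := by rw [Complex.sq_norm, Complex.normSq_mk]
  obtain ⟨κ, r, t, hκ, hr, -, he⟩ := exists_cylVec_eq hA hB (norm_nonneg z)
    (by rw [hz2]; linarith) z.arg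
  rw [hzx, hzy, ← hu] at he
  have harg0 : 0 ≤ z.arg := Complex.arg_nonneg_iff.2 (hp 3)
  refine ⟨r, z.arg, t, hr, harg0, ?_, ?_⟩
  -- An argument beyond `π / 3` would make `u 2 = -‖z‖ * sin (arg z - π / 3)` negative; the lower
  -- bound on the argument is `u 3 ≥ 0`.
  · by_contra hlt
    push Not at hlt
    have hne : z ≠ 0 := by
      intro h0
      rw [h0, Complex.arg_zero] at hlt
      linarith [Real.pi_pos]
    have hs : Real.sin (z.arg - Real.pi / 3) > 0 := by
      refine Real.sin_pos_of_pos_of_lt_pi (by linarith) ?_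
      linarith [Complex.arg_le_pi z, Real.pi_pos]
    have h4 : ‖z‖ * Real.sin (z.arg - Real.pi / 3) = -u 2 := by
      rw [Real.sin_sub, Real.cos_pi_div_three, Real.sin_pi_div_three]
      linear_combination (1 / 2) * hzy - (√3 / 2) * hzx - hx'
    have := mul_pos (norm_pos_iff.2 hne) hs
    have := hp 2
    simp only [u] at *
    linarith
  · rw [cylPt, ← ofCoord_smul (timelike_cylVec _ _ _) hκ, ← he, ofCoord_bary]

/-- A positive combination of two points in cylindrical coordinates, with angle `β`. -/
lemma exists_cyl_of_combination {r₁ h₁ r₂ h₂ δ β a b s : ℝ} (ha : 0 ≤ a) (hb : 0 ≤ b)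
    (hab : 0 < a + b) (hs : 0 ≤ s)
    (hx : a * Real.sinh r₁ + b * (Real.sinh r₂ * Real.cos δ) = s * Real.cos β)
    (hy : b * (Real.sinh r₂ * Real.sin δ) = s * Real.sin β) :
    ∃ r h : ℝ, 0 ≤ r ∧ (s = 0 → r = 0) ∧
      cylDist r₁ h₁ r h β + cylDist r h r₂ h₂ (δ - β) = cylDist r₁ h₁ r₂ h₂ δ := by
  have h3 : (0 : ℝ) < √3 := Real.sqrt_pos.2 (by norm_num)
  have t1 := timelike_cylVec r₁ 0 h₁
  have t2 := timelike_cylVec r₂ δ h₂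
  have t3 := t1.combination t2 ha hb hab
  have hd := dist_add_dist_combination t1 t2 ha hb hab
  set A := a * (√3 / 2 * Real.cosh r₁ * Real.exp h₁) + b * (√3 / 2 * Real.cosh r₂ * Real.exp h₂) with hA
  set B := a * (√3 / 2 * Real.cosh r₁ * Real.exp (-h₁)) +
    b * (√3 / 2 * Real.cosh r₂ * Real.exp (-h₂)) with hB
  have e : a • cylVec r₁ 0 h₁ + b • cylVec r₂ δ h₂ =
      lightVec A B (s * Real.cos β) (s * Real.sin β) := by
    rw [← hx, ← hy]
    ext i
    fin_cases i <;> simp [lightVec, cylVec, hA, hB] <;> ring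
  have pos : ∀ {x y : ℝ}, 0 < x → 0 < y → 0 < a * x + b * y := by
    intro x y hx hy
    rcases ha.lt_or_eq with h | h
    · have := mul_pos h hx
      positivity
    · have h' : 0 < b := by linarith
      have := mul_pos h' hy
      positivity
  have hc1 := Real.cosh_pos r₁
  have hc2 := Real.cosh_pos r₂
  have hform := t3.2
  rw [e, form_lightVec] at hform
  obtain ⟨κ, r, t, hκ, hr, hr0, he⟩ := exists_cylVec_eq (A := A) (B := B)
    (pos (by positivity) (by positivity)) (pos (by positivity) (by positivity)) hs
    (by nlinarith [Real.sin_sq_add_cos_sq β]) β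
  rw [e, he, ofCoord_smul (timelike_cylVec _ _ _) hκ] at hd
  change dist (cylPt r₁ 0 h₁) (cylPt r β t) + dist (cylPt r β t) (cylPt r₂ δ h₂) =
    dist (cylPt r₁ 0 h₁) (cylPt r₂ δ h₂) at hd
  rw [dist_cylPt_zero, dist_cylPt_zero, dist_cylPt, ← cylDist_neg r t, neg_sub] at hd
  exact ⟨r, t, hr, hr0, hd⟩

/-- A segment meets the half-plane at every intermediate angle. -/
lemma exists_cyl_between {r₁ r₂ δ β : ℝ} (h₁ h₂ : ℝ) (hr₁ : 0 ≤ r₁) (hr₂ : 0 ≤ r₂) (hβ : 0 ≤ β)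
    (hδ : β ≤ δ) (hπ : δ ≤ Real.pi) : ∃ r h : ℝ, 0 ≤ r ∧
      cylDist r₁ h₁ r h β + cylDist r h r₂ h₂ (δ - β) = cylDist r₁ h₁ r₂ h₂ δ := by
  have s1 := Real.sinh_nonneg_iff.2 hr₁
  have s2 := Real.sinh_nonneg_iff.2 hr₂
  have sβ := Real.sin_nonneg_of_nonneg_of_le_pi hβ (hδ.trans hπ)
  have sδβ := Real.sin_nonneg_of_nonneg_of_le_pi (sub_nonneg.2 hδ) (by linarith)
  have sδ := Real.sin_nonneg_of_nonneg_of_le_pi (hβ.trans hδ) hπ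
  -- By the sine rule in the transverse plane, weights proportional to `sinh r₂ * sin (δ - β)` and
  -- `sinh r₁ * sin β` give the combination the angle `β`.
  have ha : 0 ≤ Real.sinh r₂ * Real.sin (δ - β) := mul_nonneg s2 sδβ
  have hb : 0 ≤ Real.sinh r₁ * Real.sin β := mul_nonneg s1 sβ
  rcases (add_nonneg ha hb).lt_or_eq with hab | hab
  · obtain ⟨r, h, hr, -, he⟩ := exists_cyl_of_combination (r₁ := r₁) (r₂ := r₂) (h₁ := h₁) (h₂ := h₂)
      (β := β) (δ := δ) (s := Real.sinh r₁ * Real.sinh r₂ * Real.sin δ) ha hb hab (by positivity)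
      (by rw [Real.sin_sub]; ring) (by ring)
    exact ⟨r, h, hr, he⟩
  -- Both weights vanish. Then an endpoint of the segment serves: either `β` is an extreme angle, or
  -- the first point lies on the axis and may be given any angle.
  · have ha0 : Real.sinh r₂ * Real.sin (δ - β) = 0 := by linarith
    have hb0 : Real.sinh r₁ * Real.sin β = 0 := by linarith
    have zero : ∀ r h r' h' δ δ', r = 0 ∨ r' = 0 → cylDist r h r' h' δ = cylDist r h r' h' δ' := by
      rintro r h r' h' δ δ' (rfl | rfl) <;> simp [cylDist, cylCosh]
    have self : ∀ r h, cylDist r h r h 0 = 0 := by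
      intro r h; rw [cylDist, cylCosh_self, Real.arcosh_zero]
    by_cases h0 : β = 0
    · exact ⟨r₁, h₁, hr₁, by rw [h0, self, sub_zero, zero_add]⟩
    by_cases h1 : δ = β
    · exact ⟨r₂, h₂, hr₂, by rw [h1, sub_self, self, add_zero]⟩
    rcases mul_eq_zero.1 hb0 with hb0 | hb0
    · have hr0 : r₁ = 0 := Real.sinh_eq_zero.1 hb0
      refine ⟨r₁, h₁, hr₁, ?_⟩
      rw [zero _ _ _ _ β 0 (Or.inl hr0), self, zero_add, zero _ _ _ _ _ δ (Or.inl hr0)]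
    · have hlt : β < δ := lt_of_le_of_ne hδ (Ne.symm h1)
      have : 0 < Real.sin β := Real.sin_pos_of_pos_of_lt_pi (lt_of_le_of_ne hβ (Ne.symm h0))
        (by linarith)
      exact absurd hb0 this.ne'

/-- A shortest path through the axis. -/
lemma exists_cyl_axis {r₁ r₂ : ℝ} (h₁ h₂ : ℝ) (hr₁ : 0 ≤ r₁) (hr₂ : 0 ≤ r₂) (δ δ' : ℝ) :
    ∃ h : ℝ, cylDist r₁ h₁ 0 h δ + cylDist 0 h r₂ h₂ δ' = cylDist r₁ h₁ r₂ h₂ Real.pi := by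
  have s1 := Real.sinh_nonneg_iff.2 hr₁
  have s2 := Real.sinh_nonneg_iff.2 hr₂
  -- At angle `π` the transverse parts point in opposite directions, and the weights `sinh r₂`,
  -- `sinh r₁` cancel them. If both points are on the axis, equal weights do.
  have key : ∃ r h : ℝ, 0 ≤ r ∧ ((0 : ℝ) = 0 → r = 0) ∧
      cylDist r₁ h₁ r h 0 + cylDist r h r₂ h₂ (Real.pi - 0) = cylDist r₁ h₁ r₂ h₂ Real.pi := by
    rcases (add_nonneg s2 s1).lt_or_eq with hab | hab
    · exact exists_cyl_of_combination s2 s1 hab le_rfl (by rw [Real.cos_pi]; ring)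
        (by rw [Real.sin_pi]; ring)
    · exact exists_cyl_of_combination zero_le_one zero_le_one (by norm_num) le_rfl
        (by rw [show Real.sinh r₁ = 0 by linarith, show Real.sinh r₂ = 0 by linarith]; ring)
        (by rw [Real.sin_pi]; ring)
  obtain ⟨r, h, -, h0, he⟩ := key
  rw [h0 rfl] at he
  refine ⟨h, ?_⟩
  rw [← he]
  simp [cylDist, cylCosh]

end HypSpace

/-! ## The metric of the cone model -/

/-- It is only a pseudometric, because points of the axis carry a redundant angle. For the triangle
inequality, truncated angles with sum at most `π` are compared in hyperbolic space. If their sum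
exceeds `π`, the second one is lowered until the sum is `π`, which only shortens that side. -/
instance (α : ℝ) : PseudoMetricSpace (ConeModel α) where
  dist p q := ConeModel.dist p q
  dist_self p := by
    change cylDist _ _ _ _ (min ‖p.angle - p.angle‖ Real.pi) = 0
    rw [sub_self, norm_zero, min_eq_left Real.pi_pos.le, cylDist, cylCosh_self, Real.arcosh_zero]
  dist_comm p q := by
    change cylDist _ _ _ _ _ = cylDist _ _ _ _ _
    rw [cylDist_comm, norm_sub_rev]
  dist_triangle p c q := by
    change cylDist p.radius p.height q.radius q.height (min ‖p.angle - q.angle‖ Real.pi) ≤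
      cylDist p.radius p.height c.radius c.height (min ‖p.angle - c.angle‖ Real.pi) +
      cylDist c.radius c.height q.radius q.height (min ‖c.angle - q.angle‖ Real.pi)
    have hπ := Real.pi_pos.le
    have h0 := le_min (norm_nonneg (p.angle - q.angle)) hπ
    have h1 := le_min (norm_nonneg (p.angle - c.angle)) hπ
    have h2 := le_min (norm_nonneg (c.angle - q.angle)) hπ
    have h3 : min ‖p.angle - q.angle‖ Real.pi ≤
        min ‖p.angle - c.angle‖ Real.pi + min ‖c.angle - q.angle‖ Real.pi := by
      have := norm_sub_le_norm_sub_add_norm_sub p.angle c.angle q.angle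
      rcases le_total ‖p.angle - c.angle‖ Real.pi with h | h
      · rcases le_total ‖c.angle - q.angle‖ Real.pi with h' | h'
        · rw [min_eq_left h, min_eq_left h']
          exact (min_le_left _ _).trans this
        · rw [min_eq_right h']
          exact (min_le_right _ _).trans (by linarith)
      · rw [min_eq_right h]
        exact (min_le_right _ _).trans (by linarith)
    have h4 : min ‖p.angle - q.angle‖ Real.pi ≤ Real.pi := min_le_right _ _
    have h5 : min ‖p.angle - c.angle‖ Real.pi ≤ Real.pi := min_le_right _ _
    have h6 : min ‖c.angle - q.angle‖ Real.pi ≤ Real.pi := min_le_right _ _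
    generalize min ‖p.angle - q.angle‖ Real.pi = δ at *
    generalize min ‖p.angle - c.angle‖ Real.pi = δ₁ at *
    generalize min ‖c.angle - q.angle‖ Real.pi = δ₂ at *
    rcases le_total (δ₁ + δ₂) Real.pi with h | h
    · exact (cylDist_mono p.radius.2 q.radius.2 h0 h3 h).trans (cylDist_triangle _ _ _ _ _ _ _ _)
    · refine (cylDist_mono p.radius.2 q.radius.2 h0 h4 le_rfl).trans ?_
      have := cylDist_triangle p.radius p.height c.radius c.height q.radius q.height δ₁ (Real.pi - δ₁)
      rw [add_sub_cancel] at this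
      exact this.trans (add_le_add_right (cylDist_mono c.radius.2 q.radius.2 (by linarith)
        (by linarith) h6) _)

namespace ConeModel

lemma dist_eq {α : ℝ} (p q : ConeModel α) : Dist.dist p q =
    cylDist p.radius p.height q.radius q.height (min ‖p.angle - q.angle‖ Real.pi) := rfl

/-- The norm on the circle is the least absolute value of a lift, and `cylDist` is monotone in the
angle up to `π`. -/
lemma dist_le_cylDist {α : ℝ} {p q : ConeModel α} {δ : ℝ} (h : p.angle - q.angle = (δ : AddCircle α))
    (hδ : |δ| ≤ Real.pi) :
    Dist.dist p q ≤ cylDist p.radius p.height q.radius q.height δ := by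
  rw [dist_eq, ← cylDist_abs _ _ _ _ δ]
  refine cylDist_mono p.radius.2 q.radius.2 (le_min (norm_nonneg _) Real.pi_pos.le) ?_ hδ
  refine (min_le_left _ _).trans ?_
  rw [h]
  exact QuotientAddGroup.norm_mk_le_norm

lemma dist_origin {α : ℝ} (p : ConeModel α) (δ : ℝ) :
    Dist.dist (origin α) p = cylDist 0 0 p.radius p.height δ := by
  rw [dist_eq]
  simp [cylDist, cylCosh, origin]

/-- A shortest path either runs through the axis or turns by some lift of the angle difference
within `[-π, π]`. The integer `z` records how often the full cone angle is added. -/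
lemma exists_dist_eq {α : ℝ} {p q : ConeModel α} {δ : ℝ}
    (h : p.angle - q.angle = (δ : AddCircle α)) :
    Dist.dist p q = cylDist p.radius p.height q.radius q.height Real.pi ∨
      ∃ z : ℤ, |δ + z * α| ≤ Real.pi ∧
        Dist.dist p q = cylDist p.radius p.height q.radius q.height (δ + z * α) := by
  have hn : ‖p.angle - q.angle‖ = |δ + (-round (α⁻¹ * δ) : ℤ) * α| := by
    rw [h, AddCircle.norm_eq]; push_cast; ring_nf
  rcases le_total ‖p.angle - q.angle‖ Real.pi with h' | h'
  · refine Or.inr ⟨-round (α⁻¹ * δ), by rwa [← hn], ?_⟩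
    rw [dist_eq, min_eq_left h', hn, cylDist_abs]
  · exact Or.inl (by rw [dist_eq, min_eq_right h'])

end ConeModel

/-! ## Rotation about an edge -/

namespace FacePairing

variable {n : ℕ} (F : FacePairing n)

/-- Rotation about an edge. In a pair `(k, σ)` the edge joins the vertices `σ 0`, `σ 1` of the
simplex `k`, and the rotation leads from the face opposite to `σ 3` to the one opposite to `σ 2`, and
further into the next simplex. -/
def rotate (w : Fin n × Equiv.Perm (Fin 4)) : Fin n × Equiv.Perm (Fin 4) :=
  (F.nbr w.1 (w.2 2), F.perm w.1 (w.2 2) * w.2 * Equiv.swap 2 3)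

lemma rotate_snd_three (w : Fin n × Equiv.Perm (Fin 4)) :
    (F.rotate w).2 3 = F.perm w.1 (w.2 2) (w.2 2) := by
  simp [rotate]

/-- The reversal of the edge and of the rotation. -/
def reverse (w : Fin n × Equiv.Perm (Fin 4)) : Fin n × Equiv.Perm (Fin 4) :=
  (w.1, w.2 * (Equiv.swap 0 1 * Equiv.swap 2 3))

/-- After reversal the next face to cross is the one just crossed. So reversal conjugates the
rotation to its inverse, as in a dihedral group. -/
lemma rotate_reverse_rotate (w : Fin n × Equiv.Perm (Fin 4)) :
    F.rotate (reverse (F.rotate w)) = reverse w := by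
  obtain ⟨k, σ⟩ := w
  have e1 : (Equiv.swap 2 3 * (Equiv.swap 0 1 * Equiv.swap 2 3) : Equiv.Perm (Fin 4)) =
    Equiv.swap 0 1 := by decide
  have e2 : (Equiv.swap 0 1 : Equiv.Perm (Fin 4)) 2 = 2 := by decide
  simp only [rotate, reverse, mul_assoc, e1, Equiv.Perm.mul_apply, e2, nbr_nbr, perm_perm]
  rw [inv_mul_cancel_left]

lemma reverse_reverse (w : Fin n × Equiv.Perm (Fin 4)) : reverse (reverse w) = w := by
  obtain ⟨k, σ⟩ := w
  have e : (Equiv.swap 0 1 * Equiv.swap 2 3 * (Equiv.swap 0 1 * Equiv.swap 2 3) :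
    Equiv.Perm (Fin 4)) = 1 := by decide
  simp only [reverse, mul_assoc] at *
  rw [e, mul_one]

lemma rotate_injective : Function.Injective F.rotate := fun v w h => by
  have := congrArg (fun u => F.rotate (reverse u)) h
  simp only [rotate_reverse_rotate] at this
  rw [← reverse_reverse v, this, reverse_reverse]

lemma rotate_ne_reverse (w : Fin n × Equiv.Perm (Fin 4)) : F.rotate w ≠ reverse w := by
  obtain ⟨k, σ⟩ := w
  intro h
  have h1 := congrArg (fun x => x.1) h
  have h2 := congrArg (fun x => x.2 3) h
  have e : (Equiv.swap 0 1 * Equiv.swap 2 3 : Equiv.Perm (Fin 4)) 3 = 2 := by decide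
  simp only [rotate_snd_three, reverse, Equiv.Perm.mul_apply σ, e] at h2
  exact F.no_self k (σ 2) (Prod.ext h1 h2)

/-- By the dihedral relation, `l + 2` steps from `w` to its reversal contain `l` steps from `rotate
w` to its reversal. The descent ends with no step, which is impossible for a nontrivial permutation,
or with one step, which would be a self-glued face. Orientation cannot exclude this case, because
reversal is an even permutation. -/
lemma iterate_rotate_ne_reverse (l : ℕ) (w : Fin n × Equiv.Perm (Fin 4)) :
    F.rotate^[l] w ≠ reverse w := by
  induction l using Nat.twoStepInduction generalizing w with
  | zero =>
    intro h
    have h2 := congrArg (fun x => x.2) h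
    have e : (Equiv.swap 0 1 * Equiv.swap 2 3 : Equiv.Perm (Fin 4)) ≠ 1 := by decide
    exact e (mul_eq_left.1 h2.symm)
  | one => exact F.rotate_ne_reverse w
  | more l ih _ =>
    intro h
    refine ih (F.rotate w) (F.rotate_injective ?_)
    rw [F.rotate_reverse_rotate, ← h, ← Function.iterate_succ_apply' F.rotate]
    rfl

/-- Each face pairing contributes a sign, which the transposition of `2` and `3` in `rotate`
cancels. -/
lemma orientation_iterate {o : Fin n → ℤˣ}
    (ho : ∀ k i, o (F.nbr k i) * Equiv.Perm.sign (F.perm k i) = -o k) (l : ℕ)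
    (w : Fin n × Equiv.Perm (Fin 4)) :
    o (F.rotate^[l] w).1 * Equiv.Perm.sign (F.rotate^[l] w).2 = o w.1 * Equiv.Perm.sign w.2 := by
  induction l with
  | zero => rfl
  | succ l ih =>
    rw [Function.iterate_succ_apply', ← ih]
    generalize F.rotate^[l] w = v
    have := ho v.1 (v.2 2)
    simp only [rotate, Equiv.Perm.sign_mul, ← mul_assoc]
    rw [this, Equiv.Perm.sign_swap (by decide)]
    simp

/-- In the orientable case the rotation meets every simplex at most once with a given edge. -/
lemma iterate_rotate_eq_self (hF : F.Orientable) {l : ℕ} {w : Fin n × Equiv.Perm (Fin 4)}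
    {π : Equiv.Perm (Fin 4)} (h : F.rotate^[l] w = (w.1, w.2 * π))
    (h2 : π 2 = 2 ∨ π 2 = 3) (h3 : π 3 = 2 ∨ π 3 = 3) : π = 1 := by
  obtain ⟨o, ho⟩ := hF
  have h4 := F.orientation_iterate ho l w
  rw [h, Equiv.Perm.sign_mul, ← mul_assoc, mul_eq_left] at h4
  -- Of the four permutations that preserve the edge, orientation leaves only the identity and the
  -- reversal.
  have key : ∀ π : Equiv.Perm (Fin 4), (π 2 = 2 ∨ π 2 = 3) → (π 3 = 2 ∨ π 3 = 3) →
      Equiv.Perm.sign π = 1 → π = 1 ∨ π = Equiv.swap 0 1 * Equiv.swap 2 3 := by decide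
  rcases key π h2 h3 h4 with h5 | h5
  · exact h5
  · rw [h5] at h
    exact absurd h (F.iterate_rotate_ne_reverse l w)

lemma minimalPeriod_rotate_pos (w : Fin n × Equiv.Perm (Fin 4)) :
    0 < Function.minimalPeriod F.rotate w :=
  Function.minimalPeriod_pos_of_mem_periodicPts (F.rotate_injective.mem_periodicPts w)

end FacePairing

/-! ### The wedge between the two faces at an edge -/

namespace HypSpace

lemma cylPt_zero (θ θ' h : ℝ) : cylPt 0 θ h = cylPt 0 θ' h := by
  simp [cylPt, cylVec]

lemma cylVec_two (r θ h : ℝ) : cylVec r θ h 2 = Real.sinh r * Real.sin (Real.pi / 3 - θ) := by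
  simp only [cylVec, lightVec, Real.sin_sub, Real.sin_pi_div_three, Real.cos_pi_div_three]
  simp
  ring

lemma cylVec_three (r θ h : ℝ) : cylVec r θ h 3 = Real.sinh r * Real.sin θ := by
  simp [cylVec, lightVec]

lemma bary_cylPt (r θ h : ℝ) (i : Fin 4) :
    bary (cylPt r θ h) i = cylVec r θ h i / ∑ j, cylVec r θ h j := bary_ofCoord (timelike_cylVec _ _ _) i

lemma bary_cylPt_two_nonneg {r θ : ℝ} (h : ℝ) (hr : 0 ≤ r) (h0 : 0 ≤ θ) (h1 : θ ≤ Real.pi / 3) :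
    0 ≤ bary (cylPt r θ h) 2 := by
  rw [bary_cylPt, cylVec_two]
  refine div_nonneg (mul_nonneg (Real.sinh_nonneg_iff.2 hr) ?_) (timelike_cylVec _ _ _).1.le
  exact Real.sin_nonneg_of_nonneg_of_le_pi (by linarith) (by linarith [Real.pi_pos])

lemma bary_cylPt_three_nonneg {r θ : ℝ} (h : ℝ) (hr : 0 ≤ r) (h0 : 0 ≤ θ) (h1 : θ ≤ Real.pi / 3) :
    0 ≤ bary (cylPt r θ h) 3 := by
  rw [bary_cylPt, cylVec_three]
  refine div_nonneg (mul_nonneg (Real.sinh_nonneg_iff.2 hr) ?_) (timelike_cylVec _ _ _).1.le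
  exact Real.sin_nonneg_of_nonneg_of_le_pi h0 (by linarith [Real.pi_pos])

lemma eq_of_bary_cylPt_two_eq_zero {r θ h : ℝ} (h0 : 0 ≤ θ) (h1 : θ ≤ Real.pi / 3)
    (h2 : bary (cylPt r θ h) 2 = 0) : r = 0 ∨ θ = Real.pi / 3 := by
  rw [bary_cylPt, cylVec_two, div_eq_zero_iff, or_iff_left (timelike_cylVec _ _ _).1.ne',
    mul_eq_zero, Real.sinh_eq_zero] at h2
  refine h2.imp_right fun h3 => le_antisymm h1 (not_lt.1 fun h4 => ?_)
  exact absurd h3 (Real.sin_pos_of_pos_of_lt_pi (by linarith) (by linarith [Real.pi_pos])).ne'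

/-- Exchanging the vertices `2` and `3` interchanges the two bounding half-planes of the wedge and
preserves radius and height. This is how the last face of one wedge becomes the first face of the
next. -/
lemma cylVec_swap (r h : ℝ) (i : Fin 4) :
    cylVec r 0 h (Equiv.swap 2 3 i) = cylVec r (Real.pi / 3) h i := by
  have e0 : Equiv.swap (2 : Fin 4) 3 0 = 0 := by decide
  have e1 : Equiv.swap (2 : Fin 4) 3 1 = 1 := by decide
  simp only [cylVec, lightVec, Real.sin_pi_div_three, Real.cos_pi_div_three, Real.cos_zero,
    Real.sin_zero]
  fin_cases i <;> simp [e0, e1] <;> ring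

lemma bary_cylPt_swap (r h : ℝ) (i : Fin 4) :
    bary (cylPt r 0 h) (Equiv.swap 2 3 i) = bary (cylPt r (Real.pi / 3) h) i := by
  rw [bary_cylPt, bary_cylPt, cylVec_swap, ← Equiv.sum_comp (Equiv.swap 2 3) (cylVec r 0 h)]
  simp only [cylVec_swap]

lemma cylDist_sub_right (r h r' h' δ c : ℝ) :
    cylDist r (h - c) r' (h' - c) δ = cylDist r h r' h' δ := by
  rw [cylDist, cylDist, cylCosh, cylCosh, sub_sub_sub_cancel_right]

end HypSpace

lemma straight_permute_swap {b : IdealSimplex} {r h : ℝ}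
    (hb : straight b = cylPt r (Real.pi / 3) h) :
    straight (b.permute (Equiv.swap 2 3)) = cylPt r 0 h := by
  refine ext_bary fun i => ?_
  rw [bary_straight, IdealSimplex.permute_apply, Equiv.symm_swap, ← bary_straight b, hb,
    ← bary_cylPt_swap, Equiv.swap_apply_self]

/-! ## Points on the edges -/

namespace IdealTriangulation

variable {N : Type*} [TopologicalSpace N]

/-- A point on an edge, with a simplex that contains the edge, numbered such that the edge joins the
first two vertices. -/
structure EdgePoint (T : IdealTriangulation N) where
  flag : Fin T.numTet × Equiv.Perm (Fin 4)
  pt : IdealSimplex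
  height : ℝ
  straight_pt : straight pt = cylPt 0 0 height

namespace EdgePoint

variable {T : IdealTriangulation N} (e : T.EdgePoint)

/-- The simplices around the edge. -/
def flagAt (j : ℕ) : Fin T.numTet × Equiv.Perm (Fin 4) := T.pairing.rotate^[j] e.flag

/-- The points of the fibre. -/
def rep (j : ℕ) : Fin T.numTet × IdealSimplex := ((e.flagAt j).1, e.pt.permute (e.flagAt j).2)

/-- The number of simplices around the edge. -/
def period : ℕ := Function.minimalPeriod T.pairing.rotate e.flag

lemma period_pos : 0 < e.period := T.pairing.minimalPeriod_rotate_pos e.flag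

lemma flagAt_succ (j : ℕ) : e.flagAt (j + 1) = T.pairing.rotate (e.flagAt j) :=
  Function.iterate_succ_apply' _ _ _

lemma flagAt_eq_iff {i j : ℕ} : e.flagAt i = e.flagAt j ↔ i ≡ j [MOD e.period] := by
  rw [flagAt, flagAt, ← Function.iterate_mod_minimalPeriod_eq (n := i),
    ← Function.iterate_mod_minimalPeriod_eq (n := j),
    Function.iterate_eq_iterate_iff_of_lt_minimalPeriod (Nat.mod_lt _ e.period_pos)
      (Nat.mod_lt _ e.period_pos)]
  rfl

lemma pt_two : e.pt.1 2 = 0 := by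
  rw [← bary_straight, e.straight_pt, bary_cylPt, cylVec_two, Real.sinh_zero, zero_mul, zero_div]

lemma pt_three : e.pt.1 3 = 0 := by
  rw [← bary_straight, e.straight_pt, bary_cylPt, cylVec_three, Real.sinh_zero, zero_mul, zero_div]

lemma pt_eq_zero_iff (i : Fin 4) : e.pt.1 i = 0 ↔ i = 2 ∨ i = 3 := by
  have h1 := e.pt.2.1.2
  rw [Fin.sum_univ_four, e.pt_two, e.pt_three, add_zero, add_zero] at h1
  constructor
  · intro h
    fin_cases i
    · exact absurd (by simpa [show e.pt.1 0 = 0 from h] using h1) (e.pt.2.2 1)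
    · exact absurd (by simpa [show e.pt.1 1 = 0 from h] using h1) (e.pt.2.2 0)
    · exact Or.inl rfl
    · exact Or.inr rfl
  · rintro (rfl | rfl)
    · exact e.pt_two
    · exact e.pt_three

lemma permute_swap : e.pt.permute (Equiv.swap 2 3) = e.pt := by
  refine (IdealSimplex.eq_permute_iff.2 fun j => ?_).symm
  have e0 : Equiv.swap (2 : Fin 4) 3 0 = 0 := by decide
  have e1 : Equiv.swap (2 : Fin 4) 3 1 = 1 := by decide
  fin_cases j <;> simp [e0, e1, e.pt_two, e.pt_three]

lemma rep_eq_zero_iff {i : Fin 4} {j : ℕ} :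
    (e.rep j).2.1 i = 0 ↔ i = (e.flagAt j).2 2 ∨ i = (e.flagAt j).2 3 := by
  rw [rep, IdealSimplex.permute_apply, pt_eq_zero_iff, Equiv.symm_apply_eq, Equiv.symm_apply_eq]

/-- The rotation differs from the crossing by the transposition of `2` and `3`, which fixes points
of the edge. -/
lemma cross_rep_two (j : ℕ) : T.pairing.cross (e.rep j) ((e.flagAt j).2 2) = e.rep (j + 1) := by
  simp only [rep, FacePairing.cross, flagAt_succ, FacePairing.rotate]
  rw [IdealSimplex.permute_mul _ (Equiv.swap 2 3), permute_swap, IdealSimplex.permute_mul]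

lemma cross_rep_three (j : ℕ) :
    T.pairing.cross (e.rep (j + 1)) ((e.flagAt (j + 1)).2 3) = e.rep j := by
  rw [flagAt_succ, FacePairing.rotate_snd_three, ← cross_rep_two]
  exact T.pairing.cross_cross (e.rep j) _

lemma exists_succ_eq (j : ℕ) : ∃ l, e.flagAt (l + 1) = e.flagAt j := by
  refine ⟨j + (e.period - 1), e.flagAt_eq_iff.2 ?_⟩
  have := e.period_pos
  rw [show j + (e.period - 1) + 1 = j + e.period by omega]
  exact Nat.add_modEq_right

lemma rep_congr {i j : ℕ} (h : e.flagAt i = e.flagAt j) : e.rep i = e.rep j := by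
  rw [rep, rep, h]

/-- Only the two faces at the edge can be crossed. One leads forwards; the other leads backwards,
which by periodicity is also reached going forwards. -/
lemma exists_eq_rep {x : Fin T.numTet × IdealSimplex} (hx : T.proj x = T.proj (e.rep 0)) :
    ∃ j, x = e.rep j := by
  refine T.fiber_induction (P := fun x => ∃ j, x = e.rep j) ⟨0, rfl⟩ ?_ hx
  rintro _ i ⟨j, rfl⟩ hi
  rcases e.rep_eq_zero_iff.1 hi with rfl | rfl
  · exact ⟨j + 1, e.cross_rep_two j⟩
  · obtain ⟨l, hl⟩ := e.exists_succ_eq j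
    refine ⟨l, ?_⟩
    rw [← e.rep_congr hl, ← hl, cross_rep_three]

lemma proj_rep (j : ℕ) : T.proj (e.rep j) = T.proj (e.rep 0) := by
  induction j with
  | zero => rfl
  | succ j ih => rw [← ih, ← cross_rep_two, T.proj_cross (e.rep_eq_zero_iff.2 (Or.inl rfl))]

/-- Two visits to the same point of the same simplex differ by a permutation that preserves the zero
set `{2, 3}` of the coordinates, and `iterate_rotate_eq_self` makes it trivial. Here orientability
enters the geometry: the angular position of a simplex about the edge is well defined modulo the
period. -/
lemma flagAt_eq_of_rep_eq (hT : T.Orientable) {i j : ℕ} (h : e.rep i = e.rep j) :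
    e.flagAt i = e.flagAt j := by
  have h1 : (e.flagAt i).1 = (e.flagAt j).1 := congrArg (fun x => x.1) h
  have h2 : e.pt.permute (e.flagAt i).2 = e.pt.permute (e.flagAt j).2 := congrArg (fun x => x.2) h
  have hz : ∀ k, e.pt.1 (((e.flagAt i).2⁻¹ * (e.flagAt j).2) k) = e.pt.1 k := by
    intro k
    have := congrArg (fun t : IdealSimplex => t.1 ((e.flagAt j).2 k)) h2
    simpa using this
  -- Adding `period * i`, which is at least `i`, keeps the exponent a true difference of natural
  -- numbers even if `j < i`.
  have hit : T.pairing.rotate^[j + e.period * i - i] (e.flagAt i) =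
      ((e.flagAt i).1, (e.flagAt i).2 * ((e.flagAt i).2⁻¹ * (e.flagAt j).2)) := by
    rw [mul_inv_cancel_left, h1]
    change _ = e.flagAt j
    rw [flagAt, ← Function.iterate_add_apply]
    change e.flagAt _ = _
    rw [flagAt_eq_iff]
    have : i ≤ e.period * i := Nat.le_mul_of_pos_left i e.period_pos
    rw [show j + e.period * i - i + i = j + e.period * i by omega]
    exact Nat.add_mul_mod_self_left _ _ _
  have hone := T.pairing.iterate_rotate_eq_self hT hit
    ((e.pt_eq_zero_iff _).1 ((hz 2).trans e.pt_two)) ((e.pt_eq_zero_iff _).1 ((hz 3).trans e.pt_three))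
  rw [inv_mul_eq_one] at hone
  exact Prod.ext h1 hone

/-! ### Development along the edge -/

/-- The point with given cylindrical coordinates in the `j`-th simplex around the edge. -/
def develop (j : ℕ) (r θ h : ℝ) : T.Glued :=
  T.toGlued (e.flagAt j).1 ((toSimplex (cylPt r θ h)).permute (e.flagAt j).2)

lemma develop_congr {i j : ℕ} (h : e.flagAt i = e.flagAt j) (r θ t : ℝ) :
    e.develop i r θ t = e.develop j r θ t := by
  rw [develop, develop, h]

variable {e} {ρ : ℝ}

lemma bary_pos_of_dist_lt (hρ : (e.rep 0).2.IsSmallRadius ρ) {p : HypSpace}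
    (hp : dist p (straight e.pt) < ρ) {i : Fin 4} (hi : e.pt.1 i ≠ 0) : 0 < bary p i := by
  have h := hρ.bary_pos (e.flagAt 0).2⁻¹ i
  simp only [rep, IdealSimplex.permute_inv_permute] at h
  exact h hi p hp

/-- Within the small radius only the two faces at the edge matter, so there the simplex coincides
with the wedge of angles up to `π / 3`. -/
lemma bary_cylPt_nonneg (hρ : (e.rep 0).2.IsSmallRadius ρ) {r θ h : ℝ} (hr : 0 ≤ r) (h0 : 0 ≤ θ)
    (h1 : θ ≤ Real.pi / 3) (hd : cylDist 0 e.height r h 0 < ρ) (i : Fin 4) :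
    0 ≤ bary (cylPt r θ h) i := by
  have hd' : dist (cylPt r θ h) (straight e.pt) < ρ := by
    rw [e.straight_pt, dist_comm, dist_cylPt_zero]
    simpa [cylDist, cylCosh] using hd
  by_cases hi : e.pt.1 i = 0
  · rcases (e.pt_eq_zero_iff i).1 hi with rfl | rfl
    · exact bary_cylPt_two_nonneg h hr h0 h1
    · exact bary_cylPt_three_nonneg h hr h0 h1
  · exact (bary_pos_of_dist_lt hρ hd' hi).le

lemma develop_pi_div_three (hρ : (e.rep 0).2.IsSmallRadius ρ) {r h : ℝ} (hr : 0 ≤ r)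
    (hd : cylDist 0 e.height r h 0 < ρ) (j : ℕ) :
    e.develop j r (Real.pi / 3) h = e.develop (j + 1) r 0 h := by
  have hπ := Real.pi_pos
  have h1 := straight_toSimplex (bary_cylPt_nonneg hρ hr (by positivity) le_rfl hd)
  have h2 := straight_permute_swap h1
  set b := toSimplex (cylPt r (Real.pi / 3) h) with hb
  have h3 : toSimplex (cylPt r 0 h) = b.permute (Equiv.swap 2 3) := by
    rw [← h2, toSimplex_straight]
  have h4 : b.1 2 = 0 := by
    rw [← bary_straight, h1, bary_cylPt, cylVec_two, sub_self, Real.sin_zero, mul_zero, zero_div]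
  have h5 := T.proj_cross (x := ((e.flagAt j).1, b.permute (e.flagAt j).2)) (i := (e.flagAt j).2 2)
    (by simp [h4])
  have e2 : (Equiv.swap 2 3 * Equiv.swap 2 3 : Equiv.Perm (Fin 4)) = 1 := by decide
  rw [develop, develop, h3, flagAt_succ, ← hb]
  simp only [FacePairing.rotate]
  rw [← IdealSimplex.permute_mul, mul_assoc, e2, mul_one, IdealSimplex.permute_mul]
  exact h5.symm

lemma edist_develop_same (hρ : (e.rep 0).2.IsSmallRadius ρ) (j : ℕ) {r θ h r' θ' h' : ℝ}
    (hr : 0 ≤ r) (hθ : 0 ≤ θ) (hθ₁ : θ ≤ Real.pi / 3) (hr' : 0 ≤ r') (hθ' : 0 ≤ θ')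
    (hθ₁' : θ' ≤ Real.pi / 3) (hd : cylDist 0 e.height r h 0 < ρ)
    (hd' : cylDist 0 e.height r' h' 0 < ρ) :
    edist (e.develop j r θ h) (e.develop j r' θ' h') ≤
      ENNReal.ofReal (cylDist r h r' h' (θ' - θ)) := by
  refine (T.edist_toGlued_le _ _ _).trans ?_
  rw [edist_dist, IdealSimplex.dist_straight_permute,
    straight_toSimplex (bary_cylPt_nonneg hρ hr hθ hθ₁ hd),
    straight_toSimplex (bary_cylPt_nonneg hρ hr' hθ' hθ₁' hd'), dist_cylPt, ← cylDist_neg, neg_sub]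

lemma cylDist_origin_le (h₀ r h r' h' δ : ℝ) :
    cylDist 0 h₀ r h 0 ≤ cylDist 0 h₀ r' h' 0 + cylDist r' h' r h δ := by
  have := cylDist_triangle 0 h₀ r' h' r h 0 δ
  simpa [cylDist, cylCosh] using this

/-- The segment is cut where it leaves the first wedge, and the remainder crosses one wedge fewer;
total angle at most `π` guarantees the cut. The bound `2ρ` on the perimeter of the triangle with the
centre passes to the shorter segment and keeps all cutting points within `ρ` of the centre. -/
lemma edist_develop_le (hρ : (e.rep 0).2.IsSmallRadius ρ) (n : ℕ) : ∀ (j : ℕ) {r θ h r' θ' h' : ℝ},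
    0 ≤ r → 0 ≤ θ → θ ≤ Real.pi / 3 → 0 ≤ r' → 0 ≤ θ' → θ' ≤ Real.pi / 3 →
    n * (Real.pi / 3) + θ' - θ ≤ Real.pi →
    cylDist 0 e.height r h 0 + cylDist 0 e.height r' h' 0 +
      cylDist r h r' h' (n * (Real.pi / 3) + θ' - θ) < 2 * ρ →
    edist (e.develop j r θ h) (e.develop (j + n) r' θ' h') ≤
      ENNReal.ofReal (cylDist r h r' h' (n * (Real.pi / 3) + θ' - θ)) := by
  have hπ := Real.pi_pos
  induction n with
  | zero =>
    intro j r θ h r' θ' h' hr hθ hθ₁ hr' hθ' hθ₁' hle hd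
    simp only [Nat.cast_zero, zero_mul, zero_add, Nat.add_zero] at hd ⊢
    have h1 := cylDist_origin_le e.height r h r' h' (θ' - θ)
    have h2 := cylDist_origin_le e.height r' h' r h (θ' - θ)
    rw [cylDist_comm r'] at h1
    exact edist_develop_same hρ j hr hθ hθ₁ hr' hθ' hθ₁' (by linarith) (by linarith)
  | succ n ih =>
    intro j r θ h r' θ' h' hr hθ hθ₁ hr' hθ' hθ₁' hle hd
    have hn : 0 ≤ (n : ℝ) * (Real.pi / 3) := by positivity
    push_cast at hle hd ⊢
    obtain ⟨s, t, hs, ht⟩ := exists_cyl_between (β := Real.pi / 3 - θ) h h' hr hr' (by linarith)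
      (by linarith : _ ≤ ((n : ℝ) + 1) * (Real.pi / 3) + θ' - θ) hle
    have e1 : ((n : ℝ) + 1) * (Real.pi / 3) + θ' - θ - (Real.pi / 3 - θ) =
      n * (Real.pi / 3) + θ' - 0 := by ring
    rw [e1] at ht
    have h1 := cylDist_origin_le e.height r h s t (Real.pi / 3 - θ)
    have h2 := cylDist_origin_le e.height s t r h (Real.pi / 3 - θ)
    have h3 := cylDist_origin_le e.height s t r' h' (n * (Real.pi / 3) + θ' - 0)
    rw [cylDist_comm s] at h1
    rw [cylDist_comm r'] at h3
    have h4 := cylDist_nonneg 0 e.height s t 0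
    have h5 := cylDist_nonneg 0 e.height r h 0
    have h6 := cylDist_nonneg 0 e.height r' h' 0
    have hsρ : cylDist 0 e.height s t 0 < ρ := by linarith
    refine (edist_triangle _ (e.develop j s (Real.pi / 3) t) _).trans ?_
    rw [← ht, ENNReal.ofReal_add (cylDist_nonneg _ _ _ _ _) (cylDist_nonneg _ _ _ _ _)]
    refine add_le_add (edist_develop_same hρ j hr hθ hθ₁ hs (by linarith) le_rfl (by linarith) hsρ) ?_
    rw [develop_pi_div_three hρ hs hsρ, show j + (n + 1) = j + 1 + n by ring]
    exact ih (j + 1) hs le_rfl (by linarith) hr' hθ' hθ₁' (by linarith) (by linarith)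

lemma develop_axis (hρ : (e.rep 0).2.IsSmallRadius ρ) {h : ℝ} (hd : cylDist 0 e.height 0 h 0 < ρ)
    (j : ℕ) (θ θ' : ℝ) : e.develop j 0 θ h = e.develop 0 0 θ' h := by
  have h0 : ∀ j θ θ', e.develop j 0 θ h = e.develop j 0 θ' h := by
    intro j θ θ'
    rw [develop, develop, cylPt_zero θ θ']
  induction j generalizing θ with
  | zero => exact h0 0 θ θ'
  | succ j ih => rw [h0 _ θ 0, ← develop_pi_div_three hρ le_rfl hd, ih]

end EdgePoint

end IdealTriangulation

namespace IdealTriangulation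

namespace EdgePoint

variable {N : Type*} [TopologicalSpace N] {T : IdealTriangulation N} (e : T.EdgePoint)

/-! ### The chart at a point of an edge -/

/-- The cone angle at the edge. -/
def coneAngle : ℝ := e.period * (Real.pi / 3)

lemma coneAngle_pos : 0 < e.coneAngle :=
  mul_pos (Nat.cast_pos.2 e.period_pos) (div_pos Real.pi_pos (by norm_num))

/-- The point of the cone model with given coordinates in the `j`-th wedge. -/
def wedgePt (j : ℕ) (r : NNReal) (θ h : ℝ) : ConeModel e.coneAngle :=
  ⟨r, ((j * (Real.pi / 3) + θ : ℝ) : AddCircle e.coneAngle), h - e.height⟩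

/-- The position in the cone model of points of the simplices around the edge. -/
def ConeRel (x : Fin T.numTet × IdealSimplex) (b : IdealSimplex) (p : ConeModel e.coneAngle) : Prop :=
  ∃ (j : ℕ) (r : NNReal) (θ h : ℝ) (c : IdealSimplex), 0 ≤ θ ∧ θ ≤ Real.pi / 3 ∧ x = e.rep j ∧
    b = c.permute (e.flagAt j).2 ∧ straight c = cylPt r θ h ∧ p = e.wedgePt j r θ h

lemma wedge_coe_eq {i j : ℕ} (h : i ≡ j [MOD e.period]) :
    ((i * (Real.pi / 3) : ℝ) : AddCircle e.coneAngle) = ((j * (Real.pi / 3) : ℝ) :) := by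
  obtain ⟨z, hz⟩ := (Nat.modEq_iff_dvd.1 h)
  rw [eq_comm, ← sub_eq_zero, ← AddCircle.coe_sub, AddCircle.coe_eq_zero_iff]
  refine ⟨z, ?_⟩
  have : ((j : ℝ) - i) = e.period * z := by exact_mod_cast hz
  rw [coneAngle, zsmul_eq_mul]
  linear_combination (-(Real.pi / 3)) * this

lemma dist_wedgePt_le {i j : ℕ} (h : i ≡ j [MOD e.period]) {r r' : NNReal} {θ t θ' t' : ℝ}
    (hθ : |θ - θ'| ≤ Real.pi) :
    dist (e.wedgePt i r θ t) (e.wedgePt j r' θ' t') ≤ cylDist r t r' t' (θ - θ') := by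
  refine (ConeModel.dist_le_cylDist (δ := θ - θ') ?_ hθ).trans_eq (cylDist_sub_right _ _ _ _ _ _)
  simp only [wedgePt]
  rw [AddCircle.coe_add, AddCircle.coe_add, e.wedge_coe_eq h, AddCircle.coe_sub]
  abel

lemma dist_origin_wedgePt (j : ℕ) (r : NNReal) (θ h : ℝ) :
    dist (ConeModel.origin e.coneAngle) (e.wedgePt j r θ h) = cylDist 0 e.height r h 0 := by
  rw [ConeModel.dist_origin _ 0, wedgePt, ← sub_self e.height, cylDist_sub_right]

lemma abs_sub_le_pi {θ θ' : ℝ} (h0 : 0 ≤ θ) (h1 : θ ≤ Real.pi / 3) (h0' : 0 ≤ θ')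
    (h1' : θ' ≤ Real.pi / 3) : |θ - θ'| ≤ Real.pi := by
  have := Real.pi_pos
  rw [abs_le]
  constructor <;> linarith

variable {e}

lemma toGlued_eq_develop {j : ℕ} {c : IdealSimplex} {r θ h : ℝ} (hc : straight c = cylPt r θ h) :
    T.toGlued (e.rep j).1 (c.permute (e.flagAt j).2) = e.develop j r θ h := by
  rw [develop, ← hc, toSimplex_straight]
  rfl

/-- A point on the last face of a wedge has angle `π / 3` there, or lies on the axis, and its image
has angle `0` in the next wedge. Both describe the same point of the cone. -/
lemma glue_two (hT : T.Orientable) {j : ℕ} {b : IdealSimplex} {p q : ConeModel e.coneAngle}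
    (hb : b.1 ((e.flagAt j).2 2) = 0) (hp : e.ConeRel (e.rep j) b p)
    (hq : e.ConeRel (T.pairing.cross (e.rep j) ((e.flagAt j).2 2))
      (b.permute (T.pairing.perm (e.rep j).1 ((e.flagAt j).2 2))) q) : dist p q = 0 := by
  obtain ⟨i, r, θ, h, c, h0, h1, hi, rfl, hc, rfl⟩ := hp
  obtain ⟨i', r', θ', h', c', h0', h1', hi', hcc, hc', rfl⟩ := hq
  have hfi := e.flagAt_eq_of_rep_eq hT hi
  rw [cross_rep_two] at hi'
  have hfi' := e.flagAt_eq_of_rep_eq hT hi'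
  have hθ := Real.pi_pos
  have hb' : bary (cylPt r θ h) 2 = 0 := by
    rw [← hc, bary_straight, ← hb, ← hfi]
    simp
  have hcw : straight c = cylPt r (Real.pi / 3) h := by
    rcases eq_of_bary_cylPt_two_eq_zero h0 h1 hb' with h3 | h3
    · rw [hc, h3]; exact cylPt_zero _ _ _
    · rw [hc, h3]
  -- In the numberings by the flags, crossing the face is just the transposition of `2` and `3`.
  have e2 : c' = c.permute (Equiv.swap 2 3) := by
    rw [← hfi', flagAt_succ, FacePairing.rotate, ← hfi, ← IdealSimplex.permute_mul] at hcc
    rw [IdealSimplex.permute_mul _ (Equiv.swap 2 3)] at hcc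
    have h5 := congrArg (IdealSimplex.permute (T.pairing.perm (e.flagAt i).1 ((e.flagAt i).2 2) *
      (e.flagAt i).2)⁻¹) hcc
    have h6 : c = c'.permute (Equiv.swap 2 3) := by
      simpa only [rep, hfi, IdealSimplex.permute_inv_permute] using h5
    rw [h6, ← IdealSimplex.permute_mul]
    have e3 : (Equiv.swap 2 3 * Equiv.swap 2 3 : Equiv.Perm (Fin 4)) = 1 := by decide
    rw [e3, IdealSimplex.permute_one]
  have hcyl : cylPt r' θ' h' = cylPt r 0 h := by rw [← hc', e2, straight_permute_swap hcw]
  have hmod : i + 1 ≡ i' [MOD e.period] := by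
    rw [← flagAt_eq_iff, flagAt_succ, ← hfi, ← flagAt_succ, hfi']
  have key : cylDist r h r' h' (0 - θ') = 0 := by
    rw [← dist_cylPt, hcyl, dist_self]
  refine le_antisymm ?_ dist_nonneg
  calc dist (e.wedgePt i r θ h) (e.wedgePt i' r' θ' h')
      ≤ dist (e.wedgePt i r θ h) (e.wedgePt (i + 1) r 0 h) +
        dist (e.wedgePt (i + 1) r 0 h) (e.wedgePt i' r' θ' h') := dist_triangle _ _ _
    _ ≤ 0 + cylDist r h r' h' (0 - θ') := by
        refine add_le_add ?_ (e.dist_wedgePt_le hmod (abs_sub_le_pi le_rfl (by positivity) h0' h1'))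
        have e1 : e.wedgePt (i + 1) r 0 h = e.wedgePt i r (Real.pi / 3) h := by
          simp only [wedgePt]; push_cast; ring_nf
        rw [e1]
        refine (e.dist_wedgePt_le (Nat.ModEq.refl i)
          (abs_sub_le_pi h0 h1 (by positivity) le_rfl)).trans_eq ?_
        rw [← dist_cylPt, ← hc, hcw, dist_self]
    _ = 0 := by rw [key, add_zero]

/-- The chart at a point of an edge. -/
def coneChart (hT : T.Orientable) {ρ : ℝ} (hρ : (e.rep 0).2.IsSmallRadius ρ) :
    T.Chart (e.rep 0) ρ (ConeModel.origin e.coneAngle) where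
  small := hρ
  rel := e.ConeRel
  total := by
    intro x hx b _
    obtain ⟨j, rfl⟩ := e.exists_eq_rep hx
    obtain ⟨r, θ, h, hr, h0, h1, hc⟩ := exists_eq_cylPt
      (p := straight (b.permute (e.flagAt j).2⁻¹)) (fun i => by
        rw [bary_straight]; exact IdealSimplex.nonneg _ i)
    exact ⟨_, j, ⟨r, hr⟩, θ, h, _, h0, h1, rfl, by simp, hc, rfl⟩
  dist_le := by
    rintro x a b p q hx ⟨i, r, θ, h, c, h0, h1, rfl, rfl, hc, rfl⟩
      ⟨i', r', θ', h', c', h0', h1', hi', rfl, hc', rfl⟩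
    have hf := e.flagAt_eq_of_rep_eq hT hi'
    refine (e.dist_wedgePt_le (e.flagAt_eq_iff.1 hf) (abs_sub_le_pi h0 h1 h0' h1')).trans_eq ?_
    rw [hf, IdealSimplex.dist_straight_permute, hc, hc', dist_cylPt]
  glue := by
    intro x i b p q hx hxi hbi hp hq
    obtain ⟨j, rfl⟩ := e.exists_eq_rep hx
    rcases e.rep_eq_zero_iff.1 hxi with rfl | rfl
    · exact glue_two hT hbi hp hq
    -- Crossing the first face of a wedge undoes the crossing of the last face of the preceding one,
    -- so `glue_two` applies with the roles of `p` and `q` exchanged.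
    · obtain ⟨l, hl⟩ := e.exists_succ_eq j
      rw [← e.rep_congr hl] at hp hq
      rw [← hl] at hq hbi
      have e1 := e.cross_rep_three l
      rw [e1] at hq
      rw [dist_comm]
      have e3 : T.pairing.perm (e.rep l).1 ((e.flagAt l).2 2) =
          (T.pairing.perm (e.rep (l + 1)).1 ((e.flagAt (l + 1)).2 3))⁻¹ := by
        rw [← e.cross_rep_two, flagAt_succ, FacePairing.rotate_snd_three]
        simp only [FacePairing.cross, rep]
        rw [FacePairing.perm_perm, inv_inv]
      have e4 : T.pairing.perm (e.rep (l + 1)).1 ((e.flagAt (l + 1)).2 3) ((e.flagAt (l + 1)).2 3) =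
          (e.flagAt l).2 2 := by
        rw [← inv_inv (T.pairing.perm (e.rep (l + 1)).1 ((e.flagAt (l + 1)).2 3)), ← e3,
          Equiv.Perm.inv_eq_iff_eq, flagAt_succ, FacePairing.rotate_snd_three]
        rfl
      refine glue_two hT (j := l) ?_ hq ?_
      · rw [← e4, IdealSimplex.permute_apply, Equiv.symm_apply_apply, hbi]
      · rw [cross_rep_two, e3, IdealSimplex.permute_inv_permute]
        exact hp
  dist_origin := by
    rintro x b p hx ⟨i, r, θ, h, c, h0, h1, rfl, rfl, hc, rfl⟩
    rw [dist_origin_wedgePt, rep, IdealSimplex.dist_straight_permute, hc, e.straight_pt, dist_comm,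
      dist_cylPt_zero]
    simp [cylDist, cylCosh]
  surj := by
    intro p hp
    have hρ0 := hρ.pos
    have hπ := Real.pi_pos
    have : Fact (0 < e.coneAngle) := ⟨e.coneAngle_pos⟩
    obtain ⟨r, Θ, h⟩ := p
    obtain ⟨t, ht, rfl⟩ : ∃ t ∈ Set.Ico 0 (0 + e.coneAngle), (t : AddCircle e.coneAngle) = Θ :=
      ⟨_, (AddCircle.equivIco e.coneAngle 0 Θ).2, AddCircle.coe_equivIco⟩
    -- The index of the wedge that contains the angle `t`.
    set j := ⌊t / (Real.pi / 3)⌋₊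
    have hj0 : j * (Real.pi / 3) ≤ t :=
      (le_div_iff₀ (by positivity)).1 (Nat.floor_le (div_nonneg ht.1 (by positivity)))
    have hj1 : t < (j + 1) * (Real.pi / 3) :=
      (div_lt_iff₀ (by positivity)).1 (Nat.lt_floor_add_one _)
    have hw : (⟨r, (t : AddCircle e.coneAngle), h⟩ : ConeModel e.coneAngle) =
        e.wedgePt j r (t - j * (Real.pi / 3)) (h + e.height) := by
      simp [wedgePt]
    rw [hw] at hp ⊢
    rw [dist_origin_wedgePt] at hp
    exact ⟨e.rep j, _, e.proj_rep j, j, r, _, _, toSimplex (cylPt r (t - j * (Real.pi / 3)) (h + e.height)),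
      by linarith, by linarith, rfl, rfl,
      straight_toSimplex (bary_cylPt_nonneg hρ r.2 (by linarith) (by linarith) (by linarith)), rfl⟩
  le := by
    have key : ∀ {n j j' : ℕ} {r r' : NNReal} {θ θ' h h' : ℝ}, 0 ≤ θ → θ ≤ Real.pi / 3 → 0 ≤ θ' →
        θ' ≤ Real.pi / 3 → cylDist 0 e.height r h 0 < ρ / 3 → cylDist 0 e.height r' h' 0 < ρ / 3 →
        j + n ≡ j' [MOD e.period] → n * (Real.pi / 3) + θ' - θ ≤ Real.pi →
        dist (e.wedgePt j r θ h) (e.wedgePt j' r' θ' h') =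
          cylDist r h r' h' (n * (Real.pi / 3) + θ' - θ) →
        edist (e.develop j r θ h) (e.develop j' r' θ' h') ≤
          ENNReal.ofReal (dist (e.wedgePt j r θ h) (e.wedgePt j' r' θ' h')) := by
      intro n j j' r r' θ θ' h h' h0 h1 h0' h1' hd hd' hn hle heq
      have htri := dist_triangle_left (e.wedgePt j r θ h) (e.wedgePt j' r' θ' h')
        (ConeModel.origin e.coneAngle)
      rw [dist_origin_wedgePt, dist_origin_wedgePt, heq] at htri
      rw [heq, ← e.develop_congr (e.flagAt_eq_iff.2 hn)]
      have := hρ.pos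
      exact edist_develop_le hρ n j r.2 h0 h1 r'.2 h0' h1' hle (by linarith)
    rintro x x' a b p q - - ⟨j, r, θ, h, c, h0, h1, rfl, rfl, hc, rfl⟩
      ⟨j', r', θ', h', c', h0', h1', rfl, rfl, hc', rfl⟩ hp hq
    rw [dist_origin_wedgePt] at hp hq
    rw [toGlued_eq_develop hc, toGlued_eq_develop hc']
    have hρ0 := hρ.pos
    have hang : (e.wedgePt j r θ h).angle - (e.wedgePt j' r' θ' h').angle =
        (((j - j' : ℝ) * (Real.pi / 3) + θ - θ' : ℝ) : AddCircle e.coneAngle) := by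
      simp only [wedgePt]
      rw [← AddCircle.coe_sub]
      congr 1
      ring
    have hcd : ∀ δ, cylDist (e.wedgePt j r θ h).radius (e.wedgePt j r θ h).height
        (e.wedgePt j' r' θ' h').radius (e.wedgePt j' r' θ' h').height δ = cylDist r h r' h' δ :=
      fun δ => cylDist_sub_right _ _ _ _ _ _
    -- A shortest path of the cone is followed in the glued space: through a point of the axis,
    -- which all wedges share, or through consecutive wedges.
    rcases ConeModel.exists_dist_eq hang with hpi | ⟨z, hz, hz'⟩
    · have htri := dist_triangle_left (e.wedgePt j r θ h) (e.wedgePt j' r' θ' h')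
        (ConeModel.origin e.coneAngle)
      rw [dist_origin_wedgePt, dist_origin_wedgePt] at htri
      rw [hcd] at hpi
      obtain ⟨t, ht⟩ := exists_cyl_axis h h' r.coe_nonneg r'.coe_nonneg (θ - θ) (θ' - θ')
      have h2 := cylDist_origin_le e.height 0 t r h (θ - θ)
      have h3 := cylDist_origin_le e.height 0 t r' h' (θ' - θ')
      rw [cylDist_comm r'] at h3
      have n1 := cylDist_nonneg 0 e.height r h 0
      have n2 := cylDist_nonneg 0 e.height r' h' 0
      have htρ : cylDist 0 e.height 0 t 0 < ρ := by linarith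
      rw [hpi, ← ht, ENNReal.ofReal_add (cylDist_nonneg _ _ _ _ _) (cylDist_nonneg _ _ _ _ _)]
      refine (edist_triangle _ (e.develop j 0 θ t) _).trans (add_le_add ?_ ?_)
      · exact edist_develop_same hρ j r.2 h0 h1 le_rfl h0 h1 (by linarith) htρ
      · rw [develop_axis hρ htρ j θ 0, ← develop_axis hρ htρ j' θ' 0]
        exact edist_develop_same hρ j' le_rfl h0' h1' r'.2 h0' h1' htρ (by linarith)
    · rw [hcd] at hz'
      -- The signed number of wedge boundaries from wedge `j` to wedge `j'` along the chosen lift.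
      -- Its sign tells at which end the development has to start.
      set m : ℤ := j' - j - z * e.period with hm
      have hδ : (j - j' : ℝ) * (Real.pi / 3) + θ - θ' + z * e.coneAngle =
          -((m : ℝ) * (Real.pi / 3) + θ' - θ) := by
        rw [hm, coneAngle]; push_cast; ring
      rw [hδ] at hz hz'
      rw [abs_neg] at hz
      rw [cylDist_neg] at hz'
      rcases le_total 0 m with hm0 | hm0
      · obtain ⟨n, hn⟩ := Int.eq_ofNat_of_zero_le hm0
        rw [hn] at hz hz'
        refine key h0 h1 h0' h1' hp hq (n := n) ?_ (abs_le.1 hz).2 hz'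
        refine (Nat.modEq_iff_dvd.2 ⟨z, ?_⟩)
        push_cast
        linear_combination hn - hm
      · obtain ⟨n, hn⟩ := Int.eq_ofNat_of_zero_le (neg_nonneg.2 hm0)
        have hmn : (m : ℝ) = -(n : ℝ) := by
          have : m = -(n : ℤ) := by linarith
          exact_mod_cast congrArg (Int.cast : ℤ → ℝ) this
        rw [hmn] at hz hz'
        rw [edist_comm, dist_comm]
        refine key h0' h1' h0 h1 hq hp (n := n) ?_ (by linarith [(abs_le.1 hz).1]) ?_
        · refine (Nat.modEq_iff_dvd.2 ⟨-z, ?_⟩)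
          push_cast
          linear_combination hn + hm
        · rw [dist_comm, hz', cylDist_comm, ← cylDist_neg]
          congr 1
          ring

end EdgePoint

/-! ### Every point of an edge is a cone point -/

variable {N : Type*} [TopologicalSpace N]

lemma exists_edgePoint (T : IdealTriangulation N) (k : Fin T.numTet) {t : IdealSimplex}
    {i j : Fin 4} (hij : i ≠ j) (hi : t.1 i = 0) (hj : t.1 j = 0) :
    ∃ e : T.EdgePoint, e.rep 0 = (k, t) := by
  obtain ⟨σ, hσ2, hσ3⟩ : ∃ σ : Equiv.Perm (Fin 4), σ 2 = i ∧ σ 3 = j := by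
    clear hi hj
    revert i j
    decide
  set s := t.permute σ⁻¹ with hs
  have h2 : s.1 2 = 0 := by rw [hs, IdealSimplex.permute_apply, ← hi, ← hσ2]; rfl
  have h3 : s.1 3 = 0 := by rw [hs, IdealSimplex.permute_apply, ← hj, ← hσ3]; rfl
  have hsum := s.2.1.2
  rw [Fin.sum_univ_four, h2, h3, add_zero, add_zero] at hsum
  have h0 : 0 < s.1 0 := (s.2.1.1 0).lt_of_ne' fun h => s.2.2 1 (by linarith)
  have h1 : 0 < s.1 1 := (s.2.1.1 1).lt_of_ne' fun h => s.2.2 0 (by linarith)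
  -- With vanishing transverse part the point lies on the axis, and the angle `0` is an arbitrary
  -- choice.
  obtain ⟨κ, r, h, hκ, -, hr, heq⟩ := exists_cylVec_eq h0 h1 le_rfl
    (by have := mul_pos h0 h1; linarith) 0
  obtain rfl := hr rfl
  have hb : bary (straight s) = κ • cylVec 0 0 h := by
    rw [← heq]
    ext l
    rw [bary_straight]
    fin_cases l <;> simp [lightVec, h2, h3]
  refine ⟨⟨(k, σ), s, h, ?_⟩, ?_⟩
  · rw [← ofCoord_bary (straight s), hb, ofCoord_smul (timelike_cylVec _ _ _) hκ, cylPt]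
  · simp [EdgePoint.rep, EdgePoint.flagAt, hs]

lemma exists_isConePoint {T : IdealTriangulation N} (hT : T.Orientable) {k : Fin T.numTet}
    {t : IdealSimplex} {i j : Fin 4} (hij : i ≠ j) (hi : t.1 i = 0) (hj : t.1 j = 0) :
    ∃ α : ℝ, 0 < α ∧ IsConePoint α (T.toGlued k t) := by
  obtain ⟨e, he⟩ := T.exists_edgePoint k hij hi hj
  obtain ⟨ρ, hρ⟩ := IdealSimplex.exists_isSmallRadius (e.rep 0).2
  obtain ⟨ψ, h0, h1, h2⟩ := (EdgePoint.coneChart hT hρ).exists_isometry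
  rw [he] at h0 h2
  exact ⟨e.coneAngle, e.coneAngle_pos, ρ / 3, div_pos hρ.pos (by norm_num), ψ, h0, h1, h2⟩

end IdealTriangulation

/-! ## Volume -/

/-! ### Hausdorff measure under local isometries -/

section LocalIsometry

open MeasureTheory Measure

variable {X Y : Type*} [EMetricSpace X] [MeasurableSpace X] [BorelSpace X]
  [EMetricSpace Y] [MeasurableSpace Y] [BorelSpace Y]

lemma euclideanHausdorffMeasure_image_eq_zero {f : X → Y} {s : Set X} {C : NNReal}
    (hf : LipschitzOnWith C f s) (d : ℕ) (hs : (μHE[d] : Measure X) s = 0) :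
    (μHE[d] : Measure Y) (f '' s) = 0 := by
  rw [euclideanHausdorffMeasure_def, Measure.smul_apply, ENNReal.smul_def, smul_eq_mul,
    mul_eq_zero, or_iff_right (by
      simpa using addHaarScalarFactor_volume_hausdorffMeasure_ne_zero d)] at hs ⊢
  have := hf.hausdorffMeasure_image_le (d := d) (by positivity)
  rw [hs, mul_zero] at this
  exact le_antisymm this bot_le

lemma euclideanHausdorffMeasure_image_of_isometryOn {f : X → Y} {s : Set X}
    (hf : ∀ a ∈ s, ∀ b ∈ s, edist (f a) (f b) = edist a b) (d : ℕ) :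
    (μHE[d] : Measure Y) (f '' s) = μHE[d] s := by
  have h1 : Isometry (s.domRestrict f) := fun a b => hf a a.2 b b.2
  have h2 := h1.euclideanHausdorffMeasure_image (d := d) Set.univ
  have h3 := (isometry_subtype_coe (s := s)).euclideanHausdorffMeasure_image (d := d) Set.univ
  rw [← h3, Set.image_univ, Set.range_domRestrict] at h2
  rw [h2, Set.image_univ, Subtype.range_coe]

/-- Injective local isometries preserve the Hausdorff measure. -/
theorem euclideanHausdorffMeasure_image_of_locally_isometryOn [PolishSpace X] {f : X → Y} {s : Set X}
    (hs : MeasurableSet s) (hinj : Set.InjOn f s) (hcont : ContinuousOn f s)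
    (hf : ∀ x ∈ s, ∃ u ∈ nhds x, ∀ a ∈ u, ∀ b ∈ u, edist (f a) (f b) = edist a b) (d : ℕ) :
    (μHE[d] : Measure Y) (f '' s) = μHE[d] s := by
  rcases s.eq_empty_or_nonempty with rfl | ⟨x₀, hx₀⟩
  · simp
  choose! u hu hfu using hf
  obtain ⟨t, hts, htc, ht⟩ := TopologicalSpace.countable_cover_nhdsWithin (f := fun x => interior (u x))
    (s := s) fun x hx => mem_nhdsWithin_of_mem_nhds (interior_mem_nhds.2 (hu x hx))
  have htn : t.Nonempty := by
    by_contra h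
    rw [Set.not_nonempty_iff_eq_empty] at h
    simpa [h] using ht hx₀
  obtain ⟨e, rfl⟩ := htc.exists_eq_range htn
  set v : ℕ → Set X := fun n => s ∩ disjointed (fun n => interior (u (e n))) n with hv
  have hvu : ∀ n, v n ⊆ u (e n) := fun n =>
    Set.inter_subset_right.trans ((disjointed_subset _ n).trans interior_subset)
  have hvm : ∀ n, MeasurableSet (v n) := fun n => hs.inter
    (MeasurableSet.disjointed (fun n => isOpen_interior.measurableSet) n)
  have hvd : Pairwise (Function.onFun Disjoint v) := fun i j hij =>
    (disjoint_disjointed _ hij).mono Set.inter_subset_right Set.inter_subset_right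
  have hvs : ∀ n, v n ⊆ s := fun n => Set.inter_subset_left
  have hU : s = ⋃ n, v n := by
    rw [hv, ← Set.inter_iUnion, iUnion_disjointed, eq_comm, Set.inter_eq_left]
    simpa using ht
  have e1 : ∀ n, (μHE[d] : Measure Y) (f '' v n) = μHE[d] (v n) := fun n =>
    euclideanHausdorffMeasure_image_of_isometryOn
      (fun a ha b hb => hfu (e n) (hts ⟨n, rfl⟩) a (hvu n ha) b (hvu n hb)) d
  conv_lhs => rw [hU]
  conv_rhs => rw [hU]
  -- A countable subcover, made disjoint, cuts `s` into pieces on which `f` is isometric. Their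
  -- images are disjoint by injectivity, and measurable as injective continuous images of Borel sets
  -- in a Polish space.
  rw [Set.image_iUnion, measure_iUnion _ fun n => (hvm n).image_of_continuousOn_injOn
    (hcont.mono (hvs n)) (hinj.mono (hvs n)), measure_iUnion hvd hvm]
  · simp only [e1]
  · intro i j hij
    rw [Function.onFun, Set.disjoint_left]
    rintro _ ⟨a, ha, rfl⟩ ⟨b, hb, h⟩
    rw [hinj (hvs j hb) (hvs i ha) h] at hb
    exact Set.disjoint_left.1 (hvd hij) ha hb

end LocalIsometry

/-! ### The faces of the tetrahedron are null sets -/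

namespace HypSpace

open MeasureTheory Measure

instance : MeasurableSpace HypSpace := borel HypSpace

instance : BorelSpace HypSpace := ⟨rfl⟩

lemma isOpenEmbedding_pt : Topology.IsOpenEmbedding pt := by
  refine ⟨⟨isInducing_pt, fun p q h => ext_pt h⟩, ?_⟩
  have : Set.range pt = Metric.ball 0 1 := by
    ext x
    rw [mem_ball_zero_iff]
    exact ⟨fun ⟨p, hp⟩ => hp ▸ p.norm_lt, fun h => ⟨⟨x, h⟩, rfl⟩⟩
  rw [this]
  exact Metric.isOpen_ball

instance : PolishSpace HypSpace := by
  have := isOpenEmbedding_pt.isOpen_range.polishSpace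
  exact isOpenEmbedding_pt.isEmbedding.toHomeomorph.isClosedEmbedding.polishSpace

/-- The point of hyperbolic space with given position in the unit ball. -/
def ofPt (x : EuclideanSpace ℝ (Fin 3)) : HypSpace := if h : ‖x‖ < 1 then ⟨x, h⟩ else center

lemma ofPt_pt (p : HypSpace) : ofPt p.pt = p := by rw [ofPt, dif_pos p.norm_lt]

/-- From `d ≤ sinh d`: by Cauchy-Schwarz the numerator of `sinh² d` is at most `‖p - q‖²`, and the
denominator stays away from zero on the smaller ball. The factor `2` is slack. -/
lemma dist_le_of_norm_le {r : ℝ} (hr : r < 1) {p q : HypSpace} (hp : ‖p.pt‖ ≤ r) (hq : ‖q.pt‖ ≤ r) :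
    dist p q ≤ 2 / (1 - r ^ 2) * ‖p.pt - q.pt‖ := by
  have hr0 := (norm_nonneg _).trans hp
  have h1 : 0 < 1 - r ^ 2 := by nlinarith
  refine (Real.self_le_sinh_iff.2 dist_nonneg).trans ?_
  rw [dist_def, Real.sinh_arcosh (one_le_coshDist p q), coshDist_sq_sub_one]
  refine Real.sqrt_le_iff.2 ⟨by positivity, ?_⟩
  have hp1 : 1 - r ^ 2 ≤ 1 - ‖p.pt‖ ^ 2 := by gcongr
  have hq1 : 1 - r ^ 2 ≤ 1 - ‖q.pt‖ ^ 2 := by gcongr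
  have hin : ⟪p.pt - q.pt, q.pt⟫ ^ 2 ≤ ‖p.pt - q.pt‖ ^ 2 * ‖q.pt‖ ^ 2 := by
    rw [← mul_pow, ← sq_abs]
    gcongr
    exact abs_real_inner_le_norm _ _
  have hD := sq_nonneg ‖p.pt - q.pt‖
  calc _ ≤ ‖p.pt - q.pt‖ ^ 2 / ((1 - r ^ 2) * (1 - r ^ 2)) := by
        refine div_le_div₀ (sq_nonneg _) (by nlinarith) (by positivity)
          (mul_le_mul hp1 hq1 h1.le (h1.le.trans hp1))
    _ ≤ 4 * ‖p.pt - q.pt‖ ^ 2 / ((1 - r ^ 2) * (1 - r ^ 2)) := by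
        gcongr
        linarith
    _ = _ := by field_simp; ring

lemma lipschitzOnWith_ofPt {r : ℝ} (hr : r < 1) :
    ∃ C : NNReal, LipschitzOnWith C ofPt (Metric.closedBall 0 r) := by
  refine ⟨Real.toNNReal (2 / (1 - r ^ 2)), LipschitzOnWith.of_dist_le_mul fun x hx y hy => ?_⟩
  rw [mem_closedBall_zero_iff] at hx hy
  have hr0 := (norm_nonneg _).trans hx
  rw [Real.coe_toNNReal _ (div_nonneg (by norm_num) (by nlinarith)), dist_eq_norm, ofPt, ofPt,
    dif_pos (hx.trans_lt hr), dif_pos (hy.trans_lt hr)]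
  exact dist_le_of_norm_le hr hx hy

lemma volume_affine_plane (i : Fin 4) :
    volume {x : EuclideanSpace ℝ (Fin 3) | 1 + 3 * ⟪x, idealVertex i⟫ = 0} = 0 := by
  have hv : ⟪idealVertex i, idealVertex i⟫ = (1 : ℝ) := by rw [inner_idealVertex, if_pos rfl]
  refine measure_mono_null ?_ (addHaar_affineSubspace volume
    (AffineSubspace.mk' (-(1 / 3 : ℝ) • idealVertex i) (ℝ ∙ idealVertex i)ᗮ) ?_)
  · intro x hx
    rw [SetLike.mem_coe, AffineSubspace.mem_mk', Submodule.mem_orthogonal_singleton_iff_inner_left,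
      vsub_eq_sub, inner_sub_left, real_inner_smul_left, hv]
    have : 1 + 3 * ⟪x, idealVertex i⟫ = 0 := hx
    linarith
  · intro h
    have h2 : idealVertex i ∈ (ℝ ∙ idealVertex i)ᗮ := by
      rw [← AffineSubspace.direction_mk' (-(1 / 3 : ℝ) • idealVertex i) (ℝ ∙ idealVertex i)ᗮ, h,
        AffineSubspace.direction_top]
      trivial
    rw [Submodule.mem_orthogonal_singleton_iff_inner_left, hv] at h2
    exact one_ne_zero h2

/-- Near each point the plane is a Lipschitz image of a piece of a Euclidean plane, which is
Lebesgue-null. Locally null sets are null. -/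
lemma measure_face (i : Fin 4) : (μHE[3] : Measure HypSpace) {p | bary p i = 0} = 0 := by
  refine measure_null_of_locally_null _ fun p _ => ?_
  obtain ⟨r, hpr, hr⟩ := exists_between p.norm_lt
  obtain ⟨C, hC⟩ := lipschitzOnWith_ofPt hr
  refine ⟨_, inter_mem_nhdsWithin _ ((isOpen_lt continuous_pt.norm continuous_const).mem_nhds hpr), ?_⟩
  have h0 : (μHE[3] : Measure (EuclideanSpace ℝ (Fin 3)))
      ({x | 1 + 3 * ⟪x, idealVertex i⟫ = 0} ∩ Metric.closedBall 0 r) = 0 := by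
    rw [EuclideanSpace.euclideanHausdorffMeasure_eq_volume]
    exact measure_mono_null Set.inter_subset_left (volume_affine_plane i)
  refine measure_mono_null ?_
    (euclideanHausdorffMeasure_image_eq_zero (hC.mono Set.inter_subset_right) 3 h0)
  rintro q ⟨hq, hqr⟩
  refine ⟨q.pt, ⟨?_, mem_closedBall_zero_iff.2 (le_of_lt hqr)⟩, ofPt_pt q⟩
  have : (1 + 3 * ⟪q.pt, idealVertex i⟫) / 4 = 0 := hq
  simpa using this

/-- The interior of the regular ideal tetrahedron. -/
def openTetrahedron : Set HypSpace := {p | ∀ i, 0 < bary p i}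

lemma isOpen_openTetrahedron : IsOpen openTetrahedron := by
  rw [openTetrahedron, Set.ofPred_forall]
  exact isOpen_iInter_of_finite isOpen_bary_pos

lemma openTetrahedron_subset : openTetrahedron ⊆ regularIdealTetrahedron := by
  rw [← range_straight_eq, range_straight]
  exact fun p hp i => (hp i).le

lemma measure_faces : (μHE[3] : Measure HypSpace) {p | ∃ i, bary p i = 0} = 0 := by
  rw [Set.ofPred_exists]
  exact measure_iUnion_null measure_face

lemma regularIdealTetrahedron_subset :
    regularIdealTetrahedron ⊆ openTetrahedron ∪ {p | ∃ i, bary p i = 0} := by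
  rw [← range_straight_eq, range_straight]
  intro p hp
  by_cases h : ∃ i, bary p i = 0
  · exact Or.inr h
  · push Not at h
    exact Or.inl fun i => (hp i).lt_of_ne' (h i)

lemma measure_regularIdealTetrahedron :
    (μHE[3] : Measure HypSpace) regularIdealTetrahedron = μHE[3] openTetrahedron := by
  refine le_antisymm ?_ (measure_mono openTetrahedron_subset)
  refine (measure_mono regularIdealTetrahedron_subset).trans ((measure_union_le _ _).trans ?_)
  rw [measure_faces, add_zero]

end HypSpace

/-! ### The volume of the glued space -/

namespace IdealTriangulation

open MeasureTheory Measure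

variable {N : Type*} [TopologicalSpace N] (T : IdealTriangulation N)

instance : MeasurableSpace T.Glued := borel T.Glued

instance : BorelSpace T.Glued := ⟨rfl⟩

/-- The quotient map from the regular ideal tetrahedron to the glued space. -/
def develTet (k : Fin T.numTet) (p : HypSpace) : T.Glued := T.toGlued k (toSimplex p)

lemma lipschitzOnWith_develTet (k : Fin T.numTet) :
    LipschitzOnWith 1 (T.develTet k) regularIdealTetrahedron := by
  rw [← range_straight_eq]
  rintro _ ⟨a, rfl⟩ _ ⟨b, rfl⟩
  rw [ENNReal.coe_one, one_mul, develTet, develTet, toSimplex_straight, toSimplex_straight]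
  exact T.edist_toGlued_le k a b

/-- An interior point lies on no face and is alone in its fibre. -/
lemma eq_of_develTet_eq {k l : Fin T.numTet} {p q : HypSpace} (hp : p ∈ openTetrahedron)
    (hq : q ∈ openTetrahedron) (h : T.develTet k p = T.develTet l q) : k = l ∧ p = q := by
  have h2 : ∀ j, (toSimplex q).1 j ≠ 0 := fun j => by
    rw [toSimplex_apply fun i => (hq i).le]; exact (hq j).ne'
  rcases T.fiber_of_ne_zero (x₀ := (l, toSimplex q)) (i := 0) (fun j _ => h2 j)
    (x := (k, toSimplex p)) h with h3 | ⟨h3, -⟩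
  · refine ⟨congrArg Prod.fst h3, ?_⟩
    rw [← straight_toSimplex fun i => (hp i).le, ← straight_toSimplex fun i => (hq i).le,
      show toSimplex p = toSimplex q from congrArg Prod.snd h3]
  · exact absurd h3 (h2 0)

lemma injOn_develTet (k : Fin T.numTet) : Set.InjOn (T.develTet k) openTetrahedron :=
  fun _ hp _ hq h => (T.eq_of_develTet_eq hp hq h).2

lemma continuousOn_develTet (k : Fin T.numTet) : ContinuousOn (T.develTet k) openTetrahedron :=
  ((T.lipschitzOnWith_develTet k).mono openTetrahedron_subset).continuousOn

lemma measure_develTet (k : Fin T.numTet) :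
    (μHE[3] : Measure T.Glued) (T.develTet k '' openTetrahedron) = μHE[3] openTetrahedron := by
  refine euclideanHausdorffMeasure_image_of_locally_isometryOn
    isOpen_openTetrahedron.measurableSet (T.injOn_develTet k) (T.continuousOn_develTet k) ?_ 3
  intro p hp
  have h0 : ∀ {q}, q ∈ openTetrahedron → straight (toSimplex q) = q := fun hq =>
    straight_toSimplex fun i => (hq i).le
  obtain ⟨U, hU, hUd⟩ := T.exists_nhds_edist_eq k (t := toSimplex p) fun i j _ _ => by
    rw [toSimplex_apply fun i => (hp i).le]; exact (hp j).ne'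
  rw [isInducing_straight.nhds_eq_comap, h0 hp, Filter.mem_comap] at hU
  obtain ⟨V, hV, hVU⟩ := hU
  refine ⟨V ∩ openTetrahedron, Filter.inter_mem hV (isOpen_openTetrahedron.mem_nhds hp), ?_⟩
  rintro a ⟨ha, ha'⟩ b ⟨hb, hb'⟩
  have := hUd (toSimplex a) (hVU (by rwa [Set.mem_preimage, h0 ha'])) (toSimplex b)
    (hVU (by rwa [Set.mem_preimage, h0 hb']))
  rwa [h0 ha', h0 hb'] at this

/-- The open tetrahedra have disjoint images of unchanged measure. The rest is the image of the
faces under `1`-Lipschitz maps, hence null. -/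
theorem measure_glued : (μHE[3] : Measure T.Glued) Set.univ =
    T.numTet * (μHE[3] : Measure HypSpace) regularIdealTetrahedron := by
  have hd : Pairwise (Function.onFun Disjoint fun k => T.develTet k '' openTetrahedron) := by
    intro k l hkl
    rw [Function.onFun, Set.disjoint_left]
    rintro _ ⟨p, hp, rfl⟩ ⟨q, hq, h⟩
    exact hkl (T.eq_of_develTet_eq hq hp h).1.symm
  have hm : ∀ k, MeasurableSet (T.develTet k '' openTetrahedron) := fun k =>
    isOpen_openTetrahedron.measurableSet.image_of_continuousOn_injOn (T.continuousOn_develTet k)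
      (T.injOn_develTet k)
  have e1 : (μHE[3] : Measure T.Glued) (⋃ k, T.develTet k '' openTetrahedron) =
      T.numTet * (μHE[3] : Measure HypSpace) regularIdealTetrahedron := by
    rw [measure_iUnion hd hm, tsum_fintype, measure_regularIdealTetrahedron]
    simp only [measure_develTet, Finset.sum_const, Finset.card_univ, Fintype.card_fin, nsmul_eq_mul]
  rw [← e1]
  refine le_antisymm ?_ (measure_mono (Set.subset_univ _))
  have h0 : (μHE[3] : Measure T.Glued)
      (⋃ k, T.develTet k '' ({p | ∃ i, bary p i = 0} ∩ regularIdealTetrahedron)) = 0 :=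
    measure_iUnion_null fun k => euclideanHausdorffMeasure_image_eq_zero
      ((T.lipschitzOnWith_develTet k).mono Set.inter_subset_right) 3
      (measure_mono_null Set.inter_subset_left measure_faces)
  rw [← add_zero ((μHE[3] : Measure T.Glued) (⋃ k, T.develTet k '' openTetrahedron)), ← h0]
  refine (measure_mono fun y _ => ?_).trans (measure_union_le _ _)
  obtain ⟨k, a, rfl⟩ := T.toGlued_surjective y
  have ha : straight a ∈ regularIdealTetrahedron := by
    rw [← range_straight_eq]; exact Set.mem_range_self a
  have e : T.develTet k (straight a) = T.toGlued k a := by rw [develTet, toSimplex_straight]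
  rcases regularIdealTetrahedron_subset ha with h | h
  · exact Or.inl (Set.mem_iUnion.2 ⟨k, straight a, h, e⟩)
  · exact Or.inr (Set.mem_iUnion.2 ⟨k, straight a, ⟨h, ha⟩, e⟩)

/-! ## The hyperbolic cone-manifold structure -/

/-- The structure that makes every simplex a regular ideal tetrahedron. -/
def gluedStructure (hT : T.Orientable) : HyperbolicConeStructure N where
  metric := T.gluedMetric
  induces_top := T.gluedMetric_topology_eq
  isConeManifold := by
    refine ⟨T.isLengthMetric_glued, fun (x : T.Glued) => ?_⟩
    obtain ⟨k, t, rfl⟩ := T.toGlued_surjective x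
    by_cases h : ∀ i j, i ≠ j → t.1 i = 0 → t.1 j ≠ 0
    · exact Or.inl (isHyperbolicPoint_of_nonEdge k h)
    · push Not at h
      obtain ⟨i, j, hij, hi, hj⟩ := h
      exact Or.inr (exists_isConePoint hT hij hi hj)

lemma isComplete_gluedStructure (hT : T.Orientable) : (T.gluedStructure hT).IsComplete :=
  inferInstanceAs (CompleteSpace T.Glued)

lemma singularLocus_gluedStructure_subset (hT : T.Orientable) :
    (T.gluedStructure hT).singularLocus ⊆ T.oneSkeleton := by
  intro (x : T.Glued) hx
  obtain ⟨k, t, rfl⟩ := T.toGlued_surjective x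
  by_contra h
  refine hx (isHyperbolicPoint_of_nonEdge k fun i j hij hi hj => h ⟨k, t, rfl, i, j, hij, hi, hj⟩)

lemma volume_gluedStructure (hT : T.Orientable) : (T.gluedStructure hT).volume =
    T.numTet * volume3 HypSpace regularIdealTetrahedron :=
  T.measure_glued

lemma tetrahedraRegular_gluedStructure (hT : T.Orientable) :
    (T.gluedStructure hT).TetrahedraRegular T := fun k _ ht => T.exists_nhds_edist_eq k ht

end IdealTriangulation
end

theorem mainTheorem4 {N : Type*} [TopologicalSpace N] [Nonempty N]
    (T : IdealTriangulation N) (hT : T.Orientable) :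
    NoncompactSpace N ∧
      ∃ S : HyperbolicConeStructure N,
        S.IsComplete ∧
        S.singularLocus ⊆ T.oneSkeleton ∧
        S.volume = T.numTet * volume3 HypSpace HypSpace.regularIdealTetrahedron ∧
        S.TetrahedraRegular T :=
  ⟨T.noncompactSpace, T.gluedStructure hT, T.isComplete_gluedStructure hT,
    T.singularLocus_gluedStructure_subset hT, T.volume_gluedStructure hT,
    T.tetrahedraRegular_gluedStructure hT⟩
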